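/- Conventions. $\eta=\mathrm{diag}(-1,1,\dots,1)$; $\Gamma_0,\dots,\Gamma_5,\Gamma_{5'},\Gamma_6,\dots,\Gamma_9$ are the Clifford generators of the Majorana representation $\mathbf{32}$ of $\mathrm{Pin}^+(1,10)$, with $\Gamma_a\Gamma_b+\Gamma_b\Gamma_a=2\eta_{ab}$ and $\Gamma_0\cdots\Gamma_5\Gamma_{5'}\cdots\Gamma_9=1$; $(\overline{\phi}\,\psi)$ is the nondegenerate skew-symmetric spinor pairing for which all $\Gamma_a$ are skew self-adjoint. Indices $0,\dots,5$ are tangential, $5',6,7,8,9$ transversal; $\gamma_a:=\Gamma_a$ for tangential $a$; $P:=\tfrac12(1+\Gamma_{5'6789})$, $\overline P:=1-P$. In 6d, $(\star H)_{a_1a_2a_3}:=\tfrac1{3!}\epsilon_{a_1a_2a_3b_1b_2b_3}H^{b_1b_2b_3}$ with the orientation $\epsilon^{012345}=+1$ (i.e. $\epsilon_{012345}=-1$), and $(H^2)_a^b:=H_{a\,c_1c_2}H^{c_1c_2\,b}$. Differential forms are bigraded by form degree and parity: elements of bidegrees $(n,s)$, $(n',s')$ commute up to $(-1)^{nn'+ss'}$.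 Setting. Let $\phi:\Sigma\to X$ be a map of smooth supermanifolds of dimensions $(6\,|\,16)$ and $(11\,|\,32)$. Let $(E,\Psi)$ be a super co-frame field on (an open part of) $X$ modelled on $\mathbb{R}^{1,10|\mathbf{32}}$ with an $\mathfrak{so}(1,10)$-valued connection $\Omega$. Suppose that $(E,\Psi)$ is super-Darboux for $\phi$ over a given open part of $\Sigma$ (M5-brane super-immersion): $(e,\psi):=\phi^*(PE,P\Psi)$ is a super co-frame field modelled on $\mathbb{R}^{1,5|P(\mathbf{32})}$, and $\phi^*(\overline P E,\overline P\Psi)$ is obtained from it by a super-shear map, the same in all transversal $\mathrm{Spin}(5)$-gauges. Its odd-odd component is denoted $\tilde{\mathsf H}:P(\mathbf{32})\to\overline P(\mathbf{32})$ and its component from tangent vectors to $\overline P(\mathbf{32})$ is denoted $\tau$, so that $$\phi^*\Psi=\psi+\tilde{\mathsf H}\psi+\tau_a e^a .$$ (Gauge independence is not demanded of $\tau$, as it would force $\tau=0$; this case is included.) Put $\omega^a{}_b:=\phi^*\Omega^a{}_b$ for tangential $a,b$, and define the second fundamental super-form by $\phi^*\Omega^a{}_b=e^{b'}\mathrm{II}^a_{b'b}+\psi^\beta\,\mathrm{II}^a_{\beta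 b}$ for transversal $a$ and tangential $b$, where $\mathrm{II}^a_{\beta b}$ is a linear form on $P(\mathbf{32})$ in the index $\beta$. The pulled-back torsion constraint is $$\big(\overline{\phi^*\Psi}\,\Gamma^a\,\phi^*\Psi\big)=\mathrm{d}\,\phi^*E^a+\phi^*\Omega^a{}_b\,\phi^*E^b .$$ Statement. The pulled-back torsion constraint for all transversal $a$ is equivalent to the conjunction of: (i) $\mathrm{II}^a_{b_1b_2}=\mathrm{II}^a_{b_2b_1}$ for all transversal $a$ and tangential $b_1,b_2$; (ii) $(\tau_b)_\alpha=\tfrac12(\Gamma_a\mathrm{II})^a_{\alpha b}$ for each of the five transversal $a$ (no summation over $a$) and all tangential $b$, where $(\tau_b)_\alpha$ is $\tau_b$ with its index lowered by the spinor pairing; (iii) $\tilde{\mathsf H}=\tilde{\mathsf H}_3:=\tfrac1{3!}(\tilde H_3)_{a_1a_2a_3}\gamma^{a_1a_2a_3}$ on $P(\mathbf{32})$, for some $\tilde H_3$ with $\tilde H_3=\star\tilde H_3$. Moreover, for any such $\tilde H_3$ (that is, $\tilde H_3=\star\tilde H_3$ and $\tilde{\mathsf H}=\tilde{\mathsf H}_3$),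 the pulled-back torsion constraint for all tangential $a$ is equivalent to (iv) for all tangential $a$, $$\mathrm{d}e^a+\omega^a{}_b\,e^b=(\overline{\tau_{b_1}}\gamma^a\tau_{b_2})\,e^{b_1}e^{b_2}-2\,(\overline{\tau_b}\,\gamma^a\tilde{\mathsf H}_3\,\psi)\,e^b+\big(\delta^a_{a'}-2(\tilde H_3^2)^a_{a'}\big)\,(\overline\psi\,\gamma^{a'}\psi).$$ -/

import Mathlib

universe u v

noncomputable section

open scoped Manifold ContDiff
open CategoryTheory TopologicalSpace

namespace M5

/-! ### Supercommutative algebras, super-derivations, differential forms -/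

/-- A supercommutative real algebra.  The `ℤ/2`-grading is encoded by the parity automorphism `σ`
(`+1` on even elements, `-1` on odd elements). -/
class SuperCommAlgebra (A : Type*) [Ring A] [Algebra ℝ A] where
  σ : A →ₐ[ℝ] A
  σ_σ : ∀ f, σ (σ f) = f
  even_comm : ∀ f g, σ f = f → f * g = g * f
  odd_comm : ∀ f g, σ f = -f → f * g = σ g * f

section Algebra

variable {A : Type*} [Ring A] [Algebra ℝ A] [SuperCommAlgebra A]

/-- `sg i f = (-1)^(i |f|) f`. -/
def sg (i : Fin 2) : A →ₐ[ℝ] A := if i = 0 then AlgHom.id ℝ A else SuperCommAlgebra.σ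

/-- The sign `(-1)^i`. -/
def sn (i : Fin 2) : ℝ := if i = 0 then 1 else -1

/-- `f` is homogeneous of parity `i`. -/
def HasParity (i : Fin 2) (f : A) : Prop := SuperCommAlgebra.σ f = sn i • f

/-- `D` is a super-derivation of `A` that is homogeneous of parity `i`. -/
structure IsSuperDer (i : Fin 2) (D : A →ₗ[ℝ] A) : Prop where
  parity : ∀ f, SuperCommAlgebra.σ (D f) = sn i • D (SuperCommAlgebra.σ f)
  leibniz : ∀ f g, D (f * g) = D f * g + sg i f * D g

theorem IsSuperDer.add {i : Fin 2} {D D' : A →ₗ[ℝ] A} (h : IsSuperDer i D)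
    (h' : IsSuperDer i D') : IsSuperDer i (D + D') where
  parity f := by simp [h.parity, h'.parity]
  leibniz f g := by
    simp only [LinearMap.add_apply, h.leibniz, h'.leibniz, add_mul, mul_add]; abel

theorem IsSuperDer.zero (i : Fin 2) : IsSuperDer i (0 : A →ₗ[ℝ] A) where
  parity f := by simp
  leibniz f g := by simp

theorem IsSuperDer.smul {i j : Fin 2} {f : A} {D : A →ₗ[ℝ] A} (hf : HasParity j f)
    (h : IsSuperDer i D) : IsSuperDer (j + i) (f • D) where
  parity g := by
    have h1 := h.parity g
    unfold HasParity at hf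
    simp only [LinearMap.smul_apply, smul_eq_mul, map_mul, hf, h1]
    fin_cases i <;> fin_cases j <;> simp [sn]
  leibniz g k := by
    have hl := h.leibniz g k
    unfold HasParity at hf
    have hc : f * sg i g = sg (j + i) g * f := by
      fin_cases j
      · have hf' : SuperCommAlgebra.σ f = f := by simpa [sn] using hf
        simpa using SuperCommAlgebra.even_comm f (sg i g) hf'
      · have hf' : SuperCommAlgebra.σ f = -f := by simpa [sn] using hf
        rw [SuperCommAlgebra.odd_comm f (sg i g) hf']
        fin_cases i <;> simp [sg, SuperCommAlgebra.σ_σ]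
    simp only [LinearMap.smul_apply, smul_eq_mul, hl, mul_add, ← mul_assoc, hc]

/-- The super-commutator of homogeneous super-derivations. -/
theorem IsSuperDer.bracket {i j : Fin 2} {D D' : A →ₗ[ℝ] A} (h : IsSuperDer i D)
    (h' : IsSuperDer j D') : IsSuperDer (i + j) (D ∘ₗ D' - sn (i * j) • D' ∘ₗ D) where
  parity f := by
    simp only [LinearMap.sub_apply, LinearMap.comp_apply, LinearMap.smul_apply, map_sub,
      map_smul, h.parity, h'.parity]
    fin_cases i <;> fin_cases j <;> simp [sn] <;> abel
  leibniz f g := by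
    have e1 : ∀ k : Fin 2, ∀ x : A, SuperCommAlgebra.σ (sg k x) = sg k (SuperCommAlgebra.σ x) := by
      intro k x; fin_cases k <;> simp [sg]
    simp only [LinearMap.sub_apply, LinearMap.comp_apply, LinearMap.smul_apply, map_add,
      h.leibniz, h'.leibniz]
    have p1 := h.parity f
    have p2 := h'.parity f
    fin_cases i <;> fin_cases j <;>
      simp [sn, sg, SuperCommAlgebra.σ_σ] at p1 p2 ⊢ <;>
      simp [p1, p2, add_mul, mul_add, sub_mul, mul_sub] <;> abel

variable (A) in
/-- The left `A`-module of super-derivations (super vector fields) of `A`. -/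
def Der : Submodule A (A →ₗ[ℝ] A) where
  carrier := {D | ∃ D₀ D₁, IsSuperDer 0 D₀ ∧ IsSuperDer 1 D₁ ∧ D = D₀ + D₁}
  add_mem' := by
    rintro _ _ ⟨a, b, ha, hb, rfl⟩ ⟨c, d, hc, hd, rfl⟩
    exact ⟨a + c, b + d, ha.add hc, hb.add hd, by abel⟩
  zero_mem' := ⟨0, 0, IsSuperDer.zero 0, IsSuperDer.zero 1, by simp⟩
  smul_mem' := by
    rintro f _ ⟨a, b, ha, hb, rfl⟩
    have h0 : HasParity 0 ((1 / 2 : ℝ) • (f + SuperCommAlgebra.σ f)) := by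
      simp [HasParity, sn, SuperCommAlgebra.σ_σ, add_comm]
    have h1 : HasParity 1 ((1 / 2 : ℝ) • (f - SuperCommAlgebra.σ f)) := by
      simp [HasParity, sn, SuperCommAlgebra.σ_σ, ← smul_neg]
    have a0 := IsSuperDer.smul h0 ha
    have a1 := IsSuperDer.smul h1 ha
    have b0 := IsSuperDer.smul h0 hb
    have b1 := IsSuperDer.smul h1 hb
    simp only [show (0 : Fin 2) + 0 = 0 from rfl, show (1 : Fin 2) + 0 = 1 from rfl,
      show (0 : Fin 2) + 1 = 1 from rfl, show (1 : Fin 2) + 1 = 0 from rfl] at a0 a1 b0 b1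
    have k0 := a0.add b1
    have k1 := b0.add a1
    refine ⟨_, _, k0, k1, ?_⟩
    have hf : f = (1 / 2 : ℝ) • (f + SuperCommAlgebra.σ f)
        + (1 / 2 : ℝ) • (f - SuperCommAlgebra.σ f) := by
      rw [← smul_add, add_add_sub_cancel, ← two_smul ℝ f, smul_smul]; norm_num
    conv_lhs => rw [hf]
    simp only [add_smul, smul_add]
    abel

variable (A) in
/-- Homogeneous super-derivations of parity `i`. -/
def HDer (i : Fin 2) : Type _ := {D : A →ₗ[ℝ] A // IsSuperDer i D}

/-- A homogeneous super-derivation as an element of the module of all super-derivations. -/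
def HDer.toDer {i : Fin 2} (D : HDer A i) : Der A :=
  ⟨D.1, by
    obtain ⟨D, hD⟩ := D
    fin_cases i
    · exact ⟨D, 0, hD, IsSuperDer.zero 1, by simp⟩
    · exact ⟨0, D, IsSuperDer.zero 0, hD, by simp⟩⟩

/-- The super-commutator `[D, D'] = D D' - (-1)^(|D||D'|) D' D`. -/
def HDer.bracket {i j : Fin 2} (D : HDer A i) (D' : HDer A j) : HDer A (i + j) :=
  ⟨D.1 ∘ₗ D'.1 - sn (i * j) • D'.1 ∘ₗ D.1, D.2.bracket D'.2⟩

variable (A) in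
/-- Differential 1-forms: the dual of the module of super vector fields.
The value `α D` is the contraction `ι_D α`, so that `ι_{fD} α = f ι_D α`.
Forms are bigraded by (form degree, parity) and the contraction `ι_D` has bidegree `(-1, |D|)`;
elements of bidegrees `(n, s)`, `(n', s')` commute up to the sign `(-1)^(n n' + s s')`. -/
abbrev OneForm : Type _ := Der A →ₗ[A] A

/-- The product `α f` of a 1-form with a function on the right. -/
def OneForm.rmul (α : OneForm A) (f : A) : OneForm A where
  toFun D := α D * f
  map_add' := by simp [add_mul]
  map_smul' := by simp [mul_assoc]

/-- `α` is a 1-form of parity `i`. -/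
def OneForm.HasParity (i : Fin 2) (α : OneForm A) : Prop :=
  ∀ (j : Fin 2) (D : HDer A j), M5.HasParity (i + j) (α D.toDer)

/-- The differential of a function, `ι_D (d f) = D f`. -/
def dFun (f : A) : OneForm A where
  toFun D := D.1 f
  map_add' := by simp
  map_smul' := by simp

variable (A) in
/-- A 2-form `w` is recorded by the functions `w i j D D' = ι_{D'} ι_D w` for homogeneous
super-derivations `D`, `D'` of parities `i`, `j`, which determine it. -/
abbrev TwoForm : Type _ := (i j : Fin 2) → HDer A i → HDer A j → A

/-- The wedge product of 1-forms:
`ι_D (α β) = (ι_D α) β - (-1)^(|D||α|) α (ι_D β)`, contracted once more with `D'`. -/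
def wedge (α β : OneForm A) : TwoForm A := fun i j D D' =>
  sg j (α D.toDer) * β D'.toDer - sn (i * j) • (sg i (α D'.toDer) * β D.toDer)

/-- The de Rham differential of 1-forms, by Cartan's formula
`ι_{D'} ι_D d α = (-1)^(|D||D'|) (D (ι_{D'} α) - ι_{[D, D']} α) - D' (ι_D α)`. -/
def d (α : OneForm A) : TwoForm A := fun i j D D' =>
  sn (i * j) • (D.1 (α D'.toDer) - α (D.bracket D').toDer) - D'.1 (α D.toDer)

/-- The product `w f` of a 2-form with a function on the right. -/
def TwoForm.rmul (w : TwoForm A) (f : A) : TwoForm A := fun i j D D' => w i j D D' * f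

/-- The product `f w` of a 2-form with a function on the left. -/
def TwoForm.lmul (f : A) (w : TwoForm A) : TwoForm A := fun i j D D' =>
  sg (i + j) f * w i j D D'

/-- `α'` is the pullback of the 1-form `α` along the superalgebra map `Φ`:
`Φ^* (∑ d f_k · g_k) = ∑ d (Φ f_k) · Φ g_k`. -/
def IsPullback {B : Type*} [Ring B] [Algebra ℝ B] [SuperCommAlgebra B] (Φ : B →ₐ[ℝ] A)
    (α : OneForm B) (α' : OneForm A) : Prop :=
  ∃ (n : ℕ) (f g : Fin n → B), α = ∑ k, (dFun (f k)).rmul (g k) ∧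
    α' = ∑ k, (dFun (Φ (f k))).rmul (Φ (g k))

end Algebra

/-! ### Supermanifolds -/

/-- The Grassmann algebra on `q` generators. -/
abbrev Grassmann (q : ℕ) : Type := ExteriorAlgebra ℝ (Fin q → ℝ)

/-- A smooth supermanifold of dimension `(p|q)`: a smooth `p`-manifold `M` with a sheaf of
supercommutative algebras that is locally isomorphic to the sheaf of smooth functions with values
in the Grassmann algebra on `q` generators. -/
structure Supermanifold (p q : ℕ) where
  M : TopCat.{u}
  [t2 : T2Space M]
  [secondCountable : SecondCountableTopology M]
  [charted : ChartedSpace (EuclideanSpace ℝ (Fin p)) M]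
  [smooth : IsManifold (𝓡 p) ∞ M]
  sheaf : TopCat.Sheaf (AlgCat.{u} ℝ) M
  parity : sheaf.obj ⟶ sheaf.obj
  parity_parity : parity ≫ parity = 𝟙 _
  even_comm : ∀ (U : Opens M) (f g : sheaf.obj.obj (.op U)),
    (parity.app (.op U)).hom f = f → f * g = g * f
  odd_comm : ∀ (U : Opens M) (f g : sheaf.obj.obj (.op U)),
    (parity.app (.op U)).hom f = -f → f * g = (parity.app (.op U)).hom g * f
  locally_split : ∀ x : M, ∃ U : Opens M, x ∈ U ∧
    ∃ c : ∀ W : Opens M, W ≤ U → (sheaf.obj.obj (.op W) →ₐ[ℝ] (W → Grassmann q)),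
      (∀ (W : Opens M) hW, Function.Injective (c W hW)) ∧
      (∀ (W : Opens M) hW (F : W → Grassmann q), F ∈ Set.range (c W hW) ↔
        ∀ ℓ : Module.Dual ℝ (Grassmann q),
          ContMDiff (𝓡 p) 𝓘(ℝ, ℝ) ∞ (fun w : W => ℓ (F w))) ∧
      (∀ (W W' : Opens M) hW hW' (i : W' ⟶ W) f (w : W'),
        c W' hW' ((sheaf.obj.map i.op).hom f) w = c W hW f ⟨w, leOfHom i w.2⟩) ∧
      (∀ (W : Opens M) hW f w, c W hW ((parity.app (.op W)).hom f) w = CliffordAlgebra.involute (c W hW f w))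

namespace Supermanifold

/-- The algebra of functions of a supermanifold on an open subset. -/
abbrev fn {p q : ℕ} (X : Supermanifold.{u} p q) (U : Opens X.M) : Type u :=
  X.sheaf.obj.obj (.op U)

instance {p q : ℕ} (X : Supermanifold.{u} p q) (U : Opens X.M) : SuperCommAlgebra (X.fn U) where
  σ := (X.parity.app (.op U)).hom
  σ_σ f := by
    have h := congrArg (fun t => (t.app (.op U)).hom f) X.parity_parity
    simpa using h
  even_comm := X.even_comm U
  odd_comm := X.odd_comm U

/-- Restriction of functions to a smaller open subset. -/
def res {p q : ℕ} (X : Supermanifold.{u} p q) {U W : Opens X.M} (h : W ≤ U) :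
    X.fn U →ₐ[ℝ] X.fn W := (X.sheaf.obj.map (homOfLE h).op).hom

/-- Maps of supermanifolds: continuous maps with a pullback of functions that is compatible
with restrictions and with parity. -/
structure Hom {p q p' q' : ℕ} (S : Supermanifold.{u} p q) (X : Supermanifold.{v} p' q') where
  base : C(S.M, X.M)
  pull : ∀ V : Opens X.M, X.fn V →ₐ[ℝ] S.fn (V.comap base)
  pull_res : ∀ {V W : Opens X.M} (h : W ≤ V) (f : X.fn V),
    pull W (X.res h f) = S.res (Opens.comap_mono base h) (pull V f)
  pull_parity : ∀ (V : Opens X.M) (f : X.fn V),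
    pull V (SuperCommAlgebra.σ f) = SuperCommAlgebra.σ (pull V f)

/-- Pullback of functions from an open `V` to an open `U` contained in the preimage of `V`. -/
def Hom.pullTo {p q p' q' : ℕ} {S : Supermanifold.{u} p q} {X : Supermanifold.{v} p' q'}
    (φ : S.Hom X) {U : Opens S.M} {V : Opens X.M} (h : U ≤ V.comap φ.base) :
    X.fn V →ₐ[ℝ] S.fn U := (S.res h).comp (φ.pull V)

end Supermanifold

/-! ### Spinors in 11 dimensions and their projection to 6 dimensions -/

/-- Frame indices in 11d: `Sum.inl` of `0, …, 5` are the tangential ones,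
`Sum.inr` of `0, …, 4` are the transversal ones `5', 6, 7, 8, 9`. -/
abbrev Idx : Type := Fin 6 ⊕ Fin 5

/-- The diagonal entries of the Minkowski metric `diag (-1, 1, …, 1)`. -/
def η (a : Idx) : ℝ := if a = Sum.inl 0 then -1 else 1

/-- The Minkowski metric on tangential indices. -/
def ηt (a : Fin 6) : ℝ := η (Sum.inl a)

abbrev Mat : Type := Matrix (Fin 32) (Fin 32) ℝ

/-- The Majorana representation `32` of `Pin⁺(1,10)`, in an arbitrary linear basis: Clifford
generators `Γ_a`, and the matrix `C` of the nondegenerate skew-symmetric spinor pairing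
`(φ̄ ψ) = φᵀ C ψ`. -/
structure Majorana where
  Γ : Idx → Mat
  C : Mat
  clifford : ∀ a b, Γ a * Γ b + Γ b * Γ a = if a = b then (2 * η a) • 1 else 0
  volume : (List.ofFn fun i => Γ (Sum.inl i)).prod * (List.ofFn fun i => Γ (Sum.inr i)).prod = 1
  skew : C.transpose = -C
  nondegenerate : IsUnit C.det
  adjoint : ∀ a, (Γ a).transpose * C = -(C * Γ a)

namespace Majorana

variable (R : Majorana)

/-- `Γ^a`, with the index raised. -/
def Γup (a : Idx) : Mat := η a • R.Γ a

/-- The tangential generators `γ^a`, with the index raised. -/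
def γup (a : Fin 6) : Mat := R.Γup (Sum.inl a)

/-- The projector `P = (1 + Γ_{5'6789}) / 2`. -/
def P : Mat := (1 / 2 : ℝ) • (1 + (List.ofFn fun i => R.Γ (Sum.inr i)).prod)

/-- The complementary projector `P̄ = 1 - P`. -/
def Pbar : Mat := 1 - R.P

/-- The skew-symmetrized product `γ^{a₁ a₂ a₃}`. -/
def γ3up (a : Fin 3 → Fin 6) : Mat :=
  (1 / 6 : ℝ) • ∑ s : Equiv.Perm (Fin 3),
    ((Equiv.Perm.sign s : ℤ) : ℝ) • (R.γup (a (s 0)) * R.γup (a (s 1)) * R.γup (a (s 2)))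

/-- The unit-vector Clifford element `v^a Γ_a`, for transversal `v`. -/
def cliff (v : Fin 5 → ℝ) : Mat := ∑ a, v a • R.Γ (Sum.inr a)

/-- The image of the transversal group `Spin(5)` in the endomorphisms of `32`: products of evenly
many transversal unit vectors. -/
def spin5 : Submonoid Mat :=
  Submonoid.closure
    {x | ∃ v w : Fin 5 → ℝ, ∑ a, v a ^ 2 = 1 ∧ ∑ a, w a ^ 2 = 1 ∧ x = R.cliff v * R.cliff w}

/-- `T ∈ Spin(5)`, and `r` is the transversal rotation that it covers:
`T Γ_b T⁻¹ = ∑ r^a_b Γ_a`. -/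
structure IsTransversalSpin (T : Mat) (r : Matrix (Fin 5) (Fin 5) ℝ) : Prop where
  mem : T ∈ R.spin5
  covers : ∀ b, T * R.Γ (Sum.inr b) = (∑ a, r a b • R.Γ (Sum.inr a)) * T

end Majorana

/-! ### Tensors in 6 dimensions -/

/-- The Levi-Civita symbol `ε^{a₁ … a₆}` with upper indices, with `ε^{0 1 2 3 4 5} = 1`. -/
def epsUp (a : Fin 6 → Fin 6) : ℝ := Matrix.det (Matrix.of fun i j => if a i = j then (1 : ℝ) else 0)

/-- The Levi-Civita symbol `ε_{a₁ … a₆}`, with indices lowered by the Minkowski metric. -/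
def epsDown (a : Fin 6 → Fin 6) : ℝ := (∏ i, ηt (a i)) * epsUp a

section Tensors

variable {A : Type*} [Ring A] [Algebra ℝ A] [SuperCommAlgebra A]

/-- A superfield of rank-3 skew-symmetric tensors (the components of a bosonic 3-form). -/
structure IsThreeForm (H : Fin 6 → Fin 6 → Fin 6 → A) : Prop where
  even : ∀ a b c, HasParity 0 (H a b c)
  skew₁₂ : ∀ a b c, H a b c = -H b a c
  skew₂₃ : ∀ a b c, H a b c = -H a c b

/-- `H^{abc}`, all indices raised. -/
def raise3 (H : Fin 6 → Fin 6 → Fin 6 → A) (a b c : Fin 6) : A := (ηt a * ηt b * ηt c) • H a b c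

/-- The Hodge dual, `(⋆H)_{a₁a₂a₃} = (1/3!) ε_{a₁a₂a₃b₁b₂b₃} H^{b₁b₂b₃}`. -/
def hodge (H : Fin 6 → Fin 6 → Fin 6 → A) (a₁ a₂ a₃ : Fin 6) : A :=
  (1 / 6 : ℝ) • ∑ b₁, ∑ b₂, ∑ b₃, epsDown ![a₁, a₂, a₃, b₁, b₂, b₃] • raise3 H b₁ b₂ b₃

/-- `(H²)_a^b = H_{a c₁ c₂} H^{c₁ c₂ b}`. -/
def sq (H : Fin 6 → Fin 6 → Fin 6 → A) (a b : Fin 6) : A :=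
  ∑ c₁, ∑ c₂, H a c₁ c₂ * raise3 H c₁ c₂ b

/-- Real matrices as matrices of functions. -/
def toFn (M : Mat) : Matrix (Fin 32) (Fin 32) A := M.map (algebraMap ℝ A)

/-- `(1/3!) H_{abc} γ^{abc}`. -/
def slash (R : Majorana) (H : Fin 6 → Fin 6 → Fin 6 → A) : Matrix (Fin 32) (Fin 32) A :=
  Matrix.of fun α β => (1 / 6 : ℝ) • ∑ a, ∑ b, ∑ c, R.γ3up ![a, b, c] α β • H a b c

/-- Real matrices acting on spinor-valued 1-forms. -/
def act (M : Mat) (Ψ : Fin 32 → OneForm A) (α : Fin 32) : OneForm A := ∑ β, M α β • Ψ β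

/-- The 2-form `(Ψ̄ M Ψ')`. -/
def pairForm (R : Majorana) (M : Mat) (Ψ Ψ' : Fin 32 → OneForm A) : TwoForm A :=
  ∑ α, ∑ β, (R.C * M) α β • wedge (Ψ α) (Ψ' β)

/-- The function `(χ̄ M χ')`. -/
def pairFn (R : Majorana) (M : Mat) (χ χ' : Fin 32 → A) : A :=
  ∑ α, ∑ β, (R.C * M) α β • (χ α * χ' β)

/-! ### Super co-frames, super-spacetimes and M5-brane super-immersions -/

/-- `(e, ψ)` is a super co-frame field modelled on `ℝ^{ι | Q(32)}`: `e` is even, `ψ` is odd and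
valued in the image of the projector `Q`, and together they identify the super vector fields with
functions valued in the model space. -/
structure IsCoframe {ι : Type*} (Q : Mat) (e : ι → OneForm A) (ψ : Fin 32 → OneForm A) : Prop where
  even : ∀ a, (e a).HasParity 0
  odd : ∀ α, (ψ α).HasParity 1
  proj : act Q ψ = ψ
  bijective : ∀ (u : ι → A) (v : Fin 32 → A), (∀ α, ∑ β, Q α β • v β = v α) →
    ∃! D : Der A, (∀ a, e a D = u a) ∧ ∀ α, ψ α D = v α

/-- Super-spacetime geometry: a super co-frame field `(E, Ψ)` modelled on `ℝ^{1,10|32}` with an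
`so(1,10)`-valued connection 1-form `Ω^a_b`.  The torsion constraint is not part of this. -/
structure IsSpacetime (E : Idx → OneForm A) (Ψ : Fin 32 → OneForm A)
    (Ω : Idx → Idx → OneForm A) : Prop where
  coframe : IsCoframe 1 E Ψ
  even : ∀ a b, (Ω a b).HasParity 0
  skew : ∀ a b, η b • Ω a b = -(η a • Ω b a)

/-- The super-Darboux condition on the pulled-back co-frame `(E, Ψ) = φ^*(E, Ψ)` of an M5-brane
super-immersion: in every transversal `Spin(5)`-gauge `(r E, T Ψ)` the tangential part is a super
co-frame on the worldvolume, and the transversal part is obtained from it by the super-shear map,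
whose components are `Sh00`, `Sh01`, the odd-odd component `H` (mapping `P(32)` to `P̄(32)`),
and `τ`.  Gauge-independence is imposed on all components but `τ` (for `τ` it would force
`τ = 0`), so that the case of nonvanishing `τ` is included. -/
structure IsM5Immersion (R : Majorana) (E : Idx → OneForm A) (Ψ : Fin 32 → OneForm A)
    (Sh00 : Fin 5 → Fin 6 → A) (Sh01 : Fin 5 → Fin 32 → A)
    (H : Matrix (Fin 32) (Fin 32) A) (τ : Fin 6 → Fin 32 → A) : Prop where
  parity00 : ∀ a b, HasParity 0 (Sh00 a b)
  parity01 : ∀ a β, HasParity 1 (Sh01 a β)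
  parity11 : ∀ α β, HasParity 0 (H α β)
  parity10 : ∀ b α, HasParity 1 (τ b α)
  dom01 : ∀ a α, ∑ β, R.P β α • Sh01 a β = Sh01 a α
  dom11 : toFn R.Pbar * H * toFn R.P = H
  cod10 : ∀ b α, ∑ β, R.Pbar α β • τ b β = τ b α
  coframe : ∀ T r, R.IsTransversalSpin T r →
    IsCoframe R.P (fun a => E (Sum.inl a)) (act R.P (act T Ψ))
  bosonic : ∀ T r, R.IsTransversalSpin T r → ∀ a,
    ∑ b, r a b • E (Sum.inr b) =
      ∑ c, (E (Sum.inl c)).rmul (Sh00 a c) + ∑ β, (act R.P (act T Ψ) β).rmul (Sh01 a β)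
  fermionic : ∀ T r, R.IsTransversalSpin T r → ∃ τ' : Fin 6 → Fin 32 → A, ∀ α,
    act R.Pbar (act T Ψ) α =
      ∑ β, (act R.P (act T Ψ) β).rmul (H α β) + ∑ b, (E (Sum.inl b)).rmul (τ' b α)
  shear : ∀ α, act R.Pbar Ψ α =
      ∑ β, (act R.P Ψ β).rmul (H α β) + ∑ b, (E (Sum.inl b)).rmul (τ b α)

/-- `II0 a b₁ b₂ = II^a_{b₁ b₂}` and `II1 a β b = II^a_{β b}` (a linear form on `P(32)` in the
index `β`) are the components of the second fundamental super-form: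
`φ^* Ω^a_b = e^{b'} II^a_{b' b} + ψ^β II^a_{β b}` for transversal `a` and tangential `b`. -/
structure IsSecondFundamental (R : Majorana) (e : Fin 6 → OneForm A) (ψ : Fin 32 → OneForm A)
    (Ω : Idx → Idx → OneForm A) (II0 : Fin 5 → Fin 6 → Fin 6 → A)
    (II1 : Fin 5 → Fin 32 → Fin 6 → A) : Prop where
  dom : ∀ a α b, ∑ β, R.P β α • II1 a β b = II1 a α b
  expand : ∀ a b, Ω (Sum.inr a) (Sum.inl b) =
    ∑ b', (e b').rmul (II0 a b' b) + ∑ β, (ψ β).rmul (II1 a β b)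

/-- The component `a` of the torsion constraint `(Ψ̄ Γ^a Ψ) = d E^a + Ω^a_b E^b`. -/
def TorsionConstraint (R : Majorana) (E : Idx → OneForm A) (Ψ : Fin 32 → OneForm A)
    (Ω : Idx → Idx → OneForm A) (a : Idx) : Prop :=
  pairForm R (R.Γup a) Ψ Ψ = d (E a) + ∑ b, wedge (Ω a b) (E b)

/-- `(Γ_a II)^a_{α b}`, without summation over the transversal index `a`; the matrix
`C Γ_a C⁻¹` is `Γ_a` with its spinor indices in the position `(Γ_a)_α^β`. -/
def ΓII (R : Majorana) (II1 : Fin 5 → Fin 32 → Fin 6 → A) (a : Fin 5) (α : Fin 32) (b : Fin 6) :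
    A := ∑ β, (R.C * R.Γ (Sum.inr a) * R.C⁻¹) α β • II1 a β b

/-- A spinor with its index lowered by the spinor pairing, `χ_α = C_{αβ} χ^β`. -/
def lower (R : Majorana) (χ : Fin 32 → A) (α : Fin 32) : A := ∑ β, R.C α β • χ β

/-- The formula for the worldvolume torsion `d e^a + ω^a_b e^b`, where `Ωt` is the tangential
connection `ω`. -/
def WorldvolumeTorsion (R : Majorana) (e : Fin 6 → OneForm A) (ψ : Fin 32 → OneForm A)
    (Ωt : Fin 6 → Fin 6 → OneForm A) (τ : Fin 6 → Fin 32 → A)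
    (H : Fin 6 → Fin 6 → Fin 6 → A) (a : Fin 6) : Prop :=
  d (e a) + ∑ b, wedge (Ωt a b) (e b) =
    (∑ b₁, ∑ b₂, TwoForm.lmul (pairFn R (R.γup a) (τ b₁) (τ b₂)) (wedge (e b₁) (e b₂)))
    - (2 : ℝ) • (∑ b, ∑ α, ∑ β, ∑ κ, (R.C * R.γup a) α β •
        TwoForm.lmul (τ b α * slash R H β κ) (wedge (ψ κ) (e b)))
    + ∑ a', TwoForm.lmul ((if a = a' then 1 else 0) - (2 : ℝ) • sq H a' a)
        (pairForm R (R.γup a') ψ ψ)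

end Tensors

end M5

end

noncomputable section

open scoped Manifold ContDiff
open CategoryTheory TopologicalSpace

namespace M5

/-! Gauge independence does most of the geometric work. The element `-1` of `Spin(5)` covers the
identity rotation and reverses all spinors, so the even-odd shear component contributes nothing. A
half turn in a transversal plane then reverses a transversal co-frame form while fixing its
expression in the tangential ones. Hence the transversal bosonic co-frame vanishes on the
worldvolume (`transversal_eq_zero`), and the transversal torsion is just the second fundamental form
wedged with `e`.

The pairing matrix `C Γ_i` with `i` transversal pairs `P(32)` only with the complementary chirality.
So the spinor bilinear is twice the cross term of `ψ` with its shear image. Odd 1-forms commute and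
even ones anticommute, so a 2-form written in the co-frame vanishes exactly when its `ψψ` components
are skew, its `ψe` components are zero and its `ee` components are symmetric
(`ofComponents_eq_zero_iff`). The three types of component give skewness of `C Γ_i H`, the formula
for `τ`, and symmetry of the bosonic second fundamental form.

It remains to identify the matrices `H` from `P(32)` to its complement that commute with all `Γ_i
Γ_j` and have `C Γ_i H` skew. Chirality turns the commutation into anticommutation with each `Γ_i`
(`anti_of_comm`), and skewness then says that `H` is self-adjoint. A space of such matrices is
spanned by simultaneous eigenvectors of conjugation by the tangential generators, and Schur's lemma
makes each nonzero one a multiple of some `γ_p`, `γ_p W` or `γ_p γ_q γ_r` (`eigen_cases`).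
Self-adjointness leaves the cubic ones. Since multiplication by the volume element `W` is Hodge
duality (`slash_hodge`), restriction to `P(32)` selects the self-dual part.

For tangential `a` the matrix `C γ^a` pairs equal chiralities, so the bilinear splits into the `ψψ`
term and the square of the shear image. The only nontrivial piece of the latter is the sandwich of
`γ^a` between two copies of the Clifford action of `H₃`. It lies in the span of the `γ_b P`, and
traces identify its coefficients as `-2 H₃²` (`slash_γup_slash`).

These matrix statements are proved over the reals. Linear ones pass to superfields by testing with
linear functionals; the quadratic one passes by expansion in real self-dual tensors and
polarisation, since even superfields commute. -/

theorem η_mul_self (a : Idx) : η a * η a = 1 := by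
  unfold η; split_ifs <;> norm_num

@[simp] theorem η_inr (i : Fin 5) : η (Sum.inr i) = 1 := by simp [η]

theorem ηt_mul_self (a : Fin 6) : ηt a * ηt a = 1 := η_mul_self _

theorem prod_ηt : ∏ a, ηt a = -1 := by
  simp [ηt, η]

/-- Products of anticommuting elements, with commutation sign. -/
theorem mul_comm_sign {A : Type*} [Ring A] [Algebra ℝ A] {g x y : A} {ε δ : ℝ}
    (hx : g * x = ε • (x * g)) (hy : g * y = δ • (y * g)) :
    g * (x * y) = (ε * δ) • (x * y * g) := by
  rw [← mul_assoc, hx, smul_mul_assoc, mul_assoc, hy, mul_smul_comm, smul_smul, mul_assoc]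

theorem inv_comm_sign {A : Type*} [Ring A] [Algebra ℝ A] {g x n : A} {ε : ℝ}
    (hε : ε * ε = 1) (hx : g * x = ε • (x * g)) (h1 : x * n = 1) (h2 : n * x = 1) :
    g * n = ε • (n * g) := by
  have : x * g = ε • (g * x) := by rw [hx, smul_smul, hε, one_smul]
  calc g * n = n * (x * g) * n := by rw [← mul_assoc, h2, one_mul]
    _ = ε • (n * g) := by
      rw [this, mul_smul_comm, smul_mul_assoc, mul_assoc, mul_assoc, h1, mul_one]

/-- The commutation sign of the generator `i` with the product of the generators in `S`. -/
theorem prod_sign {ι : Type*} [DecidableEq ι] (S : Finset ι) (i : ι) :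
    ∏ b ∈ S, (if b = i then (1 : ℝ) else -1) = (-1) ^ S.card * (if i ∈ S then -1 else 1) := by
  have : ∀ b, (if b = i then (1 : ℝ) else -1) = (-1) * (if b = i then -1 else 1) := by
    intro b; split_ifs <;> norm_num
  simp only [this]
  rw [Finset.prod_mul_distrib, Finset.prod_const, Finset.prod_ite_eq']

/-! ### The full Clifford algebra: trace orthogonality, spanning and Schur's lemma. -/

namespace Majorana

variable (R : Majorana)

theorem Γ_sq (a : Idx) : R.Γ a * R.Γ a = η a • 1 := by
  have h := R.clifford a a
  rw [if_pos rfl, ← two_smul ℝ, mul_smul] at h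
  exact smul_right_injective _ (two_ne_zero (α := ℝ)) h

theorem Γ_anti {a b : Idx} (hab : a ≠ b) : R.Γ a * R.Γ b = -(R.Γ b * R.Γ a) := by
  have h := R.clifford a b
  rw [if_neg hab] at h
  exact eq_neg_of_add_eq_zero_left h

theorem Γ_sign (a b : Idx) :
    R.Γ a * R.Γ b = (if b = a then (1 : ℝ) else -1) • (R.Γ b * R.Γ a) := by
  split_ifs with h
  · rw [h, one_smul]
  · rw [R.Γ_anti (Ne.symm h), neg_one_smul]

theorem Γ_isUnit (a : Idx) : IsUnit (R.Γ a) :=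
  ⟨⟨R.Γ a, η a • R.Γ a, by rw [mul_smul_comm, Γ_sq, smul_smul, η_mul_self, one_smul],
    by rw [smul_mul_assoc, Γ_sq, smul_smul, η_mul_self, one_smul]⟩, rfl⟩

theorem list_sign {M : Mat} {s : Idx → ℝ} (L : List Idx)
    (h : ∀ a ∈ L, R.Γ a * M = s a • (M * R.Γ a)) :
    (L.map R.Γ).prod * M = (L.map s).prod • (M * (L.map R.Γ).prod) := by
  induction L with
  | nil => simp
  | cons a L ih =>
    have h1 := ih fun b hb => h b (List.mem_cons_of_mem _ hb)
    have h2 := h a List.mem_cons_self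
    simp only [List.map_cons, List.prod_cons]
    rw [mul_assoc, h1, mul_smul_comm, ← mul_assoc, h2, smul_mul_assoc, smul_smul, mul_assoc,
      mul_comm]

theorem Γ_list_sign (a : Idx) (L : List Idx) :
    R.Γ a * (L.map R.Γ).prod =
      (L.map fun b => if b = a then (1 : ℝ) else -1).prod • ((L.map R.Γ).prod * R.Γ a) := by
  induction L with
  | nil => simp
  | cons b L ih =>
    simp only [List.map_cons, List.prod_cons]
    exact mul_comm_sign (R.Γ_sign a b) ih

/-- The trace of `Γ_a X Γ_a` is evaluated twice: anticommutation gives `-η_a tr X`, cyclicity gives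
`η_a tr X`. -/
theorem trace_eq_zero_of_anti {X : Mat} (a : Idx) (h : R.Γ a * X = -(X * R.Γ a)) :
    X.trace = 0 := by
  have h1 : (R.Γ a * X * R.Γ a).trace = -(η a * X.trace) := by
    rw [h, neg_mul, mul_assoc, Γ_sq, mul_smul_comm, mul_one, Matrix.trace_neg, Matrix.trace_smul,
      smul_eq_mul]
  have h2 : (R.Γ a * X * R.Γ a).trace = η a * X.trace := by
    rw [Matrix.trace_mul_comm, ← mul_assoc, Γ_sq, smul_mul_assoc, one_mul, Matrix.trace_smul,
      smul_eq_mul]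
  have h3 : η a * X.trace = 0 := by linarith
  have : η a ≠ 0 := fun h0 => by simpa [h0] using η_mul_self a
  simpa [this] using h3

/-- The product, in some order, of a set of generators other than the last one. -/
def basisProd (S : Finset {a : Idx // a ≠ Sum.inr 4}) : Mat :=
  ((S.toList.map Subtype.val).map R.Γ).prod

theorem basisProd_isUnit (S) : IsUnit (R.basisProd S) := by
  refine List.prod_isUnit fun m hm => ?_
  obtain ⟨a, -, rfl⟩ := List.mem_map.1 hm
  exact R.Γ_isUnit a

theorem basisProd_sign (a : Idx) (S : Finset {a : Idx // a ≠ Sum.inr 4}) :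
    R.Γ a * R.basisProd S =
      ((-1) ^ S.card * (if a ∈ S.map (Function.Embedding.subtype _) then (-1 : ℝ) else 1)) •
        (R.basisProd S * R.Γ a) := by
  rw [basisProd, Γ_list_sign, List.map_map]
  congr 1
  have := prod_sign (S.map (Function.Embedding.subtype _)) a
  rw [Finset.card_map, Finset.prod_map] at this
  rw [← this, ← Finset.prod_map_toList]
  rfl

/-- Trace orthogonality: for different sets, the inverse of one product times the other anticommutes
with some generator and is therefore traceless. Multiplying a linear relation by an inverse and
taking the trace isolates one coefficient. -/
theorem basisProd_linearIndependent : LinearIndependent ℝ R.basisProd := by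
  classical
  rw [linearIndependent_iff']
  intro s c hc T hT
  obtain ⟨⟨X, N, hXN, hNX⟩, hX⟩ := R.basisProd_isUnit T
  simp only at hX
  have key : ∀ S, S ≠ T → (N * R.basisProd S).trace = 0 := by
    intro S hST
    by_contra hne
    have hs : ∀ a : Idx, ((-1 : ℝ) ^ T.card *
        (if a ∈ T.map (Function.Embedding.subtype _) then (-1 : ℝ) else 1)) =
        ((-1) ^ S.card * (if a ∈ S.map (Function.Embedding.subtype _) then (-1 : ℝ) else 1)) := by
      intro a
      have hT' := R.basisProd_sign a T
      have hS' := R.basisProd_sign a S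
      rw [← hX] at hT'
      have hsq : ∀ S : Finset {a : Idx // a ≠ Sum.inr 4}, ((-1 : ℝ) ^ S.card *
        (if a ∈ S.map (Function.Embedding.subtype _) then (-1 : ℝ) else 1)) = 1 ∨
        ((-1 : ℝ) ^ S.card *
        (if a ∈ S.map (Function.Embedding.subtype _) then (-1 : ℝ) else 1)) = -1 := by
        intro S
        rcases neg_one_pow_eq_or ℝ S.card with h | h <;> rw [h] <;> split_ifs <;> norm_num
      have hN := inv_comm_sign (by rcases hsq T with h | h <;> rw [h] <;> norm_num) hT' hXN hNX
      have := mul_comm_sign hN hS'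
      by_contra hd
      refine hne (R.trace_eq_zero_of_anti a ?_)
      rw [this]
      rcases hsq T with h | h <;> rcases hsq S with h' | h' <;> rw [h, h'] at hd ⊢ <;> simp at hd ⊢
    -- The omitted generator lies in neither set, so it compares only the parities of the
    -- cardinalities. Once these agree, every other generator detects membership.
    have h4 := hs (Sum.inr 4)
    simp at h4
    apply hST
    ext a
    have ha := hs a
    rw [h4] at ha
    have h0 : (-1 : ℝ) ^ S.card ≠ 0 := by positivity
    have := mul_left_cancel₀ h0 ha
    by_cases h1 : a ∈ S <;> by_cases h2 : a ∈ T <;> simp [h1, h2, a.2] at this ⊢ <;> norm_num at this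
  have h := congrArg (fun m => (N * m).trace) hc
  simp only [Matrix.mul_sum, Matrix.trace_sum, mul_smul_comm, Matrix.trace_smul, mul_zero,
    Matrix.trace_zero] at h
  rw [Finset.sum_eq_single T (fun S _ hS => by rw [key S hS, smul_zero])
    (fun h => absurd hT h), ← hX, hNX] at h
  simpa using h

/-- Schur's lemma for the Majorana representation. -/
theorem exists_eq_smul_one {Z : Mat} (h : ∀ a, R.Γ a * Z = Z * R.Γ a) : ∃ z : ℝ, Z = z • 1 := by
  -- Ten generators have `2^10 = 32^2` subset products, so independence forces them to span. This is
  -- why one of the eleven was omitted.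
  have htop : Submodule.span ℝ (Set.range R.basisProd) = ⊤ := by
    refine R.basisProd_linearIndependent.span_eq_top_of_card_eq_finrank' ?_
    rw [Module.finrank_matrix, Fintype.card_finset]
    simp
  have hc : ∀ M : Mat, M * Z = Z * M := by
    intro M
    have hM : M ∈ Submodule.span ℝ (Set.range R.basisProd) := htop ▸ Submodule.mem_top
    induction hM using Submodule.span_induction with
    | mem x hx =>
      obtain ⟨S, rfl⟩ := hx
      have := R.list_sign (s := fun _ => 1) (M := Z) (S.toList.map Subtype.val)
        fun a _ => by rw [one_smul, h]
      simpa [basisProd] using this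
    | zero => simp
    | add x y _ _ hx hy => rw [add_mul, mul_add, hx, hy]
    | smul c x _ hx => rw [smul_mul_assoc, mul_smul_comm, hx]
  obtain ⟨z, hz⟩ := Matrix.mem_range_scalar_of_commute_single (M := Z)
    fun i j _ => hc (Matrix.single i j 1)
  exact ⟨z, by rw [← hz, Matrix.scalar_apply, Matrix.smul_one_eq_diagonal]⟩

/-- Two elements with the same commutation signs, one of them invertible, are proportional. -/
theorem exists_eq_smul {M X : Mat} (hX : IsUnit X)
    (h : ∀ a, ∃ ε : ℝ, ε * ε = 1 ∧ R.Γ a * M = ε • (M * R.Γ a) ∧ R.Γ a * X = ε • (X * R.Γ a)) :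
    ∃ z : ℝ, M = z • X := by
  obtain ⟨⟨X, N, hXN, hNX⟩, rfl⟩ := hX
  obtain ⟨z, hz⟩ := R.exists_eq_smul_one (Z := M * N) fun a => by
    obtain ⟨ε, hε, h1, h2⟩ := h a
    rw [mul_comm_sign h1 (inv_comm_sign hε h2 hXN hNX), hε, one_smul]
  refine ⟨z, ?_⟩
  change M = z • X
  rw [← one_mul X, ← smul_mul_assoc, ← hz, mul_assoc, hNX, mul_one]

end Majorana

/-! ### The splitting 6 + 5: volume element, chirality projectors, adjoints. -/

namespace Majorana

variable (R : Majorana)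

/-- The tangential generators `γ_a`. -/
def γ (a : Fin 6) : Mat := R.Γ (Sum.inl a)

/-- The product of the transversal generators. -/
def W : Mat := (List.ofFn fun i => R.Γ (Sum.inr i)).prod

theorem W_eq_list : R.W = (((List.finRange 5).map Sum.inr).map R.Γ).prod := by
  rw [W, List.ofFn_eq_map, List.map_map]; rfl

theorem γ_sq (a : Fin 6) : R.γ a * R.γ a = ηt a • 1 := R.Γ_sq _

theorem γ_anti {a b : Fin 6} (h : a ≠ b) : R.γ a * R.γ b = -(R.γ b * R.γ a) :=
  R.Γ_anti fun h' => h (Sum.inl_injective h')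

theorem γ_clifford (a b : Fin 6) :
    R.γ a * R.γ b = (if a = b then (2 * ηt a) • 1 else 0) - R.γ b * R.γ a := by
  have := R.clifford (Sum.inl a) (Sum.inl b)
  simp only [Sum.inl.injEq] at this
  rw [eq_sub_iff_add_eq]
  exact this

theorem Γ_γ (i : Fin 5) (a : Fin 6) : R.Γ (Sum.inr i) * R.γ a = -(R.γ a * R.Γ (Sum.inr i)) :=
  R.Γ_anti (by simp)

theorem W_Γ (i : Fin 5) : R.W * R.Γ (Sum.inr i) = R.Γ (Sum.inr i) * R.W := by
  rw [W_eq_list, Γ_list_sign]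
  have : (((List.finRange 5).map Sum.inr).map
      fun b : Idx => if b = Sum.inr i then (1 : ℝ) else -1).prod = 1 := by
    fin_cases i <;> simp [List.finRange_succ]
  rw [this, one_smul]

theorem γ_W (a : Fin 6) : R.γ a * R.W = -(R.W * R.γ a) := by
  rw [W_eq_list, γ, Γ_list_sign]
  have : (((List.finRange 5).map Sum.inr).map
      fun b : Idx => if b = Sum.inl a then (1 : ℝ) else -1).prod = -1 := by
    simp [List.finRange_succ]
  rw [this, neg_one_smul]

theorem five_sq {A : Type*} [Ring A] (g : Fin 5 → A) (hs : ∀ i, g i * g i = 1)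
    (ha : ∀ i j, j < i → g i * g j = -(g j * g i)) :
    (List.ofFn g).prod * (List.ofFn g).prod = 1 := by
  have hs' : ∀ i x, g i * (g i * x) = x := fun i x => by rw [← mul_assoc, hs, one_mul]
  have ha' : ∀ i j x, j < i → g i * (g j * x) = -(g j * (g i * x)) := fun i j x h => by
    rw [← mul_assoc, ha i j h, neg_mul, mul_assoc]
  simp [mul_assoc, ha', hs, Fin.succ]

theorem five_reverse {A : Type*} [Ring A] (g : Fin 5 → A)
    (ha : ∀ i j, j < i → g i * g j = -(g j * g i)) :
    g 4 * g 3 * g 2 * g 1 * g 0 = (List.ofFn g).prod := by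
  have ha' : ∀ i j x, j < i → g i * (g j * x) = -(g j * (g i * x)) := fun i j x h => by
    rw [← mul_assoc, ha i j h, neg_mul, mul_assoc]
  simp [mul_assoc, ha, ha', Fin.succ]

theorem W_sq : R.W * R.W = 1 :=
  five_sq _ (fun i => by rw [Γ_sq, η_inr, one_smul]) fun i j h =>
    R.Γ_anti fun h' => h.ne' (Sum.inr_injective h')

/-- The product of the tangential generators agrees with that of the transversal ones. -/
theorem prod_γ : (List.ofFn R.γ).prod = R.W := by
  have h : (List.ofFn R.γ).prod * R.W = 1 := R.volume
  calc _ = (List.ofFn R.γ).prod * (R.W * R.W) := by rw [W_sq, mul_one]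
    _ = R.W := by rw [← mul_assoc, h, one_mul]

/-- Five skew self-adjoint factors give five signs, and restoring the order of five anticommuting
factors takes ten transpositions, hence no further sign. -/
theorem W_transpose : R.W.transpose * R.C = -(R.C * R.W) := by
  have h : R.W = R.Γ (Sum.inr 4) * R.Γ (Sum.inr 3) * R.Γ (Sum.inr 2) * R.Γ (Sum.inr 1) *
      R.Γ (Sum.inr 0) := by
    rw [five_reverse (fun i => R.Γ (Sum.inr i))]
    · rfl
    · exact fun i j h => R.Γ_anti fun h' => h.ne' (Sum.inr_injective h')
  conv_lhs => rw [h]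
  simp only [Matrix.transpose_mul, mul_assoc, R.adjoint]
  simp only [← mul_assoc, mul_neg]
  simp only [mul_assoc, R.adjoint, mul_neg]
  simp only [← mul_assoc, R.adjoint, neg_mul, mul_neg, neg_neg]
  simp [W, mul_assoc, Fin.succ]

theorem P_eq : R.P = (1 / 2 : ℝ) • (1 + R.W) := rfl

theorem Pbar_eq : R.Pbar = (1 / 2 : ℝ) • (1 - R.W) := by
  rw [Pbar, P_eq]; module

theorem W_P : R.W * R.P = R.P := by
  rw [P_eq, mul_smul_comm, mul_add, W_sq, mul_one, add_comm]

theorem P_W : R.P * R.W = R.P := by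
  rw [P_eq, smul_mul_assoc, add_mul, W_sq, one_mul, add_comm]

theorem P_P : R.P * R.P = R.P := by
  nth_rw 1 [P_eq]
  rw [smul_mul_assoc, add_mul, W_P, one_mul]; module

theorem Pbar_Pbar : R.Pbar * R.Pbar = R.Pbar := by
  rw [Pbar, sub_mul, mul_sub, mul_sub, P_P]; simp

theorem P_Pbar : R.P * R.Pbar = 0 := by rw [Pbar, mul_sub, P_P]; simp

theorem Pbar_P : R.Pbar * R.P = 0 := by rw [Pbar, sub_mul, P_P]; simp

theorem P_Γ (i : Fin 5) : R.P * R.Γ (Sum.inr i) = R.Γ (Sum.inr i) * R.P := by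
  rw [P_eq, smul_mul_assoc, add_mul, W_Γ, mul_smul_comm, mul_add, one_mul, mul_one]

theorem Pbar_Γ (i : Fin 5) : R.Pbar * R.Γ (Sum.inr i) = R.Γ (Sum.inr i) * R.Pbar := by
  rw [Pbar, sub_mul, P_Γ, mul_sub, one_mul, mul_one]

theorem P_γ (a : Fin 6) : R.P * R.γ a = R.γ a * R.Pbar := by
  rw [P_eq, Pbar_eq, smul_mul_assoc, add_mul, mul_smul_comm, mul_sub, one_mul, mul_one, γ_W,
    sub_neg_eq_add]

theorem Pbar_γ (a : Fin 6) : R.Pbar * R.γ a = R.γ a * R.P := by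
  rw [P_eq, Pbar_eq, smul_mul_assoc, sub_mul, mul_smul_comm, mul_add, one_mul, mul_one, γ_W,
    sub_eq_add_neg]

/-- Both chirality subspaces are therefore isotropic for the pairing. Which chiralities a bilinear
couples depends only on whether its matrix commutes with `W` or anticommutes. -/
theorem P_transpose : R.P.transpose * R.C = R.C * R.Pbar := by
  rw [P_eq, Pbar_eq, Matrix.transpose_smul, Matrix.transpose_add, smul_mul_assoc, add_mul,
    W_transpose, mul_smul_comm, mul_sub, Matrix.transpose_one, one_mul, mul_one, sub_eq_add_neg]

theorem C_Γ_transpose (a : Idx) : (R.C * R.Γ a).transpose = R.C * R.Γ a := by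
  rw [Matrix.transpose_mul, R.skew, mul_neg, R.adjoint, neg_neg]

theorem γ_transpose (a : Fin 6) : (R.γ a).transpose * R.C = -(R.C * R.γ a) := R.adjoint _

theorem eq_zero_of_C_mul {M : Mat} (h : R.C * M = 0) : M = 0 := by
  have := congrArg (R.C⁻¹ * ·) h
  simpa [← mul_assoc, Matrix.nonsing_inv_mul _ R.nondegenerate] using this

/-- Matrices that anticommute with the transversal generators, and that are self-adjoint
up to the sign `δ` with respect to the spinor pairing. -/
def oddSpace (δ : ℝ) : Submodule ℝ Mat where
  carrier := {M | (∀ i, R.Γ (Sum.inr i) * M = -(M * R.Γ (Sum.inr i))) ∧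
    M.transpose * R.C = δ • (R.C * M)}
  add_mem' := by
    rintro M N ⟨h1, h2⟩ ⟨h3, h4⟩
    refine ⟨fun i => by rw [mul_add, add_mul, h1, h3, neg_add], ?_⟩
    rw [Matrix.transpose_add, add_mul, mul_add, h2, h4, smul_add]
  zero_mem' := by simp
  smul_mem' := by
    rintro c M ⟨h1, h2⟩
    refine ⟨fun i => by rw [mul_smul_comm, smul_mul_assoc, h1, smul_neg], ?_⟩
    rw [Matrix.transpose_smul, smul_mul_assoc, mul_smul_comm, h2, smul_comm]

theorem oddSpace_conj {δ : ℝ} {M : Mat} (h : M ∈ R.oddSpace δ) (a : Fin 6) :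
    R.γ a * M * R.γ a ∈ R.oddSpace δ := by
  obtain ⟨h1, h2⟩ := h
  refine ⟨fun i => ?_, ?_⟩
  · rw [← mul_assoc, ← mul_assoc, Γ_γ, neg_mul, neg_mul, mul_assoc (R.γ a), h1, mul_neg, neg_mul,
      neg_neg, mul_assoc, mul_assoc, Γ_γ]
    simp only [mul_assoc, mul_neg]
  · simp only [Matrix.transpose_mul]
    rw [mul_assoc, mul_assoc, γ_transpose, mul_neg, ← mul_assoc (M.transpose), h2, mul_neg,
      smul_mul_assoc, mul_smul_comm, ← mul_assoc, ← mul_assoc, γ_transpose]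
    simp only [neg_mul, mul_assoc, smul_neg, neg_neg]

/-- To embed a space of matrices that is stable under conjugation with the tangential generators,
it suffices to consider simultaneous eigenvectors of the conjugations. -/
theorem le_of_forall_eigen {Q W : Submodule ℝ Mat} (hQ : ∀ a, ∀ M ∈ Q, R.γ a * M * R.γ a ∈ Q)
    (h : ∀ M ∈ Q, (∀ a, R.γ a * M = M * R.γ a ∨ R.γ a * M = -(M * R.γ a)) → M ∈ W) : Q ≤ W := by
  -- Here `n` counts the generators, those of index below `n`, whose conjugations need not yet act
  -- on `M` by a sign. The induction removes them one at a time.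
  have key : ∀ n : ℕ, ∀ M ∈ Q,
      (∀ a : Fin 6, n ≤ a.1 → R.γ a * M = M * R.γ a ∨ R.γ a * M = -(M * R.γ a)) → M ∈ W := by
    intro n
    induction n with
    | zero => exact fun M hM hM' => h M hM fun a => hM' a (Nat.zero_le _)
    | succ n ih =>
      intro M hM hM'
      by_cases hn : n < 6
      swap
      · exact ih M hM fun a ha => absurd a.2 (by omega)
      set a : Fin 6 := ⟨n, hn⟩ with ha
      have hN := hQ a M hM
      set N := R.γ a * M * R.γ a with hNdef
      have e1 : R.γ a * N = ηt a • (M * R.γ a) := by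
        rw [hNdef, mul_assoc, ← mul_assoc, γ_sq, smul_mul_assoc, one_mul]
      have e2 : N * R.γ a = ηt a • (R.γ a * M) := by
        rw [hNdef, mul_assoc, γ_sq, mul_smul_comm, mul_one]
      -- Moving `γ_b` through `N` passes two copies of `γ_a`, so the signs already arranged survive.
      -- The combinations `M ± η_a N` are then eigenvectors for `γ_a` as well.
      have hb : ∀ b : Fin 6, n + 1 ≤ b.1 → (R.γ b * M = M * R.γ b ∧ R.γ b * N = N * R.γ b) ∨
          (R.γ b * M = -(M * R.γ b) ∧ R.γ b * N = -(N * R.γ b)) := by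
        intro b hb
        have hba : b ≠ a := by
          intro h; rw [h] at hb; simp [ha] at hb
        have e3 : R.γ b * N = -(R.γ a * (R.γ b * M) * R.γ a) := by
          rw [hNdef, ← mul_assoc, ← mul_assoc, R.γ_anti hba]; simp only [neg_mul, mul_assoc]
        have e4 : N * R.γ b = -(R.γ a * (M * R.γ b) * R.γ a) := by
          rw [hNdef, mul_assoc, R.γ_anti hba.symm]; simp only [mul_neg, mul_assoc]
        rcases hM' b hb with h | h
        · exact Or.inl ⟨h, by rw [e3, h, e4]⟩
        · exact Or.inr ⟨h, by rw [e3, h, e4, mul_neg, neg_mul]⟩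
      have hp : M + ηt a • N ∈ W := by
        refine ih _ (Q.add_mem hM (Q.smul_mem _ hN)) fun b hnb => ?_
        rcases eq_or_lt_of_le hnb with h0 | h0
        · have : b = a := Fin.ext h0.symm
          left
          rw [this, mul_add, add_mul, mul_smul_comm, smul_mul_assoc, e1, e2, smul_smul, smul_smul,
            ηt_mul_self, one_smul, one_smul, add_comm]
        · rcases hb b h0 with ⟨h1, h2⟩ | ⟨h1, h2⟩
          · left; rw [mul_add, add_mul, mul_smul_comm, smul_mul_assoc, h1, h2]
          · right; rw [mul_add, add_mul, mul_smul_comm, smul_mul_assoc, h1, h2]; module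
      have hm : M - ηt a • N ∈ W := by
        refine ih _ (Q.sub_mem hM (Q.smul_mem _ hN)) fun b hnb => ?_
        rcases eq_or_lt_of_le hnb with h0 | h0
        · have : b = a := Fin.ext h0.symm
          right
          rw [this, mul_sub, sub_mul, mul_smul_comm, smul_mul_assoc, e1, e2, smul_smul, smul_smul,
            ηt_mul_self, one_smul, one_smul, neg_sub]
        · rcases hb b h0 with ⟨h1, h2⟩ | ⟨h1, h2⟩
          · left; rw [mul_sub, sub_mul, mul_smul_comm, smul_mul_assoc, h1, h2]
          · right; rw [mul_sub, sub_mul, mul_smul_comm, smul_mul_assoc, h1, h2]; module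
      have : M = (1 / 2 : ℝ) • (M + ηt a • N) + (1 / 2 : ℝ) • (M - ηt a • N) := by module
      rw [this]
      exact W.add_mem (W.smul_mem _ hp) (W.smul_mem _ hm)
  exact fun M hM => key 6 M hM fun a ha => absurd a.2 (by omega)

theorem γ_isUnit (a : Fin 6) : IsUnit (R.γ a) := R.Γ_isUnit _

theorem W_isUnit : IsUnit R.W := ⟨⟨R.W, R.W, R.W_sq, R.W_sq⟩, rfl⟩

/-- Simultaneous eigenvectors that anticommute with the transversal generators. -/
theorem eigen_cases {M : Mat} (hM : ∀ i, R.Γ (Sum.inr i) * M = -(M * R.Γ (Sum.inr i)))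
    (h : ∀ a, R.γ a * M = M * R.γ a ∨ R.γ a * M = -(M * R.γ a)) :
    M = 0 ∨ (∃ z : ℝ, ∃ p, M = z • R.γ p) ∨ (∃ z : ℝ, ∃ p, M = z • (R.γ p * R.W)) ∨
      ∃ z : ℝ, ∃ p q r, p ≠ q ∧ p ≠ r ∧ q ≠ r ∧ M = z • (R.γ p * R.γ q * R.γ r) := by
  classical
  set S : Finset (Fin 6) := Finset.univ.filter fun a => R.γ a * M = M * R.γ a with hS
  have hs : ∀ a, R.γ a * M = (if a ∈ S then (1 : ℝ) else -1) • (M * R.γ a) := by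
    intro a
    by_cases ha : R.γ a * M = M * R.γ a
    · simp [hS, ha]
    · rcases h a with h' | h'
      · exact absurd h' ha
      · have ha' : a ∉ S := by simpa [hS] using ha
        rw [if_neg ha', h', neg_one_smul]
  -- The sign of `W` against `M` is computed in two ways: as a product of five transversal
  -- generators, and as a product of six tangential ones, of which `6 - |S|` anticommute with `M`.
  -- If `|S|` is even the two disagree and `M` vanishes.
  have hW1 : R.W * M = -(M * R.W) := by
    have := R.list_sign (M := M) (s := fun _ => -1) ((List.finRange 5).map Sum.inr) (by
      intro a ha
      obtain ⟨i, -, rfl⟩ := List.mem_map.1 ha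
      rw [hM, neg_one_smul])
    rw [← W_eq_list, List.map_const'] at this
    simpa using this
  have hW2 : R.W * M = (∏ a, if a ∈ S then (1 : ℝ) else -1) • (M * R.W) := by
    have := R.list_sign (M := M) (s := Sum.elim (fun a => if a ∈ S then (1 : ℝ) else -1) fun _ => 1)
      ((List.finRange 6).map Sum.inl) (by
      intro a ha
      obtain ⟨i, -, rfl⟩ := List.mem_map.1 ha
      exact hs i)
    have e : (((List.finRange 6).map Sum.inl).map R.Γ).prod = R.W := by
      rw [← prod_γ, List.ofFn_eq_map, List.map_map]; rfl
    rw [e, List.map_map] at this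
    rw [this]
    congr 1
  rw [hW1, Finset.prod_ite] at hW2
  simp only [Finset.prod_const_one, one_mul, Finset.prod_const, Finset.filter_not,
    Finset.filter_mem_eq_inter, Finset.univ_inter] at hW2
  rw [Finset.card_sdiff_of_subset (Finset.subset_univ _), Finset.card_univ, Fintype.card_fin] at hW2
  have hcard : S.card ≤ 6 := by simpa using Finset.card_le_univ S
  have hzero : ((-1 : ℝ) ^ (6 - S.card) = 1) → M = 0 := by
    intro h1
    rw [h1, one_smul] at hW2
    have h2 : M * R.W = 0 := by
      have h3 : (2 : ℝ) • (M * R.W) = 0 := by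
        rw [two_smul]; nth_rw 1 [← hW2]; simp
      simpa using h3
    rw [← mul_one M, ← W_sq, ← mul_assoc, h2, zero_mul]
  have hsign : ∀ X : Mat, IsUnit X → (∀ i, R.Γ (Sum.inr i) * X = -(X * R.Γ (Sum.inr i))) →
      (∀ a, R.γ a * X = (if a ∈ S then (1 : ℝ) else -1) • (X * R.γ a)) → ∃ z : ℝ, M = z • X := by
    intro X hX h1 h2
    refine R.exists_eq_smul hX ?_
    rintro (a | i)
    · exact ⟨_, by split_ifs <;> norm_num, hs a, h2 a⟩
    · exact ⟨-1, by norm_num, by rw [hM, neg_one_smul], by rw [h1, neg_one_smul]⟩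
  have hΓ : ∀ i p, R.Γ (Sum.inr i) * R.γ p = (-1 : ℝ) • (R.γ p * R.Γ (Sum.inr i)) := by
    intro i p; rw [Γ_γ, neg_one_smul]
  have hγs : ∀ a p : Fin 6, R.γ a * R.γ p = (if p = a then (1 : ℝ) else -1) • (R.γ p * R.γ a) := by
    intro a p
    simpa [γ] using R.Γ_sign (Sum.inl a) (Sum.inl p)
  -- For odd `|S|` a model with the same signs is needed: `γ_p` commutes with `γ_p` alone among the
  -- tangential generators, `γ_p γ_q γ_r` with its own three factors, and `γ_p W` with all but
  -- `γ_p`.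
  interval_cases hc : S.card
  · exact Or.inl (hzero (by norm_num))
  · right; left
    obtain ⟨p, hp⟩ := Finset.card_eq_one.1 hc
    obtain ⟨z, hz⟩ := hsign (R.γ p) (R.γ_isUnit p) (fun i => R.Γ_γ i p) (fun a => by
      rw [hγs, hp]; simp only [Finset.mem_singleton, eq_comm])
    exact ⟨z, p, hz⟩
  · exact Or.inl (hzero (by norm_num))
  · right; right; right
    obtain ⟨p, q, r, hpq, hpr, hqr, hpqr⟩ := Finset.card_eq_three.1 hc
    obtain ⟨z, hz⟩ := hsign (R.γ p * R.γ q * R.γ r)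
      (((R.γ_isUnit p).mul (R.γ_isUnit q)).mul (R.γ_isUnit r))
      (fun i => by
        simpa using mul_comm_sign (mul_comm_sign (hΓ i p) (hΓ i q)) (hΓ i r))
      (fun a => by
        rw [mul_comm_sign (mul_comm_sign (hγs a p) (hγs a q)) (hγs a r), hpqr]
        congr 1
        simp only [Finset.mem_insert, Finset.mem_singleton]
        by_cases h1 : a = p
        · subst h1; simp [hpq.symm, hpr.symm]
        by_cases h2 : a = q
        · subst h2; simp [hpq, hqr.symm]
        by_cases h3 : a = r
        · subst h3; simp [hpr, hqr]
        · simp [h1, h2, h3, Ne.symm h1, Ne.symm h2, Ne.symm h3])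
    exact ⟨z, p, q, r, hpq, hpr, hqr, hz⟩
  · exact Or.inl (hzero (by norm_num))
  · right; right; left
    have hc' : Sᶜ.card = 1 := by rw [Finset.card_compl, hc]; rfl
    obtain ⟨p, hp⟩ := Finset.card_eq_one.1 hc'
    obtain ⟨z, hz⟩ := hsign (R.γ p * R.W) ((R.γ_isUnit p).mul R.W_isUnit)
      (fun i => by
        simpa using mul_comm_sign (hΓ i p) (δ := 1) ((R.W_Γ i).symm.trans (one_smul _ _).symm))
      (fun a => by
        rw [mul_comm_sign (hγs a p) (δ := -1) ((R.γ_W a).trans (neg_one_smul _ _).symm)]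
        congr 1
        have : a ∈ S ↔ a ≠ p := by
          rw [← not_iff_not, ← Finset.mem_compl, hp]; simp
        by_cases h1 : a = p
        · rw [if_pos h1.symm, if_neg fun h => this.1 h h1, one_mul]
        · simp [this, h1, Ne.symm h1])
    exact ⟨z, p, hz⟩
  · exact Or.inl (hzero (by norm_num))

theorem γ_W_transpose (p : Fin 6) :
    (R.γ p * R.W).transpose * R.C = -(R.C * (R.γ p * R.W)) := by
  rw [Matrix.transpose_mul, mul_assoc, γ_transpose, mul_neg, ← mul_assoc, W_transpose, neg_mul,
    mul_assoc, γ_W]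
  simp

/-- Three adjoint signs combine with the odd sign of reversing three anticommuting factors. This is
what separates cubic products from `γ_p` and `γ_p W`, which are skew. -/
theorem γγγ_transpose {p q r : Fin 6} (hpq : p ≠ q) (hpr : p ≠ r) (hqr : q ≠ r) :
    (R.γ p * R.γ q * R.γ r).transpose * R.C = R.C * (R.γ p * R.γ q * R.γ r) := by
  have : R.γ p * R.γ q * R.γ r = -(R.γ r * R.γ q * R.γ p) := by
    rw [R.γ_anti hpq, neg_mul, mul_assoc, R.γ_anti hpr, mul_neg, neg_neg, ← mul_assoc,
      R.γ_anti hqr, neg_mul]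
  nth_rw 2 [this]
  simp only [Matrix.transpose_mul, mul_assoc, γ_transpose, mul_neg]
  simp only [← mul_assoc, γ_transpose, mul_neg, neg_mul, neg_neg]

theorem eq_zero_of_C_mul_eq_neg {M : Mat} (h : R.C * M = -(R.C * M)) : M = 0 := by
  apply R.eq_zero_of_C_mul
  have h3 : (2 : ℝ) • (R.C * M) = 0 := by
    rw [two_smul]; nth_rw 1 [h]; simp
  simpa using h3

theorem oddSpace_one_le {W : Submodule ℝ Mat}
    (h : ∀ p q r, p ≠ q → p ≠ r → q ≠ r → R.γ p * R.γ q * R.γ r ∈ W) : R.oddSpace 1 ≤ W := by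
  refine R.le_of_forall_eigen (fun a M hM => R.oddSpace_conj hM a) fun M hM hM' => ?_
  obtain ⟨h1, h2⟩ := hM
  rw [one_smul] at h2
  rcases R.eigen_cases h1 hM' with h0 | ⟨z, p, h0⟩ | ⟨z, p, h0⟩ | ⟨z, p, q, r, hpq, hpr, hqr, h0⟩
  · rw [h0]; exact W.zero_mem
  · have : M = 0 := R.eq_zero_of_C_mul_eq_neg (h2.symm.trans <| by
      rw [h0, Matrix.transpose_smul, smul_mul_assoc, γ_transpose]; simp)
    rw [this]; exact W.zero_mem
  · have : M = 0 := R.eq_zero_of_C_mul_eq_neg (h2.symm.trans <| by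
      rw [h0, Matrix.transpose_smul, smul_mul_assoc, γ_W_transpose]; simp)
    rw [this]; exact W.zero_mem
  · rw [h0]; exact W.smul_mem _ (h p q r hpq hpr hqr)

theorem oddSpace_neg_one_le {W : Submodule ℝ Mat}
    (h : ∀ p, R.γ p ∈ W) (h' : ∀ p, R.γ p * R.W ∈ W) : R.oddSpace (-1) ≤ W := by
  refine R.le_of_forall_eigen (fun a M hM => R.oddSpace_conj hM a) fun M hM hM' => ?_
  obtain ⟨h1, h2⟩ := hM
  rw [neg_one_smul] at h2
  rcases R.eigen_cases h1 hM' with h0 | ⟨z, p, h0⟩ | ⟨z, p, h0⟩ | ⟨z, p, q, r, hpq, hpr, hqr, h0⟩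
  · rw [h0]; exact W.zero_mem
  · rw [h0]; exact W.smul_mem _ (h p)
  · rw [h0]; exact W.smul_mem _ (h' p)
  · have : M = 0 := R.eq_zero_of_C_mul_eq_neg (.trans (by
      rw [h0, Matrix.transpose_smul, smul_mul_assoc, R.γγγ_transpose hpq hpr hqr, mul_smul_comm]) h2)
    rw [this]; exact W.zero_mem

end Majorana

/-! ### Skew tensors, the Levi-Civita symbol and Hodge duality. -/

/-- Real rank-3 skew-symmetric tensors. -/
def IsSkew (h : Fin 6 → Fin 6 → Fin 6 → ℝ) : Prop :=
  (∀ a b c, h a b c = -h b a c) ∧ ∀ a b c, h a b c = -h a c b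

theorem IsSkew.ne {h : Fin 6 → Fin 6 → Fin 6 → ℝ} (hh : IsSkew h) {a b c : Fin 6}
    (h0 : h a b c ≠ 0) : a ≠ b ∧ a ≠ c ∧ b ≠ c := by
  refine ⟨?_, ?_, ?_⟩ <;> rintro rfl <;> apply h0
  · linarith [hh.1 a a c]
  · linarith [hh.1 a b a, hh.2 b a a]
  · linarith [hh.2 a b b]

/-- The remaining values of `π` enumerate the complementary indices, so identities for skew tensors
reduce to a sign and a reordering of the six indices. -/
theorem exists_perm {a b c : Fin 6} (hab : a ≠ b) (hac : a ≠ c) (hbc : b ≠ c) :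
    ∃ π : Equiv.Perm (Fin 6), π 0 = a ∧ π 1 = b ∧ π 2 = c := by
  have hS : (({a, b, c} : Finset (Fin 6))ᶜ).card = 3 := by
    rw [Finset.card_compl, Finset.card_eq_three.2 ⟨a, b, c, hab, hac, hbc, rfl⟩]; rfl
  obtain ⟨d, e, f, hde, hdf, hef, hdef⟩ := Finset.card_eq_three.1 hS
  have hd : d ∉ ({a, b, c} : Finset (Fin 6)) := by
    rw [← Finset.mem_compl, hdef]; simp
  have he : e ∉ ({a, b, c} : Finset (Fin 6)) := by
    rw [← Finset.mem_compl, hdef]; simp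
  have hf : f ∉ ({a, b, c} : Finset (Fin 6)) := by
    rw [← Finset.mem_compl, hdef]; simp
  simp only [Finset.mem_insert, Finset.mem_singleton, not_or] at hd he hf
  have hinj : Function.Injective ![a, b, c, d, e, f] := by
    intro i j hij
    fin_cases i <;> fin_cases j <;> simp_all
  exact ⟨Equiv.ofBijective _ (Finite.injective_iff_bijective.1 hinj), rfl, rfl, rfl⟩

theorem sign_mul_self (π : Equiv.Perm (Fin 6)) :
    ((Equiv.Perm.sign π : ℤ) : ℝ) * (Equiv.Perm.sign π : ℤ) = 1 := by
  rcases Int.units_eq_one_or (Equiv.Perm.sign π) with h | h <;> rw [h] <;> norm_num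

theorem epsUp_comp (a : Fin 6 → Fin 6) (σ : Equiv.Perm (Fin 6)) :
    epsUp (fun i => a (σ i)) = (Equiv.Perm.sign σ : ℤ) * epsUp a :=
  Matrix.det_permute σ (Matrix.of fun i j => if a i = j then (1 : ℝ) else 0)

theorem epsUp_perm_comp (a : Fin 6 → Fin 6) (σ : Equiv.Perm (Fin 6)) :
    epsUp (fun i => σ (a i)) = (Equiv.Perm.sign σ : ℤ) * epsUp a := by
  have := Matrix.det_permute' σ⁻¹ (Matrix.of fun i j => if a i = j then (1 : ℝ) else 0)
  rw [Equiv.Perm.sign_inv] at this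
  rw [epsUp, epsUp, ← this]
  congr 1
  ext i j
  simp [Equiv.eq_symm_apply]

theorem epsUp_perm (σ : Equiv.Perm (Fin 6)) : epsUp σ = (Equiv.Perm.sign σ : ℤ) := by
  have h := epsUp_comp id σ
  have h1 : epsUp id = 1 := by
    rw [epsUp, ← Matrix.det_one (n := Fin 6)]
    congr 1
    ext i j
    simp [Matrix.one_apply]
  rw [h1, mul_one] at h
  exact h

theorem epsUp_eq_zero {a : Fin 6 → Fin 6} {i j : Fin 6} (hij : i ≠ j) (h : a i = a j) :
    epsUp a = 0 :=
  Matrix.det_zero_of_row_eq hij (by ext; simp [h])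

theorem epsUp_swap (a : Fin 6 → Fin 6) {i j : Fin 6} (hij : i ≠ j) :
    epsUp (fun k => a (Equiv.swap i j k)) = -epsUp a := by
  rw [epsUp_comp, Equiv.Perm.sign_swap hij]; simp

theorem epsUp_skew₁₂ (a b c x y z : Fin 6) :
    epsUp ![a, b, c, x, y, z] = -epsUp ![b, a, c, x, y, z] := by
  rw [← epsUp_swap _ (show (0 : Fin 6) ≠ 1 by decide)]
  congr 1
  ext i; fin_cases i <;> rfl

theorem epsUp_skew₂₃ (a b c x y z : Fin 6) :
    epsUp ![a, b, c, x, y, z] = -epsUp ![a, c, b, x, y, z] := by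
  rw [← epsUp_swap _ (show (1 : Fin 6) ≠ 2 by decide)]
  congr 1
  ext i; fin_cases i <;> rfl

/-- The exchange of the blocks `0, 1, 2` and `3, 4, 5`. -/
def blockSwap : Equiv.Perm (Fin 6) := Equiv.addRight 3

theorem sign_blockSwap : Equiv.Perm.sign blockSwap = -1 := by decide

theorem epsUp_blockSwap (a b c d e f : Fin 6) :
    epsUp ![a, b, c, d, e, f] = -epsUp ![d, e, f, a, b, c] := by
  have h := epsUp_comp ![d, e, f, a, b, c] blockSwap
  have : (fun i => ![d, e, f, a, b, c] (blockSwap i)) = ![a, b, c, d, e, f] := by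
    ext i; fin_cases i <;> rfl
  rw [this, sign_blockSwap] at h
  simpa using h

theorem sum_epsUp {V : Type*} [AddCommGroup V] [Module ℝ V] (k : Fin 6 → Fin 6 → Fin 6 → V) :
    ∑ x, ∑ y, ∑ z, epsUp ![0, 1, 2, x, y, z] • k x y z =
      k 3 4 5 - k 4 3 5 - k 5 4 3 - k 3 5 4 + k 4 5 3 + k 5 3 4 := by
  have e0 : ∀ x y z : Fin 6, x < 3 ∨ y < 3 ∨ z < 3 ∨ x = y ∨ x = z ∨ y = z →
      epsUp ![0, 1, 2, x, y, z] = 0 := by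
    have e1 : ∀ i j : Fin 6, ∀ x y z : Fin 6, i ≠ j →
        ![0, 1, 2, x, y, z] i = ![0, 1, 2, x, y, z] j → epsUp ![0, 1, 2, x, y, z] = 0 :=
      fun i j x y z h h' => epsUp_eq_zero h h'
    have e2 : ∀ x : Fin 6, x < 3 → x = 0 ∨ x = 1 ∨ x = 2 := by decide
    rintro x y z (h | h | h | h | h | h)
    · rcases e2 x h with rfl | rfl | rfl
      exacts [e1 0 3 _ _ _ (by decide) rfl, e1 1 3 _ _ _ (by decide) rfl,
        e1 2 3 _ _ _ (by decide) rfl]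
    · rcases e2 y h with rfl | rfl | rfl
      exacts [e1 0 4 _ _ _ (by decide) rfl, e1 1 4 _ _ _ (by decide) rfl,
        e1 2 4 _ _ _ (by decide) rfl]
    · rcases e2 z h with rfl | rfl | rfl
      exacts [e1 0 5 _ _ _ (by decide) rfl, e1 1 5 _ _ _ (by decide) rfl,
        e1 2 5 _ _ _ (by decide) rfl]
    · exact e1 3 4 _ _ _ (by decide) h
    · exact e1 3 5 _ _ _ (by decide) h
    · exact e1 4 5 _ _ _ (by decide) h
  have e3 : ∀ (σ : Equiv.Perm (Fin 6)) (a : Fin 6 → Fin 6), a = σ →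
      epsUp a = (Equiv.Perm.sign σ : ℤ) := fun σ a h => h ▸ epsUp_perm σ
  have h345 : epsUp ![0, 1, 2, 3, 4, 5] = 1 := by
    rw [e3 1 _ (by decide)]; simp
  have h435 : epsUp ![0, 1, 2, 4, 3, 5] = -1 := by
    rw [e3 (Equiv.swap 3 4) _ (by decide), Equiv.Perm.sign_swap (by decide)]; simp
  have h543 : epsUp ![0, 1, 2, 5, 4, 3] = -1 := by
    rw [e3 (Equiv.swap 3 5) _ (by decide), Equiv.Perm.sign_swap (by decide)]; simp
  have h354 : epsUp ![0, 1, 2, 3, 5, 4] = -1 := by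
    rw [e3 (Equiv.swap 4 5) _ (by decide), Equiv.Perm.sign_swap (by decide)]; simp
  have h453 : epsUp ![0, 1, 2, 4, 5, 3] = 1 := by
    rw [e3 (Equiv.swap 3 4 * Equiv.swap 4 5) _ (by decide), Equiv.Perm.sign_mul,
      Equiv.Perm.sign_swap (by decide), Equiv.Perm.sign_swap (by decide)]; simp
  have h534 : epsUp ![0, 1, 2, 5, 3, 4] = 1 := by
    rw [e3 (Equiv.swap 4 5 * Equiv.swap 3 4) _ (by decide), Equiv.Perm.sign_mul,
      Equiv.Perm.sign_swap (by decide), Equiv.Perm.sign_swap (by decide)]; simp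
  simp [Fin.sum_univ_six, e0, h345, h435, h543, h354, h453, h534]
  abel

/-- Relabelling by `π` costs its sign, and the six surviving orderings of the complement contribute
equally. Skewness is asked only at distinct indices so that Clifford products qualify, which fail it
at repeated indices. -/
theorem sum_epsUp_perm {V : Type*} [AddCommGroup V] [Module ℝ V] (π : Equiv.Perm (Fin 6))
    (k : Fin 6 → Fin 6 → Fin 6 → V)
    (h1 : ∀ x y z, x ≠ y → x ≠ z → y ≠ z → k x y z = -k y x z)
    (h2 : ∀ x y z, x ≠ y → x ≠ z → y ≠ z → k x y z = -k x z y) :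
    ∑ x, ∑ y, ∑ z, epsUp ![π 0, π 1, π 2, x, y, z] • k x y z =
      (6 * (Equiv.Perm.sign π : ℤ) : ℝ) • k (π 3) (π 4) (π 5) := by
  have e : ∀ x y z, epsUp ![π 0, π 1, π 2, π x, π y, π z] =
      (Equiv.Perm.sign π : ℤ) * epsUp ![0, 1, 2, x, y, z] := by
    intro x y z
    rw [← epsUp_perm_comp]
    congr 1
    ext i; fin_cases i <;> rfl
  have r : ∑ x, ∑ y, ∑ z, epsUp ![π 0, π 1, π 2, x, y, z] • k x y z =
      ∑ x, ∑ y, ∑ z, epsUp ![π 0, π 1, π 2, π x, π y, π z] • k (π x) (π y) (π z) := by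
    rw [← Equiv.sum_comp π]
    refine Finset.sum_congr rfl fun x _ => ?_
    rw [← Equiv.sum_comp π]
    refine Finset.sum_congr rfl fun y _ => ?_
    rw [← Equiv.sum_comp π]
  rw [r]
  simp only [e, mul_smul, ← Finset.smul_sum]
  rw [sum_epsUp fun x y z => k (π x) (π y) (π z)]
  have hne : ∀ i j : Fin 6, i ≠ j → π i ≠ π j := fun i j h h' => h (π.injective h')
  have n34 := hne 3 4 (by decide)
  have n35 := hne 3 5 (by decide)
  have n45 := hne 4 5 (by decide)
  have k1 := h1 _ _ _ n34.symm n45 n35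
  have k2 := h2 _ _ _ n35 n34 n45.symm
  have k3 := h1 _ _ _ n35.symm n45.symm n34
  have k4 := h2 _ _ _ n45 n34.symm n35.symm
  have k5 := h1 _ _ _ n45.symm n35.symm n34.symm
  rw [k5, k4, k1, k3, k2, smul_comm]
  module

/-- The metric factors on the summed indices occur twice, in `epsDown` and in `raise3`, and cancel.
-/
theorem hodge_eq (h : Fin 6 → Fin 6 → Fin 6 → ℝ) (a b c : Fin 6) :
    hodge h a b c = (1 / 6) * (ηt a * ηt b * ηt c) *
      ∑ x, ∑ y, ∑ z, epsUp ![a, b, c, x, y, z] • h x y z := by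
  simp only [hodge, smul_eq_mul, raise3, Finset.mul_sum]
  refine Finset.sum_congr rfl fun x _ => Finset.sum_congr rfl fun y _ =>
    Finset.sum_congr rfl fun z _ => ?_
  simp only [epsDown, Fin.prod_univ_six]
  simp only [Matrix.cons_val]
  linear_combination (1 / 6) * ηt a * ηt b * ηt c * epsUp ![a, b, c, x, y, z] * h x y z *
    (ηt y * ηt y * ηt z * ηt z * ηt_mul_self x + ηt z * ηt z * ηt_mul_self y + ηt_mul_self z)

theorem hodge_perm {h : Fin 6 → Fin 6 → Fin 6 → ℝ} (hh : IsSkew h) (π : Equiv.Perm (Fin 6)) :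
    hodge h (π 0) (π 1) (π 2) = ηt (π 0) * ηt (π 1) * ηt (π 2) * (Equiv.Perm.sign π : ℤ) *
      h (π 3) (π 4) (π 5) := by
  rw [hodge_eq, sum_epsUp_perm π h (fun _ _ _ _ _ _ => hh.1 _ _ _) (fun _ _ _ _ _ _ => hh.2 _ _ _),
    smul_eq_mul]
  ring

theorem hodge_isSkew (h : Fin 6 → Fin 6 → Fin 6 → ℝ) : IsSkew (hodge h) := by
  constructor <;> intro a b c <;> rw [hodge_eq, hodge_eq]
  · simp only [epsUp_skew₁₂ a b, neg_smul, Finset.sum_neg_distrib]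
    ring
  · simp only [epsUp_skew₂₃ a b, neg_smul, Finset.sum_neg_distrib]
    ring

/-- Two signs cancel: exchanging two blocks of three indices is odd, and the product of the six
metric entries is `-1`. -/
theorem hodge_hodge {h : Fin 6 → Fin 6 → Fin 6 → ℝ} (hh : IsSkew h) : hodge (hodge h) = h := by
  ext a b c
  by_cases hd : a ≠ b ∧ a ≠ c ∧ b ≠ c
  · obtain ⟨π, rfl, rfl, rfl⟩ := exists_perm hd.1 hd.2.1 hd.2.2
    have h1 : hodge h (π 3) (π 4) (π 5) = _ := hodge_perm hh (π * blockSwap)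
    rw [hodge_perm (hodge_isSkew h), h1, Equiv.Perm.sign_mul, sign_blockSwap]
    have hs : ((Equiv.Perm.sign π : ℤ) : ℝ) * (Equiv.Perm.sign π : ℤ) = 1 := by
      exact sign_mul_self π
    have hp := prod_ηt
    rw [← Equiv.prod_comp π, Fin.prod_univ_six] at hp
    have b0 : (π * blockSwap) 0 = π 3 := rfl
    have b1 : (π * blockSwap) 1 = π 4 := rfl
    have b2 : (π * blockSwap) 2 = π 5 := rfl
    have b3 : (π * blockSwap) 3 = π 0 := rfl
    have b4 : (π * blockSwap) 4 = π 1 := rfl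
    have b5 : (π * blockSwap) 5 = π 2 := rfl
    rw [b0, b1, b2, b3, b4, b5]
    push_cast
    linear_combination (-(h (π 0) (π 1) (π 2)) * ((Equiv.Perm.sign π : ℤ) : ℝ) ^ 2) * hp +
      h (π 0) (π 1) (π 2) * hs
  · have z1 : hodge (hodge h) a b c = 0 := by_contra fun h0 => hd ((hodge_isSkew _).ne h0)
    have z2 : h a b c = 0 := by_contra fun h0 => hd (hh.ne h0)
    rw [z1, z2]

theorem sum_perm_three {V : Type*} [AddCommGroup V] (F : Equiv.Perm (Fin 3) → V) :
    ∑ s, F s = F 1 + F (Equiv.swap 0 1) + F (Equiv.swap 0 2) + F (Equiv.swap 1 2) +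
      F (Equiv.swap 0 1 * Equiv.swap 1 2) + F (Equiv.swap 1 2 * Equiv.swap 0 1) := by
  have : (Finset.univ : Finset (Equiv.Perm (Fin 3))) = {1, Equiv.swap 0 1, Equiv.swap 0 2,
      Equiv.swap 1 2, Equiv.swap 0 1 * Equiv.swap 1 2, Equiv.swap 1 2 * Equiv.swap 0 1} := by
    decide
  rw [this, Finset.sum_insert (by decide), Finset.sum_insert (by decide),
    Finset.sum_insert (by decide), Finset.sum_insert (by decide), Finset.sum_insert (by decide),
    Finset.sum_singleton]
  abel

/-! ### The Clifford action of three-forms, and Hodge duality as multiplication by `W`. -/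

namespace Majorana

variable (R : Majorana)

theorem γ3up_eq (a b c : Fin 6) : R.γ3up ![a, b, c] = (1 / 6 : ℝ) •
    (R.γup a * R.γup b * R.γup c - R.γup b * R.γup a * R.γup c - R.γup c * R.γup b * R.γup a
      - R.γup a * R.γup c * R.γup b + R.γup b * R.γup c * R.γup a
      + R.γup c * R.γup a * R.γup b) := by
  have s1 : Equiv.Perm.sign (Equiv.swap (0 : Fin 3) 1 * Equiv.swap 1 2) = 1 := by decide
  have s2 : Equiv.Perm.sign (Equiv.swap (1 : Fin 3) 2 * Equiv.swap 0 1) = 1 := by decide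
  have s3 : Equiv.Perm.sign (Equiv.swap (0 : Fin 3) 1) = -1 := by decide
  have s4 : Equiv.Perm.sign (Equiv.swap (0 : Fin 3) 2) = -1 := by decide
  have s5 : Equiv.Perm.sign (Equiv.swap (1 : Fin 3) 2) = -1 := by decide
  rw [γ3up, sum_perm_three, s1, s2, s3, s4, s5, Equiv.Perm.sign_one]
  have e1 : (Equiv.swap (0 : Fin 3) 1) 0 = 1 := by decide
  have e2 : (Equiv.swap (0 : Fin 3) 1) 1 = 0 := by decide
  have e3 : (Equiv.swap (0 : Fin 3) 1) 2 = 2 := by decide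
  have e4 : (Equiv.swap (0 : Fin 3) 2) 0 = 2 := by decide
  have e5 : (Equiv.swap (0 : Fin 3) 2) 1 = 1 := by decide
  have e6 : (Equiv.swap (0 : Fin 3) 2) 2 = 0 := by decide
  have e7 : (Equiv.swap (1 : Fin 3) 2) 0 = 0 := by decide
  have e8 : (Equiv.swap (1 : Fin 3) 2) 1 = 2 := by decide
  have e9 : (Equiv.swap (1 : Fin 3) 2) 2 = 1 := by decide
  simp only [Equiv.Perm.mul_apply, Equiv.Perm.one_apply, e1, e2, e3, e4, e5, e6, e7, e8, e9]
  simp only [Matrix.cons_val, Units.val_one, Int.cast_one, one_smul, Units.val_neg, Int.cast_neg,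
    neg_one_smul]
  congr 1

theorem γup_eq (a : Fin 6) : R.γup a = ηt a • R.γ a := rfl

theorem γ_eq (a : Fin 6) : R.γ a = ηt a • R.γup a := by
  rw [γup_eq, smul_smul, ηt_mul_self, one_smul]

theorem γup_anti {a b : Fin 6} (h : a ≠ b) : R.γup a * R.γup b = -(R.γup b * R.γup a) := by
  simp only [γup_eq, smul_mul_assoc, mul_smul_comm]
  rw [R.γ_anti h, smul_neg, smul_neg, smul_comm]

theorem slash_eq_γ3up (h : Fin 6 → Fin 6 → Fin 6 → ℝ) :
    slash R h = (1 / 6 : ℝ) • ∑ a, ∑ b, ∑ c, h a b c • R.γ3up ![a, b, c] := by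
  ext i j
  simp only [slash, Matrix.of_apply, Matrix.smul_apply, Matrix.sum_apply, smul_eq_mul]
  simp only [mul_comm]

/-- Skew coefficients vanish at repeated indices, and at distinct indices the generators already
anticommute, so the skew-symmetrisation in `γ3up` changes nothing. -/
theorem slash_eq {h : Fin 6 → Fin 6 → Fin 6 → ℝ} (hh : IsSkew h) :
    slash R h = (1 / 6 : ℝ) • ∑ a, ∑ b, ∑ c, h a b c • (R.γup a * R.γup b * R.γup c) := by
  rw [slash_eq_γ3up]
  congr 1
  refine Finset.sum_congr rfl fun a _ => Finset.sum_congr rfl fun b _ =>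
    Finset.sum_congr rfl fun c _ => ?_
  by_cases h0 : h a b c = 0
  · rw [h0, zero_smul, zero_smul]
  obtain ⟨hab, hac, hbc⟩ := hh.ne h0
  congr 1
  have k1 : R.γup b * R.γup a * R.γup c = -(R.γup a * R.γup b * R.γup c) := by
    rw [R.γup_anti hab.symm, neg_mul]
  have k2 : R.γup a * R.γup c * R.γup b = -(R.γup a * R.γup b * R.γup c) := by
    rw [mul_assoc, R.γup_anti hbc.symm, mul_neg, mul_assoc]
  have k3 : R.γup c * R.γup a * R.γup b = R.γup a * R.γup b * R.γup c := by
    rw [R.γup_anti hac.symm, neg_mul, k2, neg_neg]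
  have k4 : R.γup b * R.γup c * R.γup a = R.γup a * R.γup b * R.γup c := by
    rw [mul_assoc, R.γup_anti hac.symm, mul_neg, ← mul_assoc, k1, neg_neg]
  have k5 : R.γup c * R.γup b * R.γup a = -(R.γup a * R.γup b * R.γup c) := by
    rw [mul_assoc, R.γup_anti hab.symm, mul_neg, ← mul_assoc, k3]
  rw [γ3up_eq, k1, k2, k3, k4, k5]
  module

/-- Adjacent transpositions generate the symmetric group, and each exchanges two neighbouring
anticommuting factors. The extra `π` makes the statement stable under composition. -/
theorem prod_γ_perm (σ π : Equiv.Perm (Fin 6)) :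
    (List.ofFn fun i => R.γ (π (σ i))).prod =
      ((Equiv.Perm.sign σ : ℤ) : ℝ) • (List.ofFn fun i => R.γ (π i)).prod := by
  have hσ : σ ∈ Submonoid.closure (Set.range fun i : Fin 5 => Equiv.swap i.castSucc i.succ) := by
    rw [Equiv.Perm.mclosure_swap_castSucc_succ]; trivial
  induction hσ using Submonoid.closure_induction generalizing π with
  | mem σ hσ =>
    obtain ⟨i, rfl⟩ := hσ
    have hi : i.castSucc ≠ i.succ := (Fin.castSucc_lt_succ).ne
    simp only
    rw [Equiv.Perm.sign_swap hi]
    have hne : R.γ (π i.succ) * R.γ (π i.castSucc) = -(R.γ (π i.castSucc) * R.γ (π i.succ)) :=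
      R.γ_anti fun h => hi (π.injective h).symm
    have hne' : ∀ x, R.γ (π i.succ) * (R.γ (π i.castSucc) * x) =
        -(R.γ (π i.castSucc) * (R.γ (π i.succ) * x)) := fun x => by
      rw [← mul_assoc, hne, neg_mul, mul_assoc]
    simp only [List.ofFn_succ, List.ofFn_zero, List.prod_cons, List.prod_nil, mul_one]
    fin_cases i <;>
    · simp [Fin.succ, Equiv.swap_apply_def] at hne hne' ⊢
      simp [hne, hne']
  | one => simp
  | mul σ τ _ _ h1 h2 =>
    have h3 := h2 (π * σ)
    simp only [Equiv.Perm.mul_apply] at h3 ⊢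
    rw [h3, h1, smul_smul, Equiv.Perm.sign_mul]
    push_cast
    rw [mul_comm]

/-- Since `W` is also the product of the tangential generators, the three given factors cancel
against it and the complementary three remain. The minus sign comes from squaring a product of three
anticommuting generators. -/
theorem γγγ_W (π : Equiv.Perm (Fin 6)) :
    R.γup (π 0) * R.γup (π 1) * R.γup (π 2) * R.W =
      -((Equiv.Perm.sign π : ℤ) : ℝ) • (R.γ (π 3) * R.γ (π 4) * R.γ (π 5)) := by
  have hW := R.prod_γ_perm π 1
  simp only [Equiv.Perm.one_apply] at hW
  rw [show (List.ofFn fun i => R.γ i).prod = R.W from R.prod_γ] at hW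
  have hs : ((Equiv.Perm.sign π : ℤ) : ℝ) * (Equiv.Perm.sign π : ℤ) = 1 := by
    exact sign_mul_self π
  have hW' : R.W = ((Equiv.Perm.sign π : ℤ) : ℝ) • (List.ofFn fun i => R.γ (π i)).prod := by
    rw [hW, smul_smul, hs, one_smul]
  have ne : ∀ i j : Fin 6, i ≠ j → R.γ (π i) * R.γ (π j) = -(R.γ (π j) * R.γ (π i)) :=
    fun i j h => R.γ_anti fun h' => h (π.injective h')
  have sq : ∀ i x, R.γ (π i) * (R.γ (π i) * x) = ηt (π i) • x := fun i x => by
    rw [← mul_assoc, γ_sq, smul_mul_assoc, one_mul]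
  have key : R.γ (π 0) * R.γ (π 1) * R.γ (π 2) * (List.ofFn fun i => R.γ (π i)).prod =
      -(ηt (π 0) * ηt (π 1) * ηt (π 2)) • (R.γ (π 3) * R.γ (π 4) * R.γ (π 5)) := by
    have n10 := ne 1 0 (by decide)
    have n20 := ne 2 0 (by decide)
    have n21 := ne 2 1 (by decide)
    have n10' : ∀ x, R.γ (π 1) * (R.γ (π 0) * x) = -(R.γ (π 0) * (R.γ (π 1) * x)) := fun x => by
      rw [← mul_assoc, n10, neg_mul, mul_assoc]
    have n20' : ∀ x, R.γ (π 2) * (R.γ (π 0) * x) = -(R.γ (π 0) * (R.γ (π 2) * x)) := fun x => by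
      rw [← mul_assoc, n20, neg_mul, mul_assoc]
    have n21' : ∀ x, R.γ (π 2) * (R.γ (π 1) * x) = -(R.γ (π 1) * (R.γ (π 2) * x)) := fun x => by
      rw [← mul_assoc, n21, neg_mul, mul_assoc]
    have : (List.ofFn fun i => R.γ (π i)).prod = R.γ (π 0) * (R.γ (π 1) * (R.γ (π 2) *
        (R.γ (π 3) * (R.γ (π 4) * R.γ (π 5))))) := by
      simp [Fin.succ]
    rw [this]
    simp only [mul_assoc, n10', n20', n21', sq, mul_neg, neg_neg, mul_smul_comm, smul_smul,
      neg_smul, smul_neg]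
    rw [← mul_assoc, mul_comm (ηt (π 2) * ηt (π 1)), mul_comm (ηt (π 2))]
  rw [hW', mul_smul_comm]
  simp only [γup_eq, smul_mul_assoc, mul_smul_comm]
  rw [key]
  simp only [smul_smul]
  congr 1
  linear_combination (-((Equiv.Perm.sign π : ℤ) : ℝ)) *
    (ηt (π 1) * ηt (π 1) * ηt (π 2) * ηt (π 2) * ηt_mul_self (π 0) +
      ηt (π 2) * ηt (π 2) * ηt_mul_self (π 1) + ηt_mul_self (π 2))

/-- Hodge duality is multiplication with the transversal volume element. -/
theorem slash_hodge {h : Fin 6 → Fin 6 → Fin 6 → ℝ} (hh : IsSkew h) :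
    slash R (hodge h) = slash R h * R.W := by
  have h1 : ∀ a b c, hodge h a b c • (R.γup a * R.γup b * R.γup c) =
      (1 / 6 : ℝ) • ∑ x, ∑ y, ∑ z, epsUp ![a, b, c, x, y, z] • h x y z •
        (R.γ a * R.γ b * R.γ c) := by
    intro a b c
    simp only [R.γ_eq, smul_mul_assoc, mul_smul_comm, smul_smul, ← Finset.sum_smul]
    rw [hodge_eq]
    congr 1
    simp only [smul_eq_mul, Finset.mul_sum]
    refine Finset.sum_congr rfl fun x _ => Finset.sum_congr rfl fun y _ =>
      Finset.sum_congr rfl fun z _ => ?_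
    ring
  rw [R.slash_eq (hodge_isSkew h), R.slash_eq hh, smul_mul_assoc]
  congr 1
  simp only [h1, Finset.sum_mul, smul_mul_assoc, Finset.smul_sum]
  have comm : ∀ G : Fin 6 → Fin 6 → Fin 6 → Fin 6 → Fin 6 → Fin 6 → Mat,
      ∑ a, ∑ b, ∑ c, ∑ x, ∑ y, ∑ z, G a b c x y z =
        ∑ x, ∑ y, ∑ z, ∑ a, ∑ b, ∑ c, G a b c x y z := by
    intro G
    have := Finset.sum_comm (s := (Finset.univ : Finset (Fin 6 × Fin 6 × Fin 6)))
      (t := (Finset.univ : Finset (Fin 6 × Fin 6 × Fin 6)))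
      (f := fun p q => G p.1 p.2.1 p.2.2 q.1 q.2.1 q.2.2)
    simpa only [Fintype.sum_prod_type] using this
  rw [comm]
  refine Finset.sum_congr rfl fun x _ => Finset.sum_congr rfl fun y _ =>
    Finset.sum_congr rfl fun z _ => ?_
  by_cases h0 : h x y z = 0
  · simp [h0]
  obtain ⟨hxy, hxz, hyz⟩ := hh.ne h0
  obtain ⟨π, rfl, rfl, rfl⟩ := exists_perm hxy hxz hyz
  -- The sign of exchanging the two index blocks matches the minus sign in `γγγ_W`.
  simp only [epsUp_blockSwap _ _ _ (π 0), neg_smul, smul_neg, Finset.sum_neg_distrib,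
    ← Finset.smul_sum]
  rw [γγγ_W]
  have := sum_epsUp_perm π (fun a b c => h (π 0) (π 1) (π 2) • (R.γ a * R.γ b * R.γ c))
    (fun a b c hab _ _ => by rw [R.γ_anti hab, neg_mul, smul_neg])
    (fun a b c _ _ hbc => by rw [mul_assoc, R.γ_anti hbc, mul_neg, smul_neg, mul_assoc])
  rw [this]
  module

end Majorana

theorem IsSkew.add {h k : Fin 6 → Fin 6 → Fin 6 → ℝ} (hh : IsSkew h) (hk : IsSkew k) :
    IsSkew (h + k) :=
  ⟨fun a b c => by simp only [Pi.add_apply]; rw [hh.1, hk.1]; ring,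
    fun a b c => by simp only [Pi.add_apply]; rw [hh.2, hk.2]; ring⟩

theorem IsSkew.smul {h : Fin 6 → Fin 6 → Fin 6 → ℝ} (hh : IsSkew h) (r : ℝ) : IsSkew (r • h) :=
  ⟨fun a b c => by simp only [Pi.smul_apply, smul_eq_mul]; rw [hh.1]; ring,
    fun a b c => by simp only [Pi.smul_apply, smul_eq_mul]; rw [hh.2]; ring⟩

theorem hodge_add (h k : Fin 6 → Fin 6 → Fin 6 → ℝ) : hodge (h + k) = hodge h + hodge k := by
  ext a b c
  simp only [Pi.add_apply, hodge_eq, smul_add, Finset.sum_add_distrib, mul_add]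

theorem hodge_smul (r : ℝ) (h : Fin 6 → Fin 6 → Fin 6 → ℝ) : hodge (r • h) = r • hodge h := by
  ext a b c
  simp only [Pi.smul_apply, hodge_eq, smul_eq_mul, Finset.mul_sum]
  refine Finset.sum_congr rfl fun x _ => Finset.sum_congr rfl fun y _ =>
    Finset.sum_congr rfl fun z _ => ?_
  ring

/-- The real self-dual rank-3 skew-symmetric tensors. -/
def selfDual : Submodule ℝ (Fin 6 → Fin 6 → Fin 6 → ℝ) where
  carrier := {h | IsSkew h ∧ h = hodge h}
  add_mem' := by
    rintro h k ⟨h1, h2⟩ ⟨k1, k2⟩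
    exact ⟨h1.add k1, by rw [hodge_add, ← h2, ← k2]⟩
  zero_mem' := ⟨⟨by simp, by simp⟩, by ext; simp [hodge_eq]⟩
  smul_mem' := by
    rintro r h ⟨h1, h2⟩
    exact ⟨h1.smul r, by rw [hodge_smul, ← h2]⟩

/-! ### Classification of the gauge-invariant odd-odd shear component. -/

namespace Majorana

variable (R : Majorana)

theorem slash_add (h k : Fin 6 → Fin 6 → Fin 6 → ℝ) :
    slash R (h + k) = slash R h + slash R k := by
  simp only [slash_eq_γ3up, Pi.add_apply, add_smul, Finset.sum_add_distrib, smul_add]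

theorem slash_smul (r : ℝ) (h : Fin 6 → Fin 6 → Fin 6 → ℝ) :
    slash R (r • h) = r • slash R h := by
  simp only [slash_eq_γ3up, Pi.smul_apply, smul_eq_mul, mul_smul, ← Finset.smul_sum]
  rw [smul_comm]

theorem exists_slash_eq_γγγ {p q r : Fin 6} (hpq : p ≠ q) (hpr : p ≠ r) (hqr : q ≠ r) :
    ∃ h, IsSkew h ∧ R.γ p * R.γ q * R.γ r = slash R h := by
  obtain ⟨π, rfl, rfl, rfl⟩ := exists_perm hpq hpr hqr
  -- The witness is the Levi-Civita symbol with the complementary indices fixed; `t` corrects its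
  -- orientation and the raised indices of the generators.
  set t : ℝ := (Equiv.Perm.sign π : ℤ) * (ηt (π 0) * ηt (π 1) * ηt (π 2)) with ht
  have hk : IsSkew fun a b c => epsUp ![a, b, c, π 3, π 4, π 5] :=
    ⟨fun a b c => epsUp_skew₁₂ a b c _ _ _, fun a b c => epsUp_skew₂₃ a b c _ _ _⟩
  refine ⟨t • _, hk.smul t, ?_⟩
  rw [slash_smul, R.slash_eq hk]
  have := sum_epsUp_perm (π * blockSwap) (fun a b c => R.γup a * R.γup b * R.γup c)
    (fun a b c hab _ _ => by rw [R.γup_anti hab, neg_mul])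
    (fun a b c _ _ hbc => by rw [mul_assoc, R.γup_anti hbc, mul_neg, mul_assoc])
  rw [Equiv.Perm.sign_mul, sign_blockSwap] at this
  have b0 : (π * blockSwap) 0 = π 3 := rfl
  have b1 : (π * blockSwap) 1 = π 4 := rfl
  have b2 : (π * blockSwap) 2 = π 5 := rfl
  have b3 : (π * blockSwap) 3 = π 0 := rfl
  have b4 : (π * blockSwap) 4 = π 1 := rfl
  have b5 : (π * blockSwap) 5 = π 2 := rfl
  rw [b0, b1, b2, b3, b4, b5] at this
  simp only [epsUp_blockSwap _ _ _ (π 3), neg_smul, Finset.sum_neg_distrib]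
  rw [this]
  simp only [γup_eq, smul_mul_assoc, mul_smul_comm, smul_smul, ← neg_smul]
  nth_rw 1 [← one_smul ℝ (R.γ (π 0) * R.γ (π 1) * R.γ (π 2))]
  congr 1
  rw [ht]
  have hs := sign_mul_self π
  push_cast
  linear_combination (-(ηt (π 0) * ηt (π 0) * ηt (π 1) * ηt (π 1) * ηt (π 2) * ηt (π 2))) * hs
    - (ηt (π 1) * ηt (π 1) * ηt (π 2) * ηt (π 2) * ηt_mul_self (π 0) +
      ηt (π 2) * ηt (π 2) * ηt_mul_self (π 1) + ηt_mul_self (π 2))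

theorem exists_slash_of_mem_oddSpace {M : Mat} (hM : M ∈ R.oddSpace 1) :
    ∃ h, IsSkew h ∧ M = slash R h := by
  let W : Submodule ℝ Mat :=
    { carrier := {M | ∃ h, IsSkew h ∧ M = slash R h}
      add_mem' := by
        rintro _ _ ⟨h, hh, rfl⟩ ⟨k, hk, rfl⟩
        exact ⟨h + k, hh.add hk, (R.slash_add h k).symm⟩
      zero_mem' := ⟨0, ⟨by simp, by simp⟩, by simp [slash_eq_γ3up]⟩
      smul_mem' := by
        rintro r _ ⟨h, hh, rfl⟩
        exact ⟨r • h, hh.smul r, (R.slash_smul r h).symm⟩ }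
  exact R.oddSpace_one_le (W := W) (fun p q r hpq hpr hqr => R.exists_slash_eq_γγγ hpq hpr hqr) hM

/-- The product `Γ_0 W` of the first transversal generator with `W` consists of two bilinears and so
commutes with `M`, while `W` acts as `1` on the right of `M` and as `-1` on its left. This gives
anticommutation with the first generator, and the bilinears `Γ_i Γ_0` carry it to the others. -/
theorem anti_of_comm {M : Mat} (hP : R.Pbar * M * R.P = M)
    (hc : ∀ i j, i ≠ j → M * (R.Γ (Sum.inr i) * R.Γ (Sum.inr j)) =
      R.Γ (Sum.inr i) * R.Γ (Sum.inr j) * M) (i : Fin 5) :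
    R.Γ (Sum.inr i) * M = -(M * R.Γ (Sum.inr i)) := by
  have hMW : M * R.W = M := by rw [← hP, mul_assoc, P_W]
  have hWM : R.W * M = -M := by
    have : R.W * R.Pbar = -R.Pbar := by rw [Pbar, mul_sub, W_P, mul_one, P_eq]; module
    rw [← hP, mul_assoc, ← mul_assoc, this, neg_mul]
  have sq : ∀ i, R.Γ (Sum.inr i) * R.Γ (Sum.inr i) = 1 := fun i => by
    rw [Γ_sq, η_inr, one_smul]
  have hW : R.W = R.Γ (Sum.inr 0) * ((R.Γ (Sum.inr 1) * R.Γ (Sum.inr 2)) *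
      (R.Γ (Sum.inr 3) * R.Γ (Sum.inr 4))) := by
    simp [W, mul_assoc, Fin.succ]
  set Q := (R.Γ (Sum.inr 1) * R.Γ (Sum.inr 2)) * (R.Γ (Sum.inr 3) * R.Γ (Sum.inr 4)) with hQ
  have hΓW : R.Γ (Sum.inr 0) * R.W = Q := by rw [hW, ← mul_assoc, sq, one_mul]
  have hMQ : M * Q = Q * M := by
    rw [hQ, ← mul_assoc, hc 1 2 (by decide), mul_assoc, hc 3 4 (by decide)]
    simp only [mul_assoc]
  have h0 : R.Γ (Sum.inr 0) * M = -(M * R.Γ (Sum.inr 0)) := by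
    have h1 : M * R.Γ (Sum.inr 0) = Q * M := by
      nth_rw 1 [← hMW]
      rw [mul_assoc, W_Γ, hΓW, hMQ]
    rw [h1, ← hΓW, mul_assoc, hWM, mul_neg, neg_neg]
  by_cases hi : i = 0
  · rw [hi, h0]
  · have h1 := hc i 0 hi
    have h2 : M * R.Γ (Sum.inr i) = M * (R.Γ (Sum.inr i) * R.Γ (Sum.inr 0)) * R.Γ (Sum.inr 0) := by
      rw [mul_assoc, mul_assoc, sq, mul_one]
    rw [h2, h1, mul_assoc, mul_assoc, ← neg_eq_iff_eq_neg.2 h0, mul_neg, mul_neg, neg_neg,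
      ← mul_assoc (R.Γ (Sum.inr 0)), sq, one_mul]

/-- Anticommuting `Γ_i` out of the skewness condition makes `M` self-adjoint for the pairing, hence
the Clifford action of some three-form. -/
theorem exists_selfDual {M : Mat} (hP : R.Pbar * M * R.P = M)
    (hc : ∀ i j, i ≠ j → M * (R.Γ (Sum.inr i) * R.Γ (Sum.inr j)) =
      R.Γ (Sum.inr i) * R.Γ (Sum.inr j) * M) {i : Fin 5}
    (hs : (R.C * R.Γ (Sum.inr i) * M).transpose = -(R.C * R.Γ (Sum.inr i) * M)) :
    ∃ h ∈ selfDual, M = slash R h * R.P := by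
  have ha := R.anti_of_comm hP hc
  have ht : M.transpose * R.C = R.C * M := by
    rw [Matrix.transpose_mul, C_Γ_transpose, mul_assoc, ha, mul_neg, neg_neg] at hs
    have := congrArg (· * R.Γ (Sum.inr i)) hs
    simpa [mul_assoc, Γ_sq] using this
  obtain ⟨h, hh, hM⟩ := R.exists_slash_of_mem_oddSpace (M := M) ⟨ha, by rw [ht, one_smul]⟩
  have hMP : M * R.P = M := by rw [← hP, mul_assoc, P_P]
  -- Because `W` acts as Hodge duality, passing to the self-dual part of `h` is right multiplication
  -- by `P`, which fixes `M`.
  refine ⟨(1 / 2 : ℝ) • (h + hodge h), ⟨(hh.add (hodge_isSkew h)).smul _, ?_⟩, ?_⟩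
  · rw [hodge_smul, hodge_add, hodge_hodge hh, add_comm]
  · have : slash R ((1 / 2 : ℝ) • (h + hodge h)) = M := by
      rw [slash_smul, slash_add, R.slash_hodge hh, ← hM]
      conv_rhs => rw [← hMP, P_eq, mul_smul_comm, mul_add, mul_one]
    rw [this, hMP]

theorem slash_mem_oddSpace {h : Fin 6 → Fin 6 → Fin 6 → ℝ} (hh : IsSkew h) :
    slash R h ∈ R.oddSpace 1 := by
  rw [R.slash_eq hh]
  refine Submodule.smul_mem _ _ <| Submodule.sum_mem _ fun a _ => Submodule.sum_mem _ fun b _ =>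
    Submodule.sum_mem _ fun c _ => ?_
  by_cases h0 : h a b c = 0
  · rw [h0, zero_smul]; exact Submodule.zero_mem _
  obtain ⟨hab, hac, hbc⟩ := hh.ne h0
  simp only [γup_eq, smul_mul_assoc, mul_smul_comm]
  refine Submodule.smul_mem _ _ <| Submodule.smul_mem _ _ <| Submodule.smul_mem _ _ <|
    Submodule.smul_mem _ _ ⟨fun i => ?_, ?_⟩
  · have hΓ : ∀ i p, R.Γ (Sum.inr i) * R.γ p = (-1 : ℝ) • (R.γ p * R.Γ (Sum.inr i)) := by
      intro i p; rw [Γ_γ, neg_one_smul]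
    simpa using mul_comm_sign (mul_comm_sign (hΓ i a) (hΓ i b)) (hΓ i c)
  · rw [one_smul, R.γγγ_transpose hab hac hbc]

theorem P_slash {h : Fin 6 → Fin 6 → Fin 6 → ℝ} (hh : IsSkew h) :
    R.P * slash R h = slash R h * R.Pbar := by
  have hP : ∀ a, R.P * R.γup a = R.γup a * R.Pbar := fun a => by
    rw [γup_eq, mul_smul_comm, P_γ, smul_mul_assoc]
  have hP' : ∀ a, R.Pbar * R.γup a = R.γup a * R.P := fun a => by
    rw [γup_eq, mul_smul_comm, Pbar_γ, smul_mul_assoc]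
  rw [R.slash_eq hh]
  simp only [mul_smul_comm, smul_mul_assoc, Finset.mul_sum, Finset.sum_mul]
  congr 1
  refine Finset.sum_congr rfl fun a _ => Finset.sum_congr rfl fun b _ =>
    Finset.sum_congr rfl fun c _ => ?_
  rw [mul_assoc, ← mul_assoc, hP, mul_assoc, ← mul_assoc R.Pbar, hP', mul_assoc (R.γup b), hP]
  simp only [mul_assoc]

theorem slash_P_skew {h : Fin 6 → Fin 6 → Fin 6 → ℝ} (hh : IsSkew h) (i : Fin 5) :
    (R.C * R.Γ (Sum.inr i) * (slash R h * R.P)).transpose =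
      -(R.C * R.Γ (Sum.inr i) * (slash R h * R.P)) := by
  obtain ⟨h1, h2⟩ := R.slash_mem_oddSpace hh
  rw [one_smul] at h2
  have hPb : R.Pbar * slash R h = slash R h * R.P := by
    have := R.P_slash hh
    rw [Pbar, sub_mul, this, Pbar, mul_sub]; simp
  rw [Matrix.transpose_mul, C_Γ_transpose, Matrix.transpose_mul, mul_assoc,
    ← mul_assoc (slash R h).transpose, h2, ← mul_assoc, ← mul_assoc, P_transpose,
    mul_assoc R.C, hPb, mul_assoc, mul_assoc, P_Γ, ← mul_assoc (slash R h), 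
    ← neg_eq_iff_eq_neg.2 (h1 i)]
  simp only [mul_assoc, neg_mul, mul_neg]

section SelfDual

variable {h : Fin 6 → Fin 6 → Fin 6 → ℝ}

theorem slash_mul_P (hh : h ∈ selfDual) : slash R h * R.P = slash R h := by
  have := R.slash_hodge hh.1
  rw [← hh.2] at this
  rw [P_eq, mul_smul_comm, mul_add, ← this, mul_one]; module

theorem Pbar_mul_slash (hh : h ∈ selfDual) : R.Pbar * slash R h = slash R h := by
  rw [Pbar, sub_mul, R.P_slash hh.1, Pbar, mul_sub, R.slash_mul_P hh]; simp

/-- The action annihilates the complement of `P(32)` and takes values there. -/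
theorem slash_mul_slash (hh : h ∈ selfDual) : slash R h * slash R h = 0 := by
  nth_rw 1 [← R.slash_mul_P hh]
  rw [← R.Pbar_mul_slash hh, mul_assoc, ← mul_assoc R.P, P_Pbar, zero_mul, mul_zero]

end SelfDual

/-! ### The sandwich identity that produces the square of a self-dual tensor. -/

theorem γ_γup (a b : Fin 6) :
    R.γ a * R.γup b = (if a = b then (2 : ℝ) else 0) • 1 - R.γup b * R.γ a := by
  rw [γup_eq, mul_smul_comm, γ_clifford, smul_mul_assoc, smul_sub]
  congr 1
  split_ifs with h
  · rw [smul_smul, h]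
    congr 1
    linear_combination 2 * ηt_mul_self b
  · simp

/-- Moving `γ_a` through three factors leaves three contractions, each with factor `2`. They agree
by skewness of `h`, so their sum cancels the prefactor `1/6`. -/
theorem γ_slash {h : Fin 6 → Fin 6 → Fin 6 → ℝ} (hh : IsSkew h) (a : Fin 6) :
    R.γ a * slash R h + slash R h * R.γ a = ∑ c, ∑ d, h a c d • (R.γup c * R.γup d) := by
  have key : ∀ b c d, R.γ a * (R.γup b * R.γup c * R.γup d) +
      R.γup b * R.γup c * R.γup d * R.γ a =
      (if a = b then (2 : ℝ) else 0) • (R.γup c * R.γup d) -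
      (if a = c then (2 : ℝ) else 0) • (R.γup b * R.γup d) +
      (if a = d then (2 : ℝ) else 0) • (R.γup b * R.γup c) := by
    intro b c d
    have e1 : R.γ a * (R.γup b * R.γup c * R.γup d) = R.γ a * R.γup b * (R.γup c * R.γup d) := by
      simp only [mul_assoc]
    have e2 : R.γup b * R.γ a * (R.γup c * R.γup d) = R.γup b * (R.γ a * R.γup c) * R.γup d := by
      simp only [mul_assoc]
    have e3 : R.γup b * (R.γup c * R.γ a) * R.γup d = R.γup b * R.γup c * (R.γ a * R.γup d) := by
      simp only [mul_assoc]
    rw [e1, γ_γup, sub_mul, e2, γ_γup, mul_sub, sub_mul, e3, γ_γup, mul_sub]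
    simp only [smul_mul_assoc, mul_smul_comm, one_mul, mul_one, mul_assoc]
    abel
  rw [R.slash_eq hh, mul_smul_comm, smul_mul_assoc, ← smul_add]
  simp only [Finset.mul_sum, Finset.sum_mul, mul_smul_comm, smul_mul_assoc,
    ← Finset.sum_add_distrib, ← smul_add, key]
  simp only [smul_add, smul_sub, Finset.sum_add_distrib, Finset.sum_sub_distrib, ite_smul,
    zero_smul, smul_ite, smul_zero, Finset.sum_ite_irrel, Finset.sum_const_zero,
    Finset.sum_ite_eq, Finset.mem_univ, if_true]
  have h1 : ∀ b d, h b a d = -h a b d := fun b d => hh.1 b a d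
  have h2 : ∀ b c, h b c a = h a b c := fun b c => by rw [hh.2, hh.1, neg_neg]
  simp only [h1, h2, neg_smul, Finset.sum_neg_distrib]
  simp only [smul_smul, mul_comm _ (2 : ℝ)]
  simp only [mul_smul, ← Finset.smul_sum]
  module

/-- The Minkowski metric with two upper tangential indices. -/
def gUp (a b : Fin 6) : ℝ := if a = b then ηt a else 0

theorem γup_γup (a b : Fin 6) : R.γup a * R.γup b = (2 * gUp a b) • 1 - R.γup b * R.γup a := by
  nth_rw 1 [γup_eq]
  rw [smul_mul_assoc, γ_γup, smul_sub, smul_smul]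
  nth_rw 3 [γup_eq]
  rw [mul_smul_comm]
  congr 2
  unfold gUp
  split_ifs <;> ring

theorem trace_γup_γup (a b : Fin 6) : (R.γup a * R.γup b).trace = 32 * gUp a b := by
  have h := congrArg Matrix.trace (R.γup_γup a b)
  rw [Matrix.trace_sub, Matrix.trace_mul_comm (R.γup b), Matrix.trace_smul, Matrix.trace_one,
    smul_eq_mul] at h
  simp at h
  linarith

theorem trace_γup_four (a b c d : Fin 6) :
    (R.γup a * R.γup b * (R.γup c * R.γup d)).trace =
      32 * (gUp a b * gUp c d - gUp a c * gUp b d + gUp a d * gUp b c) := by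
  have e1 : R.γup b * R.γup a * (R.γup c * R.γup d) = R.γup b * (R.γup a * R.γup c) * R.γup d := by
    simp only [mul_assoc]
  have e2 : R.γup b * (R.γup c * R.γup a) * R.γup d = R.γup b * R.γup c * (R.γup a * R.γup d) := by
    simp only [mul_assoc]
  have h : R.γup a * R.γup b * (R.γup c * R.γup d) =
      (2 * gUp a b) • (R.γup c * R.γup d) - ((2 * gUp a c) • (R.γup b * R.γup d) -
      ((2 * gUp a d) • (R.γup b * R.γup c) - R.γup b * R.γup c * R.γup d * R.γup a)) := by
    rw [γup_γup, sub_mul, e1, γup_γup R a c, mul_sub, sub_mul, e2, γup_γup R a d, mul_sub]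
    simp only [smul_mul_assoc, mul_smul_comm, one_mul, mul_one, mul_assoc]
  have e3 : (R.γup b * R.γup c * R.γup d * R.γup a).trace =
      (R.γup a * R.γup b * (R.γup c * R.γup d)).trace := by
    rw [Matrix.trace_mul_comm]; simp only [mul_assoc]
  have h' := congrArg Matrix.trace h
  simp only [Matrix.trace_sub, Matrix.trace_smul, trace_γup_γup, smul_eq_mul, e3] at h'
  linarith

/-- The `W` part of `P` has no trace here: any `γ_c` with `c` different from `a` and `b`
anticommutes with `γ_a γ_b W`. -/
theorem trace_γ_γ_P (a b : Fin 6) :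
    (R.γ a * (R.γ b * R.P)).trace = if a = b then 16 * ηt a else 0 := by
  have h1 : (R.γ a * R.γ b).trace = 32 * (ηt a * ηt b * gUp a b) := by
    rw [R.γ_eq, R.γ_eq b, smul_mul_assoc, mul_smul_comm, Matrix.trace_smul, Matrix.trace_smul,
      trace_γup_γup, smul_eq_mul, smul_eq_mul]
    ring
  have h2 : (R.γ a * R.γ b * R.W).trace = 0 := by
    have hex : ∀ a b : Fin 6, ∃ c, c ≠ a ∧ c ≠ b := by decide
    obtain ⟨c, hca, hcb⟩ := hex a b
    refine R.trace_eq_zero_of_anti (Sum.inl c) ?_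
    change R.γ c * _ = -(_ * R.γ c)
    rw [← mul_assoc, ← mul_assoc, R.γ_anti hca, neg_mul, mul_assoc (R.γ a), R.γ_anti hcb, mul_neg,
      neg_neg, mul_assoc, mul_assoc, mul_assoc, γ_W]
    simp only [mul_neg, mul_assoc]
  rw [P_eq, mul_smul_comm, mul_smul_comm, mul_add, mul_one, mul_add, ← mul_assoc,
    Matrix.trace_smul, Matrix.trace_add, h1, h2, smul_eq_mul, gUp]
  split_ifs with h
  · rw [h]
    linear_combination 16 * ηt b * ηt_mul_self b
  · ring

/-- The space is contained in the span of all `γ_p` and `γ_p W`, and these coincide after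
multiplication by `P`. -/
theorem exists_eq_sum_γ_P {M : Mat} (hM : M ∈ R.oddSpace (-1)) :
    ∃ v : Fin 6 → ℝ, M * R.P = ∑ c, v c • (R.γ c * R.P) := by
  let W : Submodule ℝ Mat :=
    { carrier := {M | ∃ v : Fin 6 → ℝ, M * R.P = ∑ c, v c • (R.γ c * R.P)}
      add_mem' := by
        rintro M N ⟨v, hv⟩ ⟨w, hw⟩
        exact ⟨v + w, by simp only [add_mul, hv, hw, Pi.add_apply, add_smul,
          Finset.sum_add_distrib]⟩
      zero_mem' := ⟨0, by simp⟩
      smul_mem' := by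
        rintro r M ⟨v, hv⟩
        exact ⟨r • v, by simp only [smul_mul_assoc, hv, Pi.smul_apply, smul_assoc,
          Finset.smul_sum]⟩ }
  refine R.oddSpace_neg_one_le (W := W) (fun p => ⟨Pi.single p 1, ?_⟩)
    (fun p => ⟨Pi.single p 1, ?_⟩) hM
  · simp [Pi.single_apply]
  · simp [Pi.single_apply, mul_assoc, W_P]

/-- The square of a self-dual tensor from its Clifford action. -/
theorem slash_γup_slash {h : Fin 6 → Fin 6 → Fin 6 → ℝ} (hh : h ∈ selfDual) (a : Fin 6) :
    slash R h * R.γup a * slash R h = (-2 : ℝ) • ∑ b, sq h b a • (R.γup b * R.P) := by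
  obtain ⟨h1, h2⟩ := R.slash_mem_oddSpace hh.1
  rw [one_smul] at h2
  have hss := R.slash_mul_slash hh
  have hF := R.γ_slash hh.1
  have hsP := R.slash_mul_P hh
  set s := slash R h with hs
  -- The sandwich anticommutes with transversal generators and is skew-adjoint, so it is a
  -- combination of the `γ_c P`. Only the coefficients `v` remain, and pairing with `γ_b` under the
  -- trace extracts them.
  have hM : s * R.γ a * s ∈ R.oddSpace (-1) := by
    constructor
    · intro i
      have h1' := (h1 i).trans (neg_one_smul ℝ _).symm
      have h3 := (R.Γ_γ i a).trans (neg_one_smul ℝ _).symm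
      simpa using mul_comm_sign (mul_comm_sign h1' h3) h1'
    · rw [Matrix.transpose_mul, Matrix.transpose_mul, mul_assoc, mul_assoc, h2,
        ← mul_assoc (R.γ a).transpose, γ_transpose, neg_mul, mul_neg, mul_assoc, ← mul_assoc, h2]
      simp [mul_assoc]
  obtain ⟨v, hv⟩ := R.exists_eq_sum_γ_P hM
  rw [mul_assoc, hsP] at hv
  have t1 : ∀ b, (R.γ b * (s * R.γ a * s)).trace = 16 * ηt b * v b := by
    intro b
    rw [hv, Finset.mul_sum, Matrix.trace_sum]
    simp only [mul_smul_comm, Matrix.trace_smul, trace_γ_γ_P, smul_eq_mul, mul_ite, mul_zero,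
      Finset.sum_ite_eq, Finset.mem_univ, if_true]
    ring
  -- As `s * s = 0`, only two terms of the product of anticommutators have a trace, and by cyclicity
  -- they are equal. The anticommutators are quadratic in the generators by `γ_slash`, so the
  -- four-generator trace applies.
  have t2 : ∀ b, ((R.γ b * s + s * R.γ b) * (R.γ a * s + s * R.γ a)).trace =
      2 * (R.γ b * (s * R.γ a * s)).trace := by
    intro b
    have e1 : (R.γ b * s + s * R.γ b) * (R.γ a * s + s * R.γ a) =
        R.γ b * (s * R.γ a * s) + R.γ b * (s * s) * R.γ a + s * (R.γ b * R.γ a * s) +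
          s * R.γ b * (s * R.γ a) := by
      simp only [add_mul, mul_add, mul_assoc]; abel
    have e2 : (s * (R.γ b * R.γ a * s)).trace = 0 := by
      rw [Matrix.trace_mul_comm, mul_assoc, hss, mul_zero, Matrix.trace_zero]
    have e3 : (s * R.γ b * (s * R.γ a)).trace = (R.γ b * (s * R.γ a * s)).trace := by
      rw [mul_assoc, Matrix.trace_mul_comm]; simp only [mul_assoc]
    rw [e1, hss, Matrix.trace_add, Matrix.trace_add, Matrix.trace_add, e2, e3, mul_zero, zero_mul,
      Matrix.trace_zero]
    ring
  have t3 : ∀ b, ((R.γ b * s + s * R.γ b) * (R.γ a * s + s * R.γ a)).trace =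
      -64 * (ηt a * sq h b a) := by
    intro b
    rw [hF, hF]
    simp only [Finset.sum_mul, Finset.mul_sum, smul_mul_assoc, mul_smul_comm, Matrix.trace_sum,
      Matrix.trace_smul, trace_γup_four, smul_eq_mul, sq, raise3]
    have : ∀ c d, ∑ e, ∑ f, h b c d * (h a e f *
        (32 * (gUp c d * gUp e f - gUp c e * gUp d f + gUp c f * gUp d e))) =
        -64 * (ηt a * (h b c d * (ηt c * ηt d * ηt a * h c d a))) := by
      intro c d
      have e0 : ∀ e f, h a e f * gUp e f = 0 := by
        intro e f
        unfold gUp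
        split_ifs with hef
        · have := hh.1.2 a e e
          rw [← hef, show h a e e = 0 by linarith, zero_mul]
        · ring
      have e1 : h b c d * gUp c d = 0 := by
        unfold gUp
        split_ifs with hef
        · have := hh.1.2 b c c
          rw [← hef, show h b c c = 0 by linarith, zero_mul]
        · ring
      have e2 : ∀ e f, h b c d * (h a e f *
          (32 * (gUp c d * gUp e f - gUp c e * gUp d f + gUp c f * gUp d e))) =
          32 * h b c d * (gUp c f * gUp d e * h a e f - gUp c e * gUp d f * h a e f) := by
        intro e f
        linear_combination 32 * h a e f * gUp e f * e1
      have e3 : ∀ e f, gUp c e * gUp d f * h a e f =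
          if c = e then (if d = f then ηt c * ηt d * h a e f else 0) else 0 := by
        intro e f; unfold gUp; split_ifs <;> ring
      have e4 : ∀ e f, gUp c f * gUp d e * h a e f =
          if d = e then (if c = f then ηt c * ηt d * h a e f else 0) else 0 := by
        intro e f; unfold gUp; split_ifs <;> ring
      simp only [e2, ← Finset.mul_sum, Finset.sum_sub_distrib, e3, e4]
      simp only [Finset.sum_ite_irrel, Finset.sum_const_zero, Finset.sum_ite_eq, Finset.mem_univ,
        if_true]
      rw [hh.1.2 a d c, show h c d a = h a c d by rw [hh.1.2, hh.1.1, neg_neg]]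
      linear_combination 64 * h b c d * ηt c * ηt d * h a c d * ηt_mul_self a
    have comm : ∀ G : Fin 6 → Fin 6 → Fin 6 → Fin 6 → ℝ,
        ∑ e, ∑ f, ∑ c, ∑ d, G c d e f = ∑ c, ∑ d, ∑ e, ∑ f, G c d e f := by
      intro G
      have := Finset.sum_comm (s := (Finset.univ : Finset (Fin 6 × Fin 6)))
        (t := (Finset.univ : Finset (Fin 6 × Fin 6))) (f := fun p q => G q.1 q.2 p.1 p.2)
      simpa only [Fintype.sum_prod_type] using this
    rw [comm]
    simp only [mul_left_comm (h a _ _) (h b _ _), this]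
  have t4 : ∀ b, v b = -2 * (ηt a * ηt b * sq h b a) := by
    intro b
    have e1 := t3 b
    rw [t2, t1] at e1
    linear_combination (1 / 32) * ηt b * e1 - v b * ηt_mul_self b
  rw [γup_eq, mul_smul_comm, smul_mul_assoc, hv, Finset.smul_sum, Finset.smul_sum]
  refine Finset.sum_congr rfl fun b _ => ?_
  rw [t4, γup_eq, smul_mul_assoc, smul_smul, smul_smul, smul_smul]
  congr 1
  linear_combination -2 * ηt b * sq h b a * ηt_mul_self a

end Majorana

/-! ### From real tensors and matrices to superfields. -/

section Transfer

variable {A : Type*} [Ring A] [Algebra ℝ A]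

/-- An identity that is real-linear in superfields thus follows from its real version, applied to
the images of the entries under each functional. -/
theorem eq_of_forall_dual {x y : A} (h : ∀ ℓ : Module.Dual ℝ A, ℓ x = ℓ y) : x = y := by
  rw [← sub_eq_zero, ← Module.forall_dual_apply_eq_zero_iff ℝ]
  exact fun ℓ => by rw [map_sub, h, sub_self]

theorem toFn_mul_apply (M : Mat) (H : Matrix (Fin 32) (Fin 32) A) (α β : Fin 32) :
    (toFn (A := A) M * H) α β = ∑ κ, M α κ • H κ β := by
  simp [Matrix.mul_apply, toFn, Algebra.smul_def]

theorem mul_toFn_apply (M : Mat) (H : Matrix (Fin 32) (Fin 32) A) (α β : Fin 32) :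
    (H * toFn (A := A) M) α β = ∑ κ, M κ β • H α κ := by
  simp only [Matrix.mul_apply, toFn, Algebra.smul_def, Matrix.map_apply, Algebra.commutes]

theorem toFn_mul_map (ℓ : Module.Dual ℝ A) (M : Mat) (H : Matrix (Fin 32) (Fin 32) A) :
    (toFn M * H).map ℓ = M * H.map ℓ := by
  ext α β
  rw [Matrix.map_apply, toFn_mul_apply, Matrix.mul_apply]
  simp

theorem mul_toFn_map (ℓ : Module.Dual ℝ A) (M : Mat) (H : Matrix (Fin 32) (Fin 32) A) :
    (H * toFn M).map ℓ = H.map ℓ * M := by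
  ext α β
  rw [Matrix.map_apply, mul_toFn_apply, Matrix.mul_apply]
  simp [mul_comm]

theorem toFn_mul (M N : Mat) : toFn (A := A) (M * N) = toFn M * toFn N := by
  simp [toFn, Matrix.map_mul]

theorem matrix_eq_of_forall_dual {H K : Matrix (Fin 32) (Fin 32) A}
    (h : ∀ ℓ : Module.Dual ℝ A, H.map ℓ = K.map ℓ) : H = K := by
  ext α β
  exact eq_of_forall_dual fun ℓ => congrFun (congrFun (h ℓ) α) β

theorem mul_apply_of_eq_sum {ι : Type*} [Fintype ι] {X Y : Matrix (Fin 32) (Fin 32) A} {c : ι → A}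
    {U V : ι → Mat} (hX : ∀ α β, X α β = ∑ I, U I α β • c I)
    (hY : ∀ α β, Y α β = ∑ I, V I α β • c I) (α β : Fin 32) :
    (X * Y) α β = ∑ I, ∑ J, (U I * V J) α β • (c I * c J) := by
  simp only [Matrix.mul_apply, hX, hY, Finset.sum_mul, Finset.mul_sum, Finset.sum_smul,
    smul_mul_smul_comm]
  have comm : ∀ G : Fin 32 → ι → ι → A, ∑ μ, ∑ J, ∑ I, G μ I J = ∑ I, ∑ J, ∑ μ, G μ I J := by
    intro G
    rw [Finset.sum_comm' (t' := Finset.univ) (s' := fun _ => Finset.univ) (by simp)]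
    simp only [Finset.sum_comm (γ := Fin 32)]
    rw [Finset.sum_comm]
  exact comm _

/-- For commuting variables a quadratic form sees only the symmetrised coefficients. -/
theorem sum_smul_mul_eq_zero {ι : Type*} [Fintype ι] {c : ι → A} (hc : ∀ I J, c I * c J = c J * c I)
    {D : ι → ι → ℝ} (hD : ∀ I J, D I J + D J I = 0) : ∑ I, ∑ J, D I J • (c I * c J) = 0 := by
  have h1 : ∑ I, ∑ J, D I J • (c I * c J) = ∑ I, ∑ J, D J I • (c I * c J) := by
    rw [Finset.sum_comm]
    exact Finset.sum_congr rfl fun I _ => Finset.sum_congr rfl fun J _ => by rw [hc]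
  have h2 : (2 : ℝ) • ∑ I, ∑ J, D I J • (c I * c J) = 0 := by
    rw [two_smul]
    nth_rw 2 [h1]
    simp only [← Finset.sum_add_distrib, ← add_smul, hD, zero_smul, Finset.sum_const_zero]
  simpa using h2

variable (R : Majorana)

theorem slash_map (ℓ : Module.Dual ℝ A) (h : Fin 6 → Fin 6 → Fin 6 → A) :
    (slash R h).map ℓ = slash R fun a b c => ℓ (h a b c) := by
  ext α β
  simp [slash]

theorem map_hodge (ℓ : Module.Dual ℝ A) (h : Fin 6 → Fin 6 → Fin 6 → A) (a b c : Fin 6) :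
    ℓ (hodge h a b c) = hodge (fun a b c => ℓ (h a b c)) a b c := by
  simp [hodge, raise3]

variable [SuperCommAlgebra A]

theorem IsThreeForm.isSkew {h : Fin 6 → Fin 6 → Fin 6 → A} (hh : IsThreeForm h)
    (ℓ : Module.Dual ℝ A) : IsSkew fun a b c => ℓ (h a b c) :=
  ⟨fun a b c => (congrArg ℓ (hh.skew₁₂ a b c)).trans (map_neg _ _),
    fun a b c => (congrArg ℓ (hh.skew₂₃ a b c)).trans (map_neg _ _)⟩

theorem IsThreeForm.mem_selfDual {h : Fin 6 → Fin 6 → Fin 6 → A} (hh : IsThreeForm h)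
    (hsd : h = hodge h) (ℓ : Module.Dual ℝ A) : (fun a b c => ℓ (h a b c)) ∈ selfDual := by
  refine ⟨hh.isSkew ℓ, ?_⟩
  ext a b c
  rw [← map_hodge, ← hsd]

theorem HasParity.sum {ι : Type*} {s : Finset ι} {i : Fin 2} {f : ι → A}
    (h : ∀ k ∈ s, HasParity i (f k)) : HasParity i (∑ k ∈ s, f k) := by
  unfold HasParity at h ⊢
  rw [map_sum, Finset.smul_sum]
  exact Finset.sum_congr rfl h

theorem HasParity.real_smul {i : Fin 2} {f : A} (h : HasParity i f) (r : ℝ) :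
    HasParity i (r • f) := by
  unfold HasParity at h ⊢
  rw [map_smul, h, smul_comm]

/-- A real-linear generalized inverse of the Clifford action of self-dual tensors. -/
theorem exists_slash_inverse : ∃ g : Mat →ₗ[ℝ] selfDual, ∀ h ∈ selfDual,
    slash R (g (slash R h * R.P)).1 * R.P = slash R h * R.P := by
  let f : selfDual →ₗ[ℝ] Mat :=
    { toFun h := slash R h.1 * R.P
      map_add' h k := by
        rw [Submodule.coe_add, Majorana.slash_add, add_mul]
      map_smul' r h := by
        rw [Submodule.coe_smul, Majorana.slash_smul, smul_mul_assoc, RingHom.id_apply] }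
  obtain ⟨g, hg⟩ := f.rangeRestrict.exists_rightInverse_of_surjective f.range_rangeRestrict
  obtain ⟨g', hg'⟩ := g.exists_extend
  refine ⟨g', fun h hh => ?_⟩
  have h1 : g' (f ⟨h, hh⟩) = g (f.rangeRestrict ⟨h, hh⟩) := LinearMap.congr_fun hg' (f.rangeRestrict ⟨h, hh⟩)
  have h2 : f.rangeRestrict (g (f.rangeRestrict ⟨h, hh⟩)) = f.rangeRestrict ⟨h, hh⟩ :=
    LinearMap.congr_fun hg _
  rw [← h1] at h2
  exact congrArg Subtype.val h2

/-- Tensors chosen separately for each functional need not assemble into a superfield. A single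
real-linear inverse `g` does: the components of `h` are fixed real combinations of the entries of
`H`, hence even, and every functional sends them to `g` of the real matrix. -/
theorem exists_threeForm {H : Matrix (Fin 32) (Fin 32) A} (heven : ∀ α β, HasParity 0 (H α β))
    (hP : toFn R.Pbar * H * toFn R.P = H)
    (hc : ∀ i j, i ≠ j → H * toFn (R.Γ (Sum.inr i) * R.Γ (Sum.inr j)) =
      toFn (R.Γ (Sum.inr i) * R.Γ (Sum.inr j)) * H) (i : Fin 5)
    (hs : ∀ α β, (toFn (A := A) (R.C * R.Γ (Sum.inr i)) * H) α β =
      -(toFn (A := A) (R.C * R.Γ (Sum.inr i)) * H) β α) :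
    ∃ h : Fin 6 → Fin 6 → Fin 6 → A, IsThreeForm h ∧ h = hodge h ∧ H = slash R h * toFn R.P := by
  obtain ⟨g, hg⟩ := exists_slash_inverse R
  let h : Fin 6 → Fin 6 → Fin 6 → A := fun a b c =>
    ∑ α, ∑ β, (g (Matrix.single α β 1)).1 a b c • H α β
  have hℓ : ∀ ℓ : Module.Dual ℝ A, (fun a b c => ℓ (h a b c)) = (g (H.map ℓ)).1 := by
    intro ℓ
    conv_rhs => rw [Matrix.matrix_eq_sum_single (H.map ℓ)]
    ext a b c
    have e : ∀ α β, Matrix.single α β ((H.map ℓ) α β) =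
        ℓ (H α β) • Matrix.single α β (1 : ℝ) := by
      intro α β; rw [Matrix.smul_single, smul_eq_mul, mul_one, Matrix.map_apply]
    simp only [h, map_sum, map_smul, e, Submodule.coe_sum, Submodule.coe_smul, Finset.sum_apply,
      Pi.smul_apply, smul_eq_mul, mul_comm]
  have hmem : ∀ ℓ : Module.Dual ℝ A, (fun a b c => ℓ (h a b c)) ∈ selfDual := fun ℓ => by
    rw [hℓ]; exact (g _).2
  refine ⟨h, ⟨fun a b c => ?_, fun a b c => ?_, fun a b c => ?_⟩, ?_, ?_⟩
  · exact HasParity.sum fun α _ => HasParity.sum fun β _ => (heven α β).real_smul _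
  · exact eq_of_forall_dual fun ℓ => by rw [map_neg]; exact (hmem ℓ).1.1 a b c
  · exact eq_of_forall_dual fun ℓ => by rw [map_neg]; exact (hmem ℓ).1.2 a b c
  · ext a b c
    exact eq_of_forall_dual fun ℓ => by
      rw [map_hodge]; exact congrFun (congrFun (congrFun (hmem ℓ).2 a) b) c
  · refine matrix_eq_of_forall_dual fun ℓ => ?_
    rw [mul_toFn_map, slash_map, hℓ]
    have hP' : R.Pbar * H.map ℓ * R.P = H.map ℓ := by
      rw [← toFn_mul_map, ← mul_toFn_map, hP]
    have hc' : ∀ i j, i ≠ j → H.map ℓ * (R.Γ (Sum.inr i) * R.Γ (Sum.inr j)) =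
        R.Γ (Sum.inr i) * R.Γ (Sum.inr j) * H.map ℓ := fun i j hij => by
      rw [← mul_toFn_map, hc i j hij, toFn_mul_map]
    have hs' : (R.C * R.Γ (Sum.inr i) * H.map ℓ).transpose = -(R.C * R.Γ (Sum.inr i) * H.map ℓ) := by
      rw [← toFn_mul_map]
      ext α β
      simp only [Matrix.transpose_apply, Matrix.map_apply, Matrix.neg_apply]
      rw [hs, map_neg]
    obtain ⟨k, hk, hkM⟩ := R.exists_selfDual hP' hc' hs'
    rw [hkM, hg k hk]

theorem slash_P_skew {h : Fin 6 → Fin 6 → Fin 6 → A} (hh : IsThreeForm h) (i : Fin 5)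
    (α β : Fin 32) : (toFn (A := A) (R.C * R.Γ (Sum.inr i)) * (slash R h * toFn (A := A) R.P)) α β =
      -(toFn (A := A) (R.C * R.Γ (Sum.inr i)) * (slash R h * toFn (A := A) R.P)) β α := by
  refine eq_of_forall_dual fun ℓ => ?_
  have := R.slash_P_skew (hh.isSkew ℓ) i
  rw [← slash_map, ← mul_toFn_map, ← toFn_mul_map] at this
  rw [map_neg]
  exact congrFun (congrFun this β) α

theorem slash_transpose {h : Fin 6 → Fin 6 → Fin 6 → A} (hh : IsThreeForm h) (κ β : Fin 32) :
    ∑ α, R.C α β • slash R h α κ = (toFn (A := A) R.C * slash R h) κ β := by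
  refine eq_of_forall_dual fun ℓ => ?_
  have := (R.slash_mem_oddSpace (hh.isSkew ℓ)).2
  rw [one_smul, ← slash_map, ← toFn_mul_map] at this
  have := congrFun (congrFun this κ) β
  simpa [Matrix.mul_apply, mul_comm] using this

/-- The tensors `T I` are the images of the coordinate tensors under a real-linear projection onto
`selfDual`, which fixes `h` functional by functional. Linear functionals do not respect products, so
quadratic identities need such an expansion. -/
theorem exists_selfDual_expansion {h : Fin 6 → Fin 6 → Fin 6 → A} (hh : IsThreeForm h)
    (hsd : h = hodge h) : ∃ T : Fin 6 × Fin 6 × Fin 6 → Fin 6 → Fin 6 → Fin 6 → ℝ,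
      (∀ I, T I ∈ selfDual) ∧
      ∀ a b c, h a b c = ∑ I : Fin 6 × Fin 6 × Fin 6, T I a b c • h I.1 I.2.1 I.2.2 := by
  obtain ⟨p, hp⟩ := (selfDual.subtype).exists_leftInverse_of_injective selfDual.ker_subtype
  let E : Fin 6 × Fin 6 × Fin 6 → Fin 6 → Fin 6 → Fin 6 → ℝ :=
    fun I a b c => if I = (a, b, c) then 1 else 0
  refine ⟨fun I => (p (E I)).1, fun I => (p (E I)).2, fun a b c => eq_of_forall_dual fun ℓ => ?_⟩
  have h1 := hh.mem_selfDual hsd ℓ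
  have h2 : p (fun a b c => ℓ (h a b c)) = ⟨_, h1⟩ := LinearMap.congr_fun hp ⟨_, h1⟩
  have h3 : (fun a b c => ℓ (h a b c)) =
      ∑ I : Fin 6 × Fin 6 × Fin 6, ℓ (h I.1 I.2.1 I.2.2) • E I := by
    ext a b c
    simp [E, Finset.sum_apply]
  have h4 : (p (∑ I : Fin 6 × Fin 6 × Fin 6, ℓ (h I.1 I.2.1 I.2.2) • E I)).1 =
      fun a b c => ℓ (h a b c) := by
    rw [← h3, h2]
  rw [map_sum] at h4
  have h5 := congrFun (congrFun (congrFun h4 a) b) c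
  simp only [map_smul, Submodule.coe_sum, Submodule.coe_smul, Finset.sum_apply, Pi.smul_apply,
    smul_eq_mul] at h5
  rw [← h5]
  simp [mul_comm]

theorem slash_γup_slash {h : Fin 6 → Fin 6 → Fin 6 → A} (hh : IsThreeForm h) (hsd : h = hodge h)
    (a : Fin 6) (α β : Fin 32) : (slash R h * toFn (A := A) (R.γup a) * slash R h) α β =
      ∑ b, (R.γup b * R.P) α β • (-2 : ℝ) • sq h b a := by
  obtain ⟨T, hT, hTh⟩ := exists_selfDual_expansion hh hsd
  set c : Fin 6 × Fin 6 × Fin 6 → A := fun I => h I.1 I.2.1 I.2.2 with hc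
  have hcomm : ∀ I J, c I * c J = c J * c I := fun I J =>
    SuperCommAlgebra.even_comm _ _ (by simpa [HasParity, sn] using hh.even I.1 I.2.1 I.2.2)
  have hslash : ∀ α β, slash R h α β = ∑ I, slash R (T I) α β • c I := by
    intro α β
    simp only [slash, Matrix.of_apply, smul_eq_mul, Finset.mul_sum, Finset.sum_smul]
    rw [Finset.smul_sum, Finset.sum_comm]
    refine Finset.sum_congr rfl fun x _ => ?_
    rw [Finset.smul_sum, Finset.sum_comm]
    refine Finset.sum_congr rfl fun y _ => ?_
    rw [Finset.smul_sum, Finset.sum_comm]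
    refine Finset.sum_congr rfl fun z _ => ?_
    rw [hTh, Finset.smul_sum, Finset.smul_sum]
    refine Finset.sum_congr rfl fun I _ => ?_
    rw [smul_smul, smul_smul, mul_assoc]
  have hslash' : ∀ α β, (slash R h * toFn (A := A) (R.γup a)) α β =
      ∑ I, (slash R (T I) * R.γup a) α β • c I := by
    intro α β
    rw [mul_toFn_apply]
    simp only [hslash, Finset.smul_sum]
    rw [Finset.sum_comm]
    refine Finset.sum_congr rfl fun I _ => ?_
    rw [Matrix.mul_apply, Finset.sum_smul]
    exact Finset.sum_congr rfl fun κ _ => by rw [smul_smul, mul_comm]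
  let B : (Fin 6 → Fin 6 → Fin 6 → ℝ) → (Fin 6 → Fin 6 → Fin 6 → ℝ) → Fin 6 → ℝ :=
    fun t u b => ∑ c₁, ∑ c₂, t b c₁ c₂ * raise3 u c₁ c₂ a
  have hsq : ∀ b, sq h b a = ∑ I, ∑ J, B (T I) (T J) b • (c I * c J) := by
    intro b
    simp only [sq, B, raise3, Finset.sum_smul]
    have e : ∀ x y, h b x y * ((ηt x * ηt y * ηt a) • h x y a) =
        ∑ I, ∑ J, (T I b x y * (ηt x * ηt y * ηt a) • T J x y a) • (c I * c J) := by
      intro x y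
      rw [hTh b x y, hTh x y a, Finset.smul_sum, Finset.sum_mul]
      refine Finset.sum_congr rfl fun I _ => ?_
      rw [Finset.mul_sum]
      refine Finset.sum_congr rfl fun J _ => ?_
      rw [smul_smul, smul_mul_smul_comm, smul_eq_mul]
    simp only [e]
    have comm : ∀ G : Fin 6 → Fin 6 → Fin 6 × Fin 6 × Fin 6 → Fin 6 × Fin 6 × Fin 6 → A,
        ∑ x, ∑ y, ∑ I, ∑ J, G x y I J = ∑ I, ∑ J, ∑ x, ∑ y, G x y I J := by
      intro G
      have := Finset.sum_comm (s := (Finset.univ : Finset (Fin 6 × Fin 6)))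
        (t := (Finset.univ : Finset ((Fin 6 × Fin 6 × Fin 6) × (Fin 6 × Fin 6 × Fin 6))))
        (f := fun p q => G p.1 p.2 q.1 q.2)
      rw [Fintype.sum_prod_type, Fintype.sum_prod_type] at this
      simpa only [Fintype.sum_prod_type (f := fun q : (Fin 6 × Fin 6 × Fin 6) ×
        (Fin 6 × Fin 6 × Fin 6) => _), Fintype.sum_prod_type (f := fun q : Fin 6 × Fin 6 => _)]
        using this
    exact comm _
  have hBadd : ∀ t u b, B (t + u) (t + u) b = B t t b + B t u b + B u t b + B u u b := by
    intro t u b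
    simp only [B, ← Finset.sum_add_distrib]
    refine Finset.sum_congr rfl fun x _ => Finset.sum_congr rfl fun y _ => ?_
    simp only [raise3, Pi.add_apply, smul_eq_mul]
    ring
  -- Polarisation: the real sandwich identity at `T I`, `T J` and `T I + T J`.
  have key : ∀ I J,
      ((slash R (T I) * R.γup a * slash R (T J)) α β
        - ∑ b, (R.γup b * R.P) α β * (-2 * B (T I) (T J) b)) +
      ((slash R (T J) * R.γup a * slash R (T I)) α β
        - ∑ b, (R.γup b * R.P) α β * (-2 * B (T J) (T I) b)) = 0 := by
    intro I J
    have q : ∀ t ∈ selfDual, (slash R t * R.γup a * slash R t) α β =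
        ∑ b, (R.γup b * R.P) α β * (-2 * B t t b) := by
      intro t ht
      rw [R.slash_γup_slash ht a]
      simp only [Matrix.smul_apply, Matrix.sum_apply, smul_eq_mul, Finset.mul_sum]
      refine Finset.sum_congr rfl fun b _ => ?_
      simp only [sq, B]
      ring
    have q1 := q _ (hT I)
    have q2 := q _ (hT J)
    have q3 := q _ (selfDual.add_mem (hT I) (hT J))
    simp only [Majorana.slash_add, add_mul, mul_add, Matrix.add_apply, hBadd,
      Finset.sum_add_distrib] at q3
    linarith
  rw [mul_apply_of_eq_sum hslash' hslash, ← sub_eq_zero]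
  have hz := sum_smul_mul_eq_zero hcomm key
  rw [← hz]
  simp only [hsq, sub_smul, Finset.sum_sub_distrib]
  congr 1
  simp only [Finset.smul_sum, Finset.sum_smul, smul_smul]
  rw [Finset.sum_comm]
  refine Finset.sum_congr rfl fun I _ => ?_
  rw [Finset.sum_comm]

end Transfer

/-! ### Parities, signs and co-frame components of differential forms. -/

section Forms

variable {A : Type*} [Ring A] [Algebra ℝ A] [SuperCommAlgebra A]

theorem sg_algebraMap (i : Fin 2) (r : ℝ) : sg i (algebraMap ℝ A r) = algebraMap ℝ A r :=
  AlgHom.commutes _ _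

theorem sg_sg (i j : Fin 2) (f : A) : sg i (sg j f) = sg (i + j) f := by
  fin_cases i <;> fin_cases j <;> simp [sg, SuperCommAlgebra.σ_σ]

theorem HasParity.sg_eq {i : Fin 2} {f : A} (h : HasParity i f) (j : Fin 2) :
    sg j f = sn (i * j) • f := by
  unfold HasParity at h
  fin_cases i <;> fin_cases j <;> simp [sg, sn] at h ⊢ <;> exact h

theorem HasParity.mul_comm {i : Fin 2} {f : A} (h : HasParity i f) (g : A) :
    f * g = sg i g * f := by
  unfold HasParity at h
  fin_cases i
  · simpa [sg] using SuperCommAlgebra.even_comm f g (by simpa [sn] using h)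
  · simpa [sg] using SuperCommAlgebra.odd_comm f g (by simpa [sn] using h)

theorem HasParity.mul {i j : Fin 2} {f g : A} (hf : HasParity i f) (hg : HasParity j g) :
    HasParity (i + j) (f * g) := by
  unfold HasParity at *
  rw [map_mul, hf, hg, smul_mul_smul_comm]
  congr 1
  fin_cases i <;> fin_cases j <;> simp [sn]

theorem HasParity.add {i : Fin 2} {f g : A} (hf : HasParity i f) (hg : HasParity i g) :
    HasParity i (f + g) := by
  unfold HasParity at *
  rw [map_add, hf, hg, smul_add]

theorem HasParity.sub {i : Fin 2} {f g : A} (hf : HasParity i f) (hg : HasParity i g) :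
    HasParity i (f - g) := by
  unfold HasParity at *
  rw [map_sub, hf, hg, smul_sub]

theorem HasParity.zero (i : Fin 2) : HasParity i (0 : A) := by
  simp [HasParity]

theorem hasParity_algebraMap (r : ℝ) : HasParity 0 (algebraMap ℝ A r) := by
  simp [HasParity, sn, AlgHom.commutes]

theorem HasParity.eq_zero {i j : Fin 2} (hij : i ≠ j) {f : A} (hi : HasParity i f)
    (hj : HasParity j f) : f = 0 := by
  unfold HasParity at hi hj
  have h : sn i • f = sn j • f := hi.symm.trans hj
  have h2 : (sn i - sn j) • f = 0 := by rw [sub_smul, h, sub_self]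
  refine (smul_eq_zero.1 h2).resolve_left ?_
  fin_cases i <;> fin_cases j <;> simp [sn] at hij ⊢; norm_num

/-- The components of a homogeneous sum of homogeneous elements of different parity. -/
theorem HasParity.eq_zero_of_add {i j : Fin 2} (hij : i ≠ j) {f g : A} (hf : HasParity i f)
    (hg : HasParity j g) (h : HasParity i (f + g)) : g = 0 := by
  refine HasParity.eq_zero hij ?_ hg
  have := h.sub hf
  rwa [add_sub_cancel_left] at this

theorem OneForm.HasParity.sum {ι : Type*} {s : Finset ι} {i : Fin 2} {α : ι → OneForm A}
    (h : ∀ k ∈ s, (α k).HasParity i) : (∑ k ∈ s, α k).HasParity i := by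
  intro j D
  rw [LinearMap.sum_apply]
  exact M5.HasParity.sum fun k hk => h k hk j D

theorem OneForm.HasParity.add {i : Fin 2} {α β : OneForm A} (hα : α.HasParity i)
    (hβ : β.HasParity i) : (α + β).HasParity i :=
  fun j D => (hα j D).add (hβ j D)

theorem OneForm.HasParity.rmul {i k : Fin 2} {α : OneForm A} (hα : α.HasParity i) {f : A}
    (hf : M5.HasParity k f) : (α.rmul f).HasParity (i + k) := by
  intro j D
  have := (hα j D).mul hf
  rwa [add_right_comm] at this

theorem OneForm.rmul_apply (α : OneForm A) (f : A) (D : Der A) : α.rmul f D = α D * f := rfl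

theorem OneForm.sum_rmul {ι : Type*} (s : Finset ι) (α : ι → OneForm A) (f : A) :
    (∑ k ∈ s, α k).rmul f = ∑ k ∈ s, (α k).rmul f := by
  ext D
  simp only [OneForm.rmul_apply, LinearMap.sum_apply, Finset.sum_mul]

theorem OneForm.smul_rmul (r : ℝ) (α : OneForm A) (f : A) :
    (r • α).rmul f = r • α.rmul f := by
  ext D
  simp only [OneForm.rmul_apply, LinearMap.smul_apply, smul_mul_assoc]

theorem OneForm.rmul_smul (r : ℝ) (α : OneForm A) (f : A) :
    α.rmul (r • f) = r • α.rmul f := by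
  ext D
  simp only [OneForm.rmul_apply, LinearMap.smul_apply, mul_smul_comm]

theorem OneForm.rmul_sum {ι : Type*} (s : Finset ι) (α : OneForm A) (f : ι → A) :
    α.rmul (∑ k ∈ s, f k) = ∑ k ∈ s, α.rmul (f k) := by
  ext D
  simp only [OneForm.rmul_apply, LinearMap.sum_apply, Finset.mul_sum]

/-! ### The wedge product -/

theorem wedge_add_left (α α' β : OneForm A) : wedge (α + α') β = wedge α β + wedge α' β := by
  funext i j D D'
  simp only [wedge, LinearMap.add_apply, map_add, add_mul, smul_add, Pi.add_apply]
  abel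

theorem wedge_add_right (α β β' : OneForm A) : wedge α (β + β') = wedge α β + wedge α β' := by
  funext i j D D'
  simp only [wedge, LinearMap.add_apply, mul_add, smul_add, Pi.add_apply]
  abel

theorem wedge_smul_left (r : ℝ) (α β : OneForm A) : wedge (r • α) β = r • wedge α β := by
  funext i j D D'
  simp only [wedge, LinearMap.smul_apply, map_smul, smul_mul_assoc, Pi.smul_apply, smul_sub,
    smul_comm r]

theorem wedge_smul_right (r : ℝ) (α β : OneForm A) : wedge α (r • β) = r • wedge α β := by
  funext i j D D'
  simp only [wedge, LinearMap.smul_apply, mul_smul_comm, Pi.smul_apply, smul_sub, smul_comm r]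

theorem wedge_zero_right (α : OneForm A) : wedge α 0 = 0 := by
  simpa using wedge_smul_right 0 α 0

theorem wedge_zero_left (α : OneForm A) : wedge 0 α = 0 := by
  simpa using wedge_smul_left 0 0 α

theorem wedge_sum_left {ι : Type*} (s : Finset ι) (α : ι → OneForm A) (β : OneForm A) :
    wedge (∑ k ∈ s, α k) β = ∑ k ∈ s, wedge (α k) β := by
  classical
  induction s using Finset.induction_on with
  | empty => simp [wedge_zero_left]
  | insert a s ha ih => rw [Finset.sum_insert ha, Finset.sum_insert ha, wedge_add_left, ih]

theorem wedge_sum_right {ι : Type*} (s : Finset ι) (α : OneForm A) (β : ι → OneForm A) :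
    wedge α (∑ k ∈ s, β k) = ∑ k ∈ s, wedge α (β k) := by
  classical
  induction s using Finset.induction_on with
  | empty => simp [wedge_zero_right]
  | insert a s ha ih => rw [Finset.sum_insert ha, Finset.sum_insert ha, wedge_add_right, ih]

theorem wedge_rmul_right (α β : OneForm A) (f : A) :
    wedge α (β.rmul f) = (wedge α β).rmul f := by
  funext i j D D'
  simp only [wedge, TwoForm.rmul, OneForm.rmul_apply, sub_mul, smul_mul_assoc, mul_assoc]

/-- Moving `f` past a contraction of `β` costs its parity against both `β` and the contracting
field; the latter is already supplied by the sign in `wedge`. -/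
theorem wedge_rmul_left (α : OneForm A) {β : OneForm A} {s : Fin 2} (hβ : β.HasParity s) (f : A) :
    wedge (α.rmul f) β = (wedge α β).rmul (sg s f) := by
  funext i j D D'
  have h1 : sg j f * β D'.toDer = β D'.toDer * sg s f := by
    rw [(hβ j D').mul_comm, sg_sg]
    congr 2
    fin_cases s <;> fin_cases j <;> rfl
  have h2 : sg i f * β D.toDer = β D.toDer * sg s f := by
    rw [(hβ i D).mul_comm, sg_sg]
    congr 2
    fin_cases s <;> fin_cases i <;> rfl
  simp only [wedge, TwoForm.rmul, OneForm.rmul_apply, sub_mul, smul_mul_assoc, mul_assoc, map_mul,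
    h1, h2]

theorem wedge_comm {α β : OneForm A} {s t : Fin 2} (hα : α.HasParity s) (hβ : β.HasParity t) :
    wedge β α = -(sn (s * t)) • wedge α β := by
  funext i j D D'
  simp only [wedge, Pi.smul_apply]
  rw [(hα i D).sg_eq, (hα j D').sg_eq, (hβ i D).sg_eq, (hβ j D').sg_eq]
  simp only [smul_mul_assoc]
  rw [(hα i D).mul_comm, (hα j D').mul_comm, (hβ i D).sg_eq, (hβ j D').sg_eq]
  simp only [smul_mul_assoc, smul_sub, smul_smul]
  fin_cases s <;> fin_cases t <;> fin_cases i <;> fin_cases j <;> simp [sn] <;> abel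

theorem hasParity_wedge {α β : OneForm A} {s t : Fin 2} (hα : α.HasParity s) (hβ : β.HasParity t)
    {i j : Fin 2} (D : HDer A i) (D' : HDer A j) :
    HasParity (s + t + (i + j)) (wedge α β i j D D') := by
  simp only [wedge]
  rw [(hα i D).sg_eq, (hα j D').sg_eq, smul_mul_assoc, smul_mul_assoc]
  have h1 := (hα i D).mul (hβ j D')
  have h2 := (hα j D').mul (hβ i D)
  rw [add_add_add_comm] at h1
  rw [add_add_add_comm, add_comm j i] at h2
  exact (h1.real_smul _).sub ((h2.real_smul _).real_smul _)

theorem lmul_wedge {α β : OneForm A} {s t : Fin 2} (hα : α.HasParity s) (hβ : β.HasParity t)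
    (f : A) : TwoForm.lmul f (wedge α β) = (wedge α β).rmul (sg (s + t) f) := by
  funext i j D D'
  simp only [TwoForm.lmul, TwoForm.rmul]
  rw [(hasParity_wedge hα hβ D D').mul_comm, sg_sg]
  congr 2
  fin_cases s <;> fin_cases t <;> fin_cases i <;> fin_cases j <;> rfl

/-! ### Linearity of multiplication with functions -/

namespace TwoForm

theorem rmul_sub (w : TwoForm A) (f g : A) : w.rmul (f - g) = w.rmul f - w.rmul g := by
  funext i j D D'; simp only [rmul, mul_sub, Pi.sub_apply]

theorem rmul_smul (w : TwoForm A) (r : ℝ) (f : A) : w.rmul (r • f) = r • w.rmul f := by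
  funext i j D D'; simp only [rmul, mul_smul_comm, Pi.smul_apply]

theorem smul_rmul (r : ℝ) (w : TwoForm A) (f : A) : (r • w).rmul f = r • w.rmul f := by
  funext i j D D'; simp only [rmul, smul_mul_assoc, Pi.smul_apply]

theorem rmul_neg (w : TwoForm A) (f : A) : w.rmul (-f) = -w.rmul f := by
  funext i j D D'; simp only [rmul, mul_neg, Pi.neg_apply]

theorem rmul_zero (w : TwoForm A) : w.rmul 0 = 0 := by
  funext i j D D'; simp only [rmul, mul_zero, Pi.zero_apply]

theorem rmul_sum {ι : Type*} (s : Finset ι) (w : TwoForm A) (f : ι → A) :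
    w.rmul (∑ k ∈ s, f k) = ∑ k ∈ s, w.rmul (f k) := by
  funext i j D D'; simp only [rmul, Finset.mul_sum, Finset.sum_apply]

theorem rmul_rmul (w : TwoForm A) (f g : A) : (w.rmul f).rmul g = w.rmul (f * g) := by
  funext i j D D'; simp only [rmul, mul_assoc]

theorem lmul_sum {ι : Type*} (s : Finset ι) (f : A) (w : ι → TwoForm A) :
    lmul f (∑ k ∈ s, w k) = ∑ k ∈ s, lmul f (w k) := by
  funext i j D D'; simp only [lmul, Finset.mul_sum, Finset.sum_apply]

theorem lmul_smul (r : ℝ) (f : A) (w : TwoForm A) : lmul f (r • w) = r • lmul f w := by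
  funext i j D D'; simp only [lmul, mul_smul_comm, Pi.smul_apply]

end TwoForm

theorem d_zero : d (0 : OneForm A) = 0 := by
  funext i j D D'
  simp [d]

/-! ### Contractions of spinor-valued forms -/

/-- The 2-form `Ψ^α K_{αβ} Ψ'^β`. -/
def contract (K : Mat) (Ψ Ψ' : Fin 32 → OneForm A) : TwoForm A :=
  ∑ α, ∑ β, K α β • wedge (Ψ α) (Ψ' β)

theorem pairForm_eq (R : Majorana) (M : Mat) (Ψ Ψ' : Fin 32 → OneForm A) :
    pairForm R M Ψ Ψ' = contract (R.C * M) Ψ Ψ' := rfl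

theorem contract_add_left (K : Mat) (Ψ Φ Ψ' : Fin 32 → OneForm A) :
    contract K (Ψ + Φ) Ψ' = contract K Ψ Ψ' + contract K Φ Ψ' := by
  simp only [contract, Pi.add_apply, wedge_add_left, smul_add, Finset.sum_add_distrib]

theorem contract_add_right (K : Mat) (Ψ Ψ' Φ' : Fin 32 → OneForm A) :
    contract K Ψ (Ψ' + Φ') = contract K Ψ Ψ' + contract K Ψ Φ' := by
  simp only [contract, Pi.add_apply, wedge_add_right, smul_add, Finset.sum_add_distrib]

theorem contract_act_left (K M : Mat) (Ψ Ψ' : Fin 32 → OneForm A) :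
    contract K (act M Ψ) Ψ' = contract (M.transpose * K) Ψ Ψ' := by
  simp only [contract, act, wedge_sum_left, wedge_smul_left, Finset.smul_sum, smul_smul,
    Matrix.mul_apply, Matrix.transpose_apply, Finset.sum_smul]
  have comm : ∀ G : Fin 32 → Fin 32 → Fin 32 → TwoForm A,
      ∑ α, ∑ β, ∑ κ, G α β κ = ∑ κ, ∑ β, ∑ α, G α β κ := by
    intro G
    rw [Finset.sum_comm]
    simp only [Finset.sum_comm (f := fun α κ => G α _ κ)]
    rw [Finset.sum_comm]
  rw [comm]
  refine Finset.sum_congr rfl fun κ _ => Finset.sum_congr rfl fun β _ =>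
    Finset.sum_congr rfl fun α _ => ?_
  rw [mul_comm]

theorem contract_act_right (K M : Mat) (Ψ Ψ' : Fin 32 → OneForm A) :
    contract K Ψ (act M Ψ') = contract (K * M) Ψ Ψ' := by
  simp only [contract, act, wedge_sum_right, wedge_smul_right, Finset.smul_sum, smul_smul,
    Matrix.mul_apply, Finset.sum_smul]
  exact Finset.sum_congr rfl fun α _ => Finset.sum_comm

theorem contract_zero (Ψ Ψ' : Fin 32 → OneForm A) : contract 0 Ψ Ψ' = 0 := by
  simp [contract]

theorem contract_symm {K : Mat} (hK : K.transpose = K) {Ψ Ψ' : Fin 32 → OneForm A}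
    (h : ∀ α, (Ψ α).HasParity 1) (h' : ∀ α, (Ψ' α).HasParity 1) :
    contract K Ψ' Ψ = contract K Ψ Ψ' := by
  rw [contract, Finset.sum_comm, contract]
  refine Finset.sum_congr rfl fun α _ => Finset.sum_congr rfl fun β _ => ?_
  rw [wedge_comm (h α) (h' β), ← Matrix.transpose_apply K, hK]
  simp [sn]

theorem act_mul (M N : Mat) (Ψ : Fin 32 → OneForm A) : act (M * N) Ψ = act M (act N Ψ) := by
  funext α
  simp only [act, Matrix.mul_apply, Finset.sum_smul, Finset.smul_sum, smul_smul]
  exact Finset.sum_comm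

theorem act_one (Ψ : Fin 32 → OneForm A) : act 1 Ψ = Ψ := by
  funext α
  simp [act, Matrix.one_apply]

theorem act_neg (M : Mat) (Ψ : Fin 32 → OneForm A) : act (-M) Ψ = -act M Ψ := by
  funext α
  ext D
  simp only [act, Matrix.neg_apply, Pi.neg_apply, LinearMap.neg_apply, LinearMap.sum_apply,
    LinearMap.smul_apply, neg_smul, Finset.sum_neg_distrib]

theorem act_add (M N : Mat) (Ψ : Fin 32 → OneForm A) : act (M + N) Ψ = act M Ψ + act N Ψ := by
  funext α
  simp [act, add_smul, Finset.sum_add_distrib]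

/-! ### Normal forms of 2-forms in a co-frame -/

/-- The co-frame provides a dual field of mixed parity. Its odd part contracts to zero, because the
prescribed values have the parity that the even part produces. -/
theorem exists_even_dual {ι : Type*} [DecidableEq ι] {Q : Mat} {e : ι → OneForm A}
    {ψ : Fin 32 → OneForm A} (h : IsCoframe Q e ψ) (b : ι) :
    ∃ D : HDer A 0, (∀ a, e a D.toDer = if a = b then 1 else 0) ∧ ∀ α, ψ α D.toDer = 0 := by
  obtain ⟨⟨D, D₀, D₁, h0, h1, hD⟩, ⟨he, hψ⟩, -⟩ :=
    h.bijective (fun a => if a = b then 1 else 0) 0 (by simp)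
  have hsum : (⟨D, D₀, D₁, h0, h1, hD⟩ : Der A) =
      HDer.toDer (⟨D₀, h0⟩ : HDer A 0) + HDer.toDer (⟨D₁, h1⟩ : HDer A 1) := Subtype.ext hD
  simp only [hsum, map_add] at he hψ
  refine ⟨⟨D₀, h0⟩, fun a => ?_, fun α => ?_⟩
  · have h2 := HasParity.eq_zero_of_add (i := 0) (j := 1) (by decide)
      (h.even a 0 ⟨D₀, h0⟩) (h.even a 1 ⟨D₁, h1⟩) (by
        rw [he]
        split_ifs
        · simpa using hasParity_algebraMap (A := A) 1
        · exact HasParity.zero _)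
    rw [← he a, h2, add_zero]
  · have h2 := HasParity.eq_zero_of_add (i := 1) (j := 0) (by decide)
      (h.odd α 0 ⟨D₀, h0⟩) (h.odd α 1 ⟨D₁, h1⟩) (by rw [hψ]; exact HasParity.zero _)
    have h3 := hψ α
    rwa [h2, add_zero] at h3

/-- The values form a column of the projector, since a basis spinor need not lie in the image of
`Q`. -/
theorem exists_odd_dual {ι : Type*} {Q : Mat} (hQ : Q * Q = Q) {e : ι → OneForm A}
    {ψ : Fin 32 → OneForm A} (h : IsCoframe Q e ψ) (β : Fin 32) :
    ∃ D : HDer A 1, (∀ a, e a D.toDer = 0) ∧ ∀ α, ψ α D.toDer = algebraMap ℝ A (Q α β) := by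
  obtain ⟨⟨D, D₀, D₁, h0, h1, hD⟩, ⟨he, hψ⟩, -⟩ :=
    h.bijective 0 (fun α => algebraMap ℝ A (Q α β)) (by
      intro α
      simp only [Algebra.smul_def, ← map_mul, ← map_sum]
      rw [← Matrix.mul_apply, hQ])
  have hsum : (⟨D, D₀, D₁, h0, h1, hD⟩ : Der A) =
      HDer.toDer (⟨D₁, h1⟩ : HDer A 1) + HDer.toDer (⟨D₀, h0⟩ : HDer A 0) :=
    Subtype.ext (hD.trans (add_comm _ _))
  simp only [hsum, map_add] at he hψ
  refine ⟨⟨D₁, h1⟩, fun a => ?_, fun α => ?_⟩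
  · have h2 := HasParity.eq_zero_of_add (i := 1) (j := 0) (by decide)
      (h.even a 1 ⟨D₁, h1⟩) (h.even a 0 ⟨D₀, h0⟩) (by rw [he]; exact HasParity.zero _)
    have h3 := he a
    rwa [h2, add_zero] at h3
  · have h2 := HasParity.eq_zero_of_add (i := 0) (j := 1) (by decide)
      (h.odd α 1 ⟨D₁, h1⟩) (h.odd α 0 ⟨D₀, h0⟩) (by
        rw [hψ]; exact hasParity_algebraMap _)
    rw [← hψ α, h2, add_zero]

/-- The 2-form with components `X`, `Y`, `Z` in a co-frame `(e, ψ)`. -/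
def ofComponents (e : Fin 6 → OneForm A) (ψ : Fin 32 → OneForm A) (X : Fin 32 → Fin 32 → A)
    (Y : Fin 32 → Fin 6 → A) (Z : Fin 6 → Fin 6 → A) : TwoForm A :=
  ∑ α, ∑ β, (wedge (ψ α) (ψ β)).rmul (X α β) + ∑ α, ∑ b, (wedge (ψ α) (e b)).rmul (Y α b) +
    ∑ a, ∑ b, (wedge (e a) (e b)).rmul (Z a b)

theorem ofComponents_sub (e : Fin 6 → OneForm A) (ψ : Fin 32 → OneForm A) (X X' Y Y' Z Z') :
    ofComponents e ψ X Y Z - ofComponents e ψ X' Y' Z' =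
      ofComponents e ψ (X - X') (Y - Y') (Z - Z') := by
  simp only [ofComponents, Pi.sub_apply, TwoForm.rmul_sub, Finset.sum_sub_distrib]
  abel

/-- The forms `ψ` satisfy the linear relations of the image of `Q`, so spinor components are
determined only after projection by `Q`; `hX`, `hX'` and `hY` fix this ambiguity. Contraction with
dual fields extracts the components, and conversely each remaining sum equals its own negative. -/
theorem ofComponents_eq_zero_iff {Q : Mat} (hQ : Q * Q = Q) {e : Fin 6 → OneForm A}
    {ψ : Fin 32 → OneForm A} (h : IsCoframe Q e ψ) {X : Fin 32 → Fin 32 → A}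
    {Y : Fin 32 → Fin 6 → A} {Z : Fin 6 → Fin 6 → A}
    (hX : ∀ α β, ∑ γ, Q γ α • X γ β = X α β) (hX' : ∀ α β, ∑ γ, Q γ β • X α γ = X α β)
    (hY : ∀ α b, ∑ γ, Q γ α • Y γ b = Y α b) :
    ofComponents e ψ X Y Z = 0 ↔
      (∀ α β, X α β + X β α = 0) ∧ (∀ α b, Y α b = 0) ∧ ∀ a b, Z a b = Z b a := by
  constructor
  · intro h0
    choose f hfe hfψ using exists_even_dual h
    choose q hqe hqψ using exists_odd_dual hQ h
    refine ⟨fun α β => ?_, fun α b => ?_, fun a b => ?_⟩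
    · have h1 := congrFun (congrFun (congrFun (congrFun h0 1) 1) (q α)) (q β)
      simp only [ofComponents, TwoForm.rmul, wedge, Pi.add_apply, Finset.sum_apply, hqe, hqψ,
        sg_algebraMap, Pi.zero_apply] at h1
      simp only [map_zero, mul_zero, zero_mul, smul_zero, sub_zero, Finset.sum_const_zero,
        add_zero, ← map_mul] at h1
      simp only [show sn ((1 : Fin 2) * 1) = -1 from rfl, neg_one_smul, sub_neg_eq_add, add_mul,
        ← Algebra.smul_def, Finset.sum_add_distrib] at h1
      rw [← h1]
      congr 1
      · simp only [mul_smul, ← Finset.smul_sum, hX', hX]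
      · rw [Finset.sum_comm]
        simp only [mul_comm (Q _ β), mul_smul, ← Finset.smul_sum, hX, hX']
    · have h1 := congrFun (congrFun (congrFun (congrFun h0 1) 0) (q α)) (f b)
      simp only [ofComponents, TwoForm.rmul, wedge, Pi.add_apply, Finset.sum_apply, hqe, hqψ,
        hfe, hfψ, sg_algebraMap, Pi.zero_apply] at h1
      simp only [map_zero, mul_zero, zero_mul, smul_zero, sub_zero, Finset.sum_const_zero,
        add_zero, zero_add, mul_ite, mul_one, ite_mul, Finset.sum_ite_eq', Finset.mem_univ,
        if_true, ← Algebra.smul_def, hY] at h1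
      exact h1
    · have h1 := congrFun (congrFun (congrFun (congrFun h0 0) 0) (f a)) (f b)
      simp only [ofComponents, TwoForm.rmul, wedge, Pi.add_apply, Finset.sum_apply,
        hfe, hfψ, Pi.zero_apply] at h1
      simp only [map_zero, mul_zero, zero_mul, smul_zero, sub_zero, Finset.sum_const_zero,
        zero_add, apply_ite (sg (0 : Fin 2)), map_one, mul_ite, mul_one, ite_mul, one_mul,
        show sn (0 : Fin 2) = 1 from rfl, one_smul, sub_mul, ite_self, Finset.sum_sub_distrib,
        Finset.sum_ite_eq', Finset.mem_univ, if_true] at h1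
      exact sub_eq_zero.1 h1
  · rintro ⟨h1, h2, h3⟩
    have half : ∀ w : TwoForm A, w = -w → w = 0 := by
      intro w hw
      have : (2 : ℝ) • w = 0 := by rw [two_smul]; nth_rw 1 [hw]; simp
      simpa using this
    have e1 : ∑ α, ∑ β, (wedge (ψ α) (ψ β)).rmul (X α β) = 0 := by
      apply half
      nth_rw 1 [Finset.sum_comm]
      simp only [← Finset.sum_neg_distrib]
      refine Finset.sum_congr rfl fun α _ => Finset.sum_congr rfl fun β _ => ?_
      rw [wedge_comm (h.odd α) (h.odd β), ← TwoForm.rmul_neg, eq_neg_of_add_eq_zero_left (h1 β α)]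
      simp [sn]
    have e3 : ∑ a, ∑ b, (wedge (e a) (e b)).rmul (Z a b) = 0 := by
      apply half
      nth_rw 1 [Finset.sum_comm]
      simp only [← Finset.sum_neg_distrib]
      refine Finset.sum_congr rfl fun a _ => Finset.sum_congr rfl fun b _ => ?_
      rw [wedge_comm (h.even a) (h.even b), h3 b a, TwoForm.smul_rmul]
      simp [sn]
    simp only [ofComponents, e1, e3, h2, TwoForm.rmul_zero, Finset.sum_const_zero, add_zero]

end Forms

/-! ### The transversal gauge transformations that are used. -/

namespace Majorana

variable (R : Majorana)

theorem cliff_single (i : Fin 5) (r : ℝ) : R.cliff (Pi.single i r) = r • R.Γ (Sum.inr i) := by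
  simp [cliff, Pi.single_apply]

theorem Γ_Γ_mem_spin5 (i j : Fin 5) : R.Γ (Sum.inr i) * R.Γ (Sum.inr j) ∈ R.spin5 := by
  refine Submonoid.subset_closure ⟨Pi.single i 1, Pi.single j 1, ?_, ?_, ?_⟩
  · simp [Pi.single_apply]
  · simp [Pi.single_apply]
  · rw [cliff_single, cliff_single, one_smul, one_smul]

theorem neg_one_mem_spin5 : (-1 : Mat) ∈ R.spin5 := by
  refine Submonoid.subset_closure ⟨Pi.single 0 1, Pi.single 0 (-1), ?_, ?_, ?_⟩
  · simp [Pi.single_apply]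
  · simp [Pi.single_apply]
  · rw [cliff_single, cliff_single, mul_smul_comm, one_smul, Γ_sq, η_inr]; simp

theorem isTransversalSpin_one : R.IsTransversalSpin 1 1 where
  mem := one_mem _
  covers b := by simp [Matrix.one_apply]

theorem isTransversalSpin_Γ_Γ {i j : Fin 5} (hij : i ≠ j) :
    R.IsTransversalSpin (R.Γ (Sum.inr i) * R.Γ (Sum.inr j))
      (Matrix.diagonal fun a => if a = i ∨ a = j then -1 else 1) where
  mem := R.Γ_Γ_mem_spin5 i j
  covers b := by
    simp only [Matrix.diagonal_apply, ite_smul, zero_smul, Finset.sum_ite_eq', Finset.mem_univ,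
      if_true]
    have h1 := R.Γ_sign (Sum.inr b) (Sum.inr i)
    have h2 := R.Γ_sign (Sum.inr b) (Sum.inr j)
    have h := mul_comm_sign h1 h2
    simp only [Sum.inr.injEq] at h
    by_cases hi : i = b
    · subst hi
      simp only [if_true, hij.symm, if_false, one_mul, neg_one_smul, true_or] at h ⊢
      rw [neg_mul, h, neg_neg]
    by_cases hj : j = b
    · subst hj
      simp only [if_true, hij, if_false, mul_one, neg_one_smul, or_true] at h ⊢
      rw [neg_mul, h, neg_neg]
    · simp only [hi, hj, if_false, mul_neg, mul_one, neg_neg, one_smul, Ne.symm hi, Ne.symm hj,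
        or_self] at h ⊢
      rw [h]

theorem IsTransversalSpin.neg {R : Majorana} {T : Mat} {r : Matrix (Fin 5) (Fin 5) ℝ}
    (h : R.IsTransversalSpin T r) : R.IsTransversalSpin (-T) r where
  mem := by
    rw [← neg_one_mul]
    exact mul_mem R.neg_one_mem_spin5 h.mem
  covers b := by rw [neg_mul, h.covers, mul_neg]

theorem P_Γ_Γ (i j : Fin 5) : R.P * (R.Γ (Sum.inr i) * R.Γ (Sum.inr j)) =
    R.Γ (Sum.inr i) * R.Γ (Sum.inr j) * R.P := by
  rw [← mul_assoc, P_Γ, mul_assoc, P_Γ, mul_assoc]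

theorem Pbar_Γ_Γ (i j : Fin 5) : R.Pbar * (R.Γ (Sum.inr i) * R.Γ (Sum.inr j)) =
    R.Γ (Sum.inr i) * R.Γ (Sum.inr j) * R.Pbar := by
  rw [← mul_assoc, Pbar_Γ, mul_assoc, Pbar_Γ, mul_assoc]

/-- Transversal bilinears thus couple opposite chiralities only. -/
theorem P_transpose_C_Γ_Pbar (i : Fin 5) :
    R.P.transpose * (R.C * R.Γ (Sum.inr i)) = R.C * R.Γ (Sum.inr i) * R.Pbar := by
  rw [← mul_assoc, P_transpose, mul_assoc, Pbar_Γ, mul_assoc]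

end Majorana

section Columns

variable {A : Type*} [Ring A] [Algebra ℝ A]

/-- Real matrices acting on columns of functions. -/
def mulVecFn (M : Mat) (χ : Fin 32 → A) (α : Fin 32) : A := ∑ β, M α β • χ β

theorem mulVecFn_mulVecFn (M N : Mat) (χ : Fin 32 → A) :
    mulVecFn M (mulVecFn N χ) = mulVecFn (M * N) χ := by
  funext α
  simp only [mulVecFn, Finset.smul_sum, smul_smul, Matrix.mul_apply, Finset.sum_smul]
  exact Finset.sum_comm

theorem mulVecFn_one (χ : Fin 32 → A) : mulVecFn 1 χ = χ := by
  funext α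
  simp [mulVecFn, Matrix.one_apply]

theorem mulVecFn_smul (M : Mat) (r : ℝ) (χ : Fin 32 → A) :
    mulVecFn M (r • χ) = r • mulVecFn M χ := by
  funext α
  simp only [mulVecFn, Pi.smul_apply, smul_comm _ r, Finset.smul_sum]

/-- The matrix `C Γ_i C⁻¹` is an involution, because a transversal generator squares to `1`. -/
theorem lower_eq_iff (R : Majorana) (i : Fin 5) (χ ξ : Fin 32 → A) :
    (2 : ℝ) • mulVecFn (R.C * R.Γ (Sum.inr i)) χ = ξ ↔
      mulVecFn R.C χ = (1 / 2 : ℝ) • mulVecFn (R.C * R.Γ (Sum.inr i) * R.C⁻¹) ξ := by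
  have hΓ : R.Γ (Sum.inr i) * R.Γ (Sum.inr i) = 1 := by rw [R.Γ_sq, η_inr, one_smul]
  have hC : R.C⁻¹ * R.C = 1 := Matrix.nonsing_inv_mul _ R.nondegenerate
  have hC' : R.C * R.C⁻¹ = 1 := Matrix.mul_nonsing_inv _ R.nondegenerate
  constructor
  · rintro rfl
    rw [mulVecFn_smul, mulVecFn_mulVecFn, smul_smul]
    have : R.C * R.Γ (Sum.inr i) * R.C⁻¹ * (R.C * R.Γ (Sum.inr i)) = R.C := by
      rw [mul_assoc, ← mul_assoc R.C⁻¹, hC, one_mul, mul_assoc, hΓ, mul_one]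
    rw [this]; norm_num
  · intro h
    have h1 : mulVecFn (R.C * R.Γ (Sum.inr i)) χ =
        mulVecFn (R.C * R.Γ (Sum.inr i) * R.C⁻¹) (mulVecFn R.C χ) := by
      rw [mulVecFn_mulVecFn, mul_assoc _ R.C⁻¹, hC, mul_one]
    have : R.C * R.Γ (Sum.inr i) * R.C⁻¹ * (R.C * R.Γ (Sum.inr i) * R.C⁻¹) = 1 := by
      calc _ = R.C * R.Γ (Sum.inr i) * (R.C⁻¹ * R.C) * R.Γ (Sum.inr i) * R.C⁻¹ := by
            simp only [mul_assoc]
        _ = 1 := by rw [hC, mul_one, mul_assoc R.C, hΓ, mul_one, hC']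
    rw [h1, h, mulVecFn_smul, mulVecFn_mulVecFn, this, mulVecFn_one, smul_smul]
    norm_num

end Columns

/-! ### Consequences of gauge independence, and the transversal constraint. -/

section Immersion

variable {A : Type*} [Ring A] [Algebra ℝ A] [SuperCommAlgebra A] {R : Majorana}
  {E : Idx → OneForm A} {Ψ : Fin 32 → OneForm A} {Sh00 : Fin 5 → Fin 6 → A}
  {Sh01 : Fin 5 → Fin 32 → A} {H : Matrix (Fin 32) (Fin 32) A} {τ : Fin 6 → Fin 32 → A}

namespace IsM5Immersion

theorem isCoframe (hφ : IsM5Immersion R E Ψ Sh00 Sh01 H τ) :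
    IsCoframe R.P (fun a => E (Sum.inl a)) (act R.P Ψ) := by
  have := hφ.coframe 1 1 R.isTransversalSpin_one
  rwa [act_one] at this

/-- Both `T` and `-T` cover `r`, and the spinor term changes sign between the two gauges. -/
theorem bosonic_tangential (hφ : IsM5Immersion R E Ψ Sh00 Sh01 H τ) {T r}
    (h : R.IsTransversalSpin T r) (a : Fin 5) :
    ∑ b, r a b • E (Sum.inr b) = ∑ c, (E (Sum.inl c)).rmul (Sh00 a c) := by
  have h1 := hφ.bosonic T r h a
  have h2 := hφ.bosonic (-T) r h.neg a
  have h3 : act R.P (act (-T) Ψ) = -act R.P (act T Ψ) := by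
    rw [← act_mul, mul_neg, act_neg, act_mul]
  have h4 : ∑ β, (act R.P (act (-T) Ψ) β).rmul (Sh01 a β) =
      -∑ β, (act R.P (act T Ψ) β).rmul (Sh01 a β) := by
    ext D
    simp only [h3, LinearMap.sum_apply, LinearMap.neg_apply, OneForm.rmul_apply, Pi.neg_apply,
      neg_mul, Finset.sum_neg_distrib]
  rw [h4] at h2
  ext D
  have e1 := LinearMap.congr_fun h1 D
  have e2 := LinearMap.congr_fun h2 D
  rw [LinearMap.add_apply] at e1 e2
  rw [LinearMap.neg_apply] at e2
  set x := (∑ b, r a b • E (Sum.inr b)) D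
  set y := (∑ c, (E (Sum.inl c)).rmul (Sh00 a c)) D
  have e3 : (2 : ℝ) • (x - y) = 0 := by
    rw [two_smul]
    nth_rw 1 [e1]
    rw [e2]; abel
  rw [smul_eq_zero] at e3
  exact sub_eq_zero.1 (e3.resolve_left two_ne_zero)

/-- Gauge independence forces the transversal part of the bosonic co-frame to vanish. -/
theorem transversal_eq_zero (hφ : IsM5Immersion R E Ψ Sh00 Sh01 H τ) (a : Fin 5) :
    E (Sum.inr a) = 0 := by
  -- Any second transversal index gives a half turn that reverses direction `a`, while the
  -- tangential expansion is unchanged.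
  obtain ⟨j, hj⟩ : ∃ j, a ≠ j := ⟨a + 1, by revert a; decide⟩
  have h1 := hφ.bosonic_tangential R.isTransversalSpin_one a
  have h2 := hφ.bosonic_tangential (R.isTransversalSpin_Γ_Γ hj) a
  rw [← h1] at h2
  ext D
  have h3 := LinearMap.congr_fun h2 D
  simp only [LinearMap.smul_apply, Matrix.diagonal_apply, Matrix.one_apply,
    ite_smul, zero_smul, Finset.sum_ite_eq, Finset.mem_univ, if_true, true_or, one_smul,
    neg_one_smul] at h3
  have h4 : (2 : ℝ) • E (Sum.inr a) D = 0 := by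
    rw [two_smul]; nth_rw 1 [← h3]; simp
  simpa using h4

theorem shear_mul_P (hφ : IsM5Immersion R E Ψ Sh00 Sh01 H τ) : H * toFn R.P = H := by
  rw [← hφ.dom11, mul_assoc, ← toFn_mul, R.P_P]

theorem Pbar_mul_shear (hφ : IsM5Immersion R E Ψ Sh00 Sh01 H τ) : toFn R.Pbar * H = H := by
  rw [← hφ.dom11, ← mul_assoc, ← mul_assoc, ← toFn_mul, R.Pbar_Pbar]

/-- Gauge independence of the odd-odd component of the shear map. -/
theorem shear_comm (hφ : IsM5Immersion R E Ψ Sh00 Sh01 H τ) (i j : Fin 5) (hij : i ≠ j) :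
    H * toFn (R.Γ (Sum.inr i) * R.Γ (Sum.inr j)) =
      toFn (R.Γ (Sum.inr i) * R.Γ (Sum.inr j)) * H := by
  obtain ⟨τ', h⟩ := hφ.fermionic _ _ (R.isTransversalSpin_Γ_Γ hij)
  have hPT := R.P_Γ_Γ i j
  have hPbT := R.Pbar_Γ_Γ i j
  generalize R.Γ (Sum.inr i) * R.Γ (Sum.inr j) = T at h hPT hPbT ⊢
  have hHP := hφ.shear_mul_P
  ext α δ
  -- Contraction with an odd dual field annihilates every `e`, and with it the gauge-dependent term
  -- `τ'`.
  obtain ⟨q, hqe, hqψ⟩ := exists_odd_dual R.P_P hφ.isCoframe δ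
  have h1 := LinearMap.congr_fun (h α) q.toDer
  have hPΨ : act R.P (act T Ψ) = act T (act R.P Ψ) := by rw [← act_mul, hPT, act_mul]
  have hPbΨ : act R.Pbar (act T Ψ) = act T (act R.Pbar Ψ) := by rw [← act_mul, hPbT, act_mul]
  rw [hPΨ, hPbΨ] at h1
  have hc : ∀ κ, act R.Pbar Ψ κ q.toDer = H κ δ := by
    intro κ
    rw [hφ.shear κ]
    simp only [LinearMap.add_apply, LinearMap.sum_apply, OneForm.rmul_apply, hqe, hqψ, zero_mul,
      Finset.sum_const_zero, add_zero, ← Algebra.smul_def]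
    rw [← mul_toFn_apply, hHP]
  have hl : act T (act R.Pbar Ψ) α q.toDer = (toFn (A := A) T * H) α δ := by
    rw [act, LinearMap.sum_apply, toFn_mul_apply]
    exact Finset.sum_congr rfl fun κ _ => by rw [LinearMap.smul_apply, hc]
  have hr : ∀ β, act T (act R.P Ψ) β q.toDer = algebraMap ℝ A ((T * R.P) β δ) := by
    intro β
    rw [act, LinearMap.sum_apply, Matrix.mul_apply, map_sum]
    exact Finset.sum_congr rfl fun κ _ => by
      rw [LinearMap.smul_apply, hqψ, map_mul, Algebra.smul_def]
  rw [hl] at h1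
  simp only [LinearMap.add_apply, LinearMap.sum_apply, OneForm.rmul_apply, hqe, hr, zero_mul,
    Finset.sum_const_zero, add_zero, ← Algebra.smul_def] at h1
  rw [← mul_toFn_apply, ← hPT, toFn_mul, ← mul_assoc, hHP] at h1
  exact h1.symm

theorem odd_transversal (hφ : IsM5Immersion R E Ψ Sh00 Sh01 H τ) (α : Fin 32) :
    (act R.Pbar Ψ α).HasParity 1 := by
  rw [hφ.shear]
  refine .add (.sum fun β _ => ?_) (.sum fun b _ => ?_)
  · simpa using (hφ.isCoframe.odd β).rmul (hφ.parity11 α β)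
  · simpa using (hφ.isCoframe.even b).rmul (hφ.parity10 b α)

theorem decomposition (R : Majorana) (Ψ : Fin 32 → OneForm A) : Ψ = act R.P Ψ + act R.Pbar Ψ := by
  rw [← act_add, Majorana.Pbar, add_sub_cancel, act_one]

/-- The left hand side of the transversal torsion constraint. -/
theorem pairForm_transversal (hφ : IsM5Immersion R E Ψ Sh00 Sh01 H τ) (i : Fin 5) :
    pairForm R (R.Γup (Sum.inr i)) Ψ Ψ =
      ofComponents (fun a => E (Sum.inl a)) (act R.P Ψ)
        (fun α β => (2 : ℝ) • (toFn (R.C * R.Γ (Sum.inr i)) * H : Matrix _ _ A) α β)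
        (fun α b => (2 : ℝ) • ∑ β, (R.C * R.Γ (Sum.inr i)) α β • τ b β) 0 := by
  set K := R.C * R.Γ (Sum.inr i) with hK
  have hKs : K.transpose = K := R.C_Γ_transpose _
  have hPK : R.P.transpose * K = K * R.Pbar := R.P_transpose_C_Γ_Pbar i
  -- Equal chiralities do not pair under `K`; the two cross terms coincide because odd 1-forms
  -- commute and `K` is symmetric.
  have h1 : contract K (act R.P Ψ) (act R.P Ψ) = 0 := by
    rw [contract_act_left, contract_act_right, hPK, mul_assoc, R.Pbar_P, mul_zero, contract_zero]
  have h2 : contract K (act R.Pbar Ψ) (act R.Pbar Ψ) = 0 := by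
    have : R.Pbar.transpose * K = K * R.P := by
      rw [Majorana.Pbar, Matrix.transpose_sub, sub_mul, hPK, Matrix.transpose_one, Majorana.Pbar,
        mul_sub]
      simp
    rw [contract_act_left, contract_act_right, this, mul_assoc, R.P_Pbar, mul_zero, contract_zero]
  have h3 : pairForm R (R.Γup (Sum.inr i)) Ψ Ψ =
      (2 : ℝ) • contract K (act R.P Ψ) (act R.Pbar Ψ) := by
    rw [pairForm_eq, Majorana.Γup, η_inr, one_smul, ← hK]
    conv_lhs => rw [decomposition R Ψ]
    rw [contract_add_left, contract_add_right, contract_add_right, h1, h2,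
      contract_symm hKs hφ.isCoframe.odd hφ.odd_transversal, zero_add, add_zero, two_smul]
  rw [h3]
  simp only [contract, hφ.shear, wedge_add_right, wedge_sum_right, wedge_rmul_right, ofComponents,
    toFn_mul_apply, TwoForm.rmul_smul, TwoForm.rmul_sum, Pi.zero_apply, TwoForm.rmul_zero,
    Finset.sum_const_zero, add_zero, smul_add, Finset.sum_add_distrib, Finset.smul_sum]
  congr 1
  · exact Finset.sum_congr rfl fun α _ => Finset.sum_comm
  · exact Finset.sum_congr rfl fun α _ => Finset.sum_comm

/-- The right hand side of the transversal torsion constraint. -/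
theorem torsion_transversal (hφ : IsM5Immersion R E Ψ Sh00 Sh01 H τ) {Ω : Idx → Idx → OneForm A}
    {II0 : Fin 5 → Fin 6 → Fin 6 → A} {II1 : Fin 5 → Fin 32 → Fin 6 → A}
    (hII : IsSecondFundamental R (fun a => E (Sum.inl a)) (act R.P Ψ) Ω II0 II1) (i : Fin 5) :
    d (E (Sum.inr i)) + ∑ b, wedge (Ω (Sum.inr i) b) (E b) =
      ofComponents (fun a => E (Sum.inl a)) (act R.P Ψ) 0 (fun α b => II1 i α b)
        (fun a b => II0 i a b) := by
  rw [hφ.transversal_eq_zero, d_zero, zero_add, Fintype.sum_sum_type]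
  simp only [hφ.transversal_eq_zero, wedge_zero_right, Finset.sum_const_zero, add_zero, hII.expand,
    wedge_add_left, wedge_sum_left, wedge_rmul_left _ (hφ.isCoframe.even _), ofComponents,
    Pi.zero_apply, TwoForm.rmul_zero, zero_add, Finset.sum_add_distrib]
  rw [add_comm]
  congr 1
  · exact Finset.sum_comm
  · exact Finset.sum_comm

theorem torsionConstraint_transversal_iff (hφ : IsM5Immersion R E Ψ Sh00 Sh01 H τ)
    {Ω : Idx → Idx → OneForm A} {II0 : Fin 5 → Fin 6 → Fin 6 → A}
    {II1 : Fin 5 → Fin 32 → Fin 6 → A}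
    (hII : IsSecondFundamental R (fun a => E (Sum.inl a)) (act R.P Ψ) Ω II0 II1) (i : Fin 5) :
    TorsionConstraint R E Ψ Ω (Sum.inr i) ↔
      (∀ α β, (toFn (A := A) (R.C * R.Γ (Sum.inr i)) * H) α β =
        -(toFn (A := A) (R.C * R.Γ (Sum.inr i)) * H) β α) ∧
      (∀ α b, (2 : ℝ) • ∑ β, (R.C * R.Γ (Sum.inr i)) α β • τ b β = II1 i α b) ∧
      ∀ a b, II0 i a b = II0 i b a := by
  have hPK := R.P_transpose_C_Γ_Pbar i
  have hHP := hφ.shear_mul_P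
  have hPH := hφ.Pbar_mul_shear
  rw [TorsionConstraint, hφ.pairForm_transversal, hφ.torsion_transversal hII, ← sub_eq_zero,
    ofComponents_sub, ofComponents_eq_zero_iff R.P_P hφ.isCoframe]
  · simp only [Pi.sub_apply, Pi.zero_apply, sub_zero, zero_sub, neg_inj, sub_eq_zero]
    refine and_congr ?_ Iff.rfl
    refine forall_congr' fun α => forall_congr' fun β => ?_
    rw [← smul_add, smul_eq_zero, or_iff_right two_ne_zero, add_eq_zero_iff_eq_neg]
  -- The remaining goals check that the components are supported on `P(32)`, as the normal form
  -- requires.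
  · intro α β
    simp only [Pi.sub_apply, Pi.zero_apply, sub_zero]
    simp only [smul_comm _ (2 : ℝ), ← Finset.smul_sum]
    congr 1
    have : toFn (A := A) R.P.transpose * (toFn (R.C * R.Γ (Sum.inr i)) * H) =
        toFn (R.C * R.Γ (Sum.inr i)) * H := by
      rw [← mul_assoc, ← toFn_mul, hPK, toFn_mul, mul_assoc, hPH]
    nth_rw 2 [← this]
    rw [toFn_mul_apply]
    simp only [Matrix.transpose_apply]
  · intro α β
    simp only [Pi.sub_apply, Pi.zero_apply, sub_zero]
    simp only [smul_comm _ (2 : ℝ), ← Finset.smul_sum]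
    congr 1
    rw [← mul_toFn_apply, mul_assoc, hHP]
  · intro α b
    simp only [Pi.sub_apply, smul_sub, Finset.sum_sub_distrib, hII.dom]
    congr 1
    simp only [smul_comm _ (2 : ℝ), ← Finset.smul_sum]
    congr 1
    have h1 : mulVecFn (R.C * R.Γ (Sum.inr i) * R.Pbar) (τ b) =
        mulVecFn (R.C * R.Γ (Sum.inr i)) (τ b) := by
      rw [← mulVecFn_mulVecFn]
      congr 1
      funext α
      exact hφ.cod10 b α
    rw [← hPK, ← mulVecFn_mulVecFn] at h1
    exact congrFun h1 α

end IsM5Immersion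

end Immersion

/-! ### The tangential constraint and the worldvolume torsion. -/

namespace Majorana

variable (R : Majorana)

/-- In contrast to transversal generators, tangential ones exchange the projectors, so these
bilinears couple equal chiralities. -/
theorem P_transpose_C_γup (a : Fin 6) :
    R.P.transpose * (R.C * R.γup a) = R.C * R.γup a * R.P := by
  rw [γup_eq, ← mul_assoc, P_transpose, mul_assoc, mul_smul_comm, Pbar_γ]
  simp only [mul_smul_comm, smul_mul_assoc, mul_assoc]

theorem C_γup_transpose (a : Fin 6) : (R.C * R.γup a).transpose = R.C * R.γup a :=  by
  rw [γup_eq, mul_smul_comm, Matrix.transpose_smul, γ, C_Γ_transpose]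

end Majorana

section Worldvolume

variable {A : Type*} [Ring A] [Algebra ℝ A] [SuperCommAlgebra A]

theorem TwoForm.neg_rmul (w : TwoForm A) (f : A) : (-w).rmul f = -w.rmul f := by
  funext i j D D'; simp only [TwoForm.rmul, neg_mul, Pi.neg_apply]

theorem wedge_sum_sum {ι κ : Type*} (s : Finset ι) (t : Finset κ) (α : ι → OneForm A)
    (β : κ → OneForm A) :
    wedge (∑ i ∈ s, α i) (∑ j ∈ t, β j) = ∑ i ∈ s, ∑ j ∈ t, wedge (α i) (β j) := by
  rw [wedge_sum_left]
  exact Finset.sum_congr rfl fun i _ => wedge_sum_right _ _ _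

theorem sum_pair_comm {ι ι' κ κ' M : Type*} [Fintype ι] [Fintype ι'] [Fintype κ] [Fintype κ']
    [AddCommMonoid M] (G : ι → ι' → κ → κ' → M) :
    ∑ α, ∑ β, ∑ b, ∑ c, G α β b c = ∑ b, ∑ c, ∑ α, ∑ β, G α β b c := by
  have := Finset.sum_comm (s := (Finset.univ : Finset (ι × ι')))
    (t := (Finset.univ : Finset (κ × κ'))) (f := fun p q => G p.1 p.2 q.1 q.2)
  simpa only [Fintype.sum_prod_type] using this

/-- Three signs combine to a minus: `τ` moves past `ψ`, then `e` is exchanged with `ψ`, and the odd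
coefficient moves to the left of the odd 2-form. -/
theorem contract_pullback_odd {e : Fin 6 → OneForm A} {ψ : Fin 32 → OneForm A}
    (he : ∀ a, (e a).HasParity 0) (hψ : ∀ α, (ψ α).HasParity 1) (K : Mat)
    {τ : Fin 6 → Fin 32 → A} (hτ : ∀ b α, HasParity 1 (τ b α))
    {s : Matrix (Fin 32) (Fin 32) A} (hs : ∀ α β, HasParity 0 (s α β)) :
    contract K (fun α => ∑ b, (e b).rmul (τ b α)) (fun β => ∑ κ, (ψ κ).rmul (s β κ)) =
      -∑ b, ∑ α, ∑ β, ∑ κ, K α β • TwoForm.lmul (τ b α * s β κ) (wedge (ψ κ) (e b)) := by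
  have key : ∀ b α β κ, wedge ((e b).rmul (τ b α)) ((ψ κ).rmul (s β κ)) =
      -TwoForm.lmul (τ b α * s β κ) (wedge (ψ κ) (e b)) := by
    intro b α β κ
    have h1 : sg 1 (τ b α * s β κ) = -(τ b α * s β κ) := by
      rw [((hτ b α).mul (hs β κ)).sg_eq]
      simp [sn]
    have h2 : sg 1 (τ b α) = -τ b α := by
      rw [(hτ b α).sg_eq]
      simp [sn]
    rw [wedge_rmul_right, wedge_rmul_left _ (hψ κ), wedge_comm (hψ κ) (he b),
      lmul_wedge (hψ κ) (he b), TwoForm.rmul_rmul, h2, show (1 : Fin 2) + 0 = 1 from rfl, h1]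
    simp [sn, TwoForm.rmul_neg, TwoForm.neg_rmul]
  simp only [contract, wedge_sum_sum, key, Finset.sum_neg_distrib, smul_neg, Finset.smul_sum]
  refine congrArg Neg.neg ((sum_pair_comm _).trans ?_)
  refine Finset.sum_congr rfl fun b _ => ?_
  refine Finset.sum_comm.trans ?_
  refine Finset.sum_congr rfl fun α _ => ?_
  exact Finset.sum_comm

theorem contract_bosonic {e : Fin 6 → OneForm A} (he : ∀ a, (e a).HasParity 0) (R : Majorana)
    (M : Mat) (τ : Fin 6 → Fin 32 → A) :
    contract (R.C * M) (fun α => ∑ b, (e b).rmul (τ b α)) (fun β => ∑ b, (e b).rmul (τ b β)) =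
      ∑ b₁, ∑ b₂, TwoForm.lmul (pairFn R M (τ b₁) (τ b₂)) (wedge (e b₁) (e b₂)) := by
  have key : ∀ b c α β, wedge ((e b).rmul (τ b α)) ((e c).rmul (τ c β)) =
      (wedge (e b) (e c)).rmul (τ b α * τ c β) := by
    intro b c α β
    rw [wedge_rmul_right, wedge_rmul_left _ (he c), TwoForm.rmul_rmul]
    rfl
  have hl : ∀ b c f, TwoForm.lmul f (wedge (e b) (e c)) = (wedge (e b) (e c)).rmul f := by
    intro b c f
    rw [lmul_wedge (he b) (he c)]
    rfl
  simp only [contract, wedge_sum_sum, key, hl, pairFn, TwoForm.rmul_sum, TwoForm.rmul_smul,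
    Finset.smul_sum]
  exact sum_pair_comm _

/-- Self-adjointness of the Clifford action carries the left factor through `C`, which exposes the
sandwich of `γ^a`. The projector in the resulting identity is absorbed by `ψ`. -/
theorem contract_fermionic {ψ : Fin 32 → OneForm A} (hψ : ∀ α, (ψ α).HasParity 1)
    {R : Majorana} (hP : act R.P ψ = ψ) {h : Fin 6 → Fin 6 → Fin 6 → A} (hh : IsThreeForm h)
    (hsd : h = hodge h) (a : Fin 6) :
    contract (R.C * R.γup a) (fun α => ∑ κ, (ψ κ).rmul (slash R h α κ))
        (fun β => ∑ κ, (ψ κ).rmul (slash R h β κ)) =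
      ∑ b, TwoForm.lmul (-((2 : ℝ) • sq h b a)) (pairForm R (R.γup b) ψ ψ) := by
  have heven : ∀ α β, HasParity 0 (slash R h α β) := by
    intro α β
    rw [slash, Matrix.of_apply]
    exact HasParity.real_smul (HasParity.sum fun x _ => HasParity.sum fun y _ =>
      HasParity.sum fun z _ => (hh.even x y z).real_smul _) _
  have key : ∀ α β κ ν, wedge ((ψ κ).rmul (slash R h α κ)) ((ψ ν).rmul (slash R h β ν)) =
      (wedge (ψ κ) (ψ ν)).rmul (slash R h α κ * slash R h β ν) := by
    intro α β κ ν
    rw [wedge_rmul_right, wedge_rmul_left _ (hψ ν), TwoForm.rmul_rmul, (heven α κ).sg_eq]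
    simp [sn]
  have e1 : ∀ κ ν, ∑ α, ∑ β, (R.C * R.γup a) α β • (slash R h α κ * slash R h β ν) =
      ∑ b, (R.C * (R.γup b * R.P)) κ ν • (-2 : ℝ) • sq h b a := by
    intro κ ν
    have h1 : ∀ β, ∑ α, (R.C * R.γup a) α β • slash R h α κ =
        (toFn (A := A) R.C * slash R h * toFn (A := A) (R.γup a)) κ β := by
      intro β
      rw [mul_toFn_apply]
      simp only [← slash_transpose R hh, Matrix.mul_apply (M := R.C), Finset.sum_smul, Finset.smul_sum,
        smul_smul]
      rw [Finset.sum_comm]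
      simp only [mul_comm]
    have h2 : ∑ α, ∑ β, (R.C * R.γup a) α β • (slash R h α κ * slash R h β ν) =
        (toFn (A := A) R.C * (slash R h * toFn (A := A) (R.γup a) * slash R h)) κ ν := by
      rw [← mul_assoc, ← mul_assoc, Matrix.mul_apply, Finset.sum_comm]
      refine Finset.sum_congr rfl fun β _ => ?_
      rw [← h1, Finset.sum_mul]
      simp only [smul_mul_assoc]
    rw [h2, toFn_mul_apply]
    simp only [slash_γup_slash R hh hsd, Finset.smul_sum]
    rw [Finset.sum_comm]
    refine Finset.sum_congr rfl fun b _ => ?_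
    rw [Matrix.mul_apply, Finset.sum_smul]
    exact Finset.sum_congr rfl fun μ _ => (mul_smul _ _ _).symm
  have e2 : ∀ b, TwoForm.lmul (-((2 : ℝ) • sq h b a)) (pairForm R (R.γup b) ψ ψ) =
      ∑ κ, ∑ ν, (R.C * (R.γup b * R.P)) κ ν • (wedge (ψ κ) (ψ ν)).rmul ((-2 : ℝ) • sq h b a) := by
    intro b
    have h1 : pairForm R (R.γup b) ψ ψ = contract (R.C * (R.γup b * R.P)) ψ ψ := by
      rw [pairForm_eq]
      conv_lhs => rw [← hP]
      rw [← mul_assoc, contract_act_left, contract_act_right, R.P_transpose_C_γup, mul_assoc,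
        R.P_P]
    rw [h1, contract, TwoForm.lmul_sum]
    refine Finset.sum_congr rfl fun κ _ => ?_
    rw [TwoForm.lmul_sum]
    refine Finset.sum_congr rfl fun ν _ => ?_
    rw [TwoForm.lmul_smul, lmul_wedge (hψ κ) (hψ ν), neg_smul]
    rfl
  simp only [contract, wedge_sum_sum, key, e2, ← TwoForm.rmul_smul, Finset.smul_sum]
  rw [sum_pair_comm, Finset.sum_comm (s := (Finset.univ : Finset (Fin 6)))]
  refine Finset.sum_congr rfl fun κ _ => ?_
  rw [Finset.sum_comm (s := (Finset.univ : Finset (Fin 6)))]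
  refine Finset.sum_congr rfl fun ν _ => ?_
  simp only [← TwoForm.rmul_sum]
  rw [e1]

end Worldvolume

namespace IsM5Immersion

variable {A : Type*} [Ring A] [Algebra ℝ A] [SuperCommAlgebra A] {R : Majorana}
  {E : Idx → OneForm A} {Ψ : Fin 32 → OneForm A} {Sh00 : Fin 5 → Fin 6 → A}
  {Sh01 : Fin 5 → Fin 32 → A} {H : Matrix (Fin 32) (Fin 32) A} {τ : Fin 6 → Fin 32 → A}

theorem shear_slash (hφ : IsM5Immersion R E Ψ Sh00 Sh01 H τ) {h : Fin 6 → Fin 6 → Fin 6 → A}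
    (hH : H = slash R h * toFn R.P) :
    act R.Pbar Ψ = (fun α => ∑ κ, (act R.P Ψ κ).rmul (slash R h α κ)) +
      fun α => ∑ b, (E (Sum.inl b)).rmul (τ b α) := by
  funext α
  rw [hφ.shear, Pi.add_apply]
  congr 1
  simp only [hH, mul_toFn_apply, OneForm.rmul_sum, OneForm.rmul_smul]
  rw [Finset.sum_comm]
  refine Finset.sum_congr rfl fun κ _ => ?_
  conv_rhs => rw [← hφ.isCoframe.proj]
  rw [act, OneForm.sum_rmul]
  simp only [OneForm.smul_rmul]

/-- The left hand side of the tangential torsion constraint. -/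
theorem pairForm_tangential (hφ : IsM5Immersion R E Ψ Sh00 Sh01 H τ)
    {h : Fin 6 → Fin 6 → Fin 6 → A} (hh : IsThreeForm h) (hsd : h = hodge h)
    (hH : H = slash R h * toFn R.P) (a : Fin 6) :
    pairForm R (R.Γup (Sum.inl a)) Ψ Ψ =
      (∑ b₁, ∑ b₂, TwoForm.lmul (pairFn R (R.γup a) (τ b₁) (τ b₂))
        (wedge (E (Sum.inl b₁)) (E (Sum.inl b₂))))
      - (2 : ℝ) • (∑ b, ∑ α, ∑ β, ∑ κ, (R.C * R.γup a) α β •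
          TwoForm.lmul (τ b α * slash R h β κ) (wedge (act R.P Ψ κ) (E (Sum.inl b))))
      + ∑ a', TwoForm.lmul ((if a = a' then 1 else 0) - (2 : ℝ) • sq h a' a)
          (pairForm R (R.γup a') (act R.P Ψ) (act R.P Ψ)) := by
  have he := hφ.isCoframe.even
  have hψ := hφ.isCoframe.odd
  have heven : ∀ α β, HasParity 0 (slash R h α β) := by
    intro α β
    rw [slash, Matrix.of_apply]
    exact HasParity.real_smul (HasParity.sum fun x _ => HasParity.sum fun y _ =>
      HasParity.sum fun z _ => (hh.even x y z).real_smul _) _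
  have hK := R.C_γup_transpose a
  have hPK := R.P_transpose_C_γup a
  have hsh := hφ.shear_slash hH
  set B : Fin 32 → OneForm A := fun α => ∑ b, (E (Sum.inl b)).rmul (τ b α) with hB
  set F : Fin 32 → OneForm A := fun α => ∑ κ, (act R.P Ψ κ).rmul (slash R h α κ) with hF
  have hBodd : ∀ α, (B α).HasParity 1 := fun α => .sum fun b _ => by
    simpa using (he b).rmul (hφ.parity10 b α)
  have hFodd : ∀ α, (F α).HasParity 1 := fun α => .sum fun κ _ => by
    simpa using (hψ κ).rmul (heven α κ)
  have h1 : contract (R.C * R.γup a) (act R.P Ψ) (act R.Pbar Ψ) = 0 := by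
    rw [contract_act_left, contract_act_right, hPK, mul_assoc, R.P_Pbar, mul_zero, contract_zero]
  have h2 : contract (R.C * R.γup a) (act R.Pbar Ψ) (act R.P Ψ) = 0 := by
    rw [contract_symm hK hψ hφ.odd_transversal, h1]
  -- The complementary spinor is `F + B`, with `F` the shear of `ψ` and `B` the `τ` term; its cross
  -- terms agree and produce the factor `2`.
  have h3 : pairForm R (R.Γup (Sum.inl a)) Ψ Ψ = pairForm R (R.γup a) (act R.P Ψ) (act R.P Ψ) +
      contract (R.C * R.γup a) F F + (2 : ℝ) • contract (R.C * R.γup a) B F +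
      contract (R.C * R.γup a) B B := by
    change contract (R.C * R.γup a) Ψ Ψ = _
    conv_lhs => rw [decomposition R Ψ]
    rw [contract_add_left, contract_add_right, contract_add_right, h1, h2, hsh, contract_add_left,
      contract_add_right, contract_add_right, contract_symm hK hBodd hFodd, pairForm_eq]
    rw [two_smul]
    abel
  have h4 : ∀ a' : Fin 6, TwoForm.lmul ((if a = a' then 1 else 0) - (2 : ℝ) • sq h a' a)
        (pairForm R (R.γup a') (act R.P Ψ) (act R.P Ψ)) =
      (if a = a' then pairForm R (R.γup a') (act R.P Ψ) (act R.P Ψ) else 0) +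
      TwoForm.lmul (-((2 : ℝ) • sq h a' a)) (pairForm R (R.γup a') (act R.P Ψ) (act R.P Ψ)) := by
    intro a'
    funext i j D D'
    split_ifs <;> simp [TwoForm.lmul, sub_eq_add_neg, add_mul]
  rw [h3]
  simp only [h4, Finset.sum_add_distrib, Finset.sum_ite_eq, Finset.mem_univ, if_true]
  rw [hF, contract_fermionic hψ hφ.isCoframe.proj hh hsd a, hB,
    contract_pullback_odd he hψ _ hφ.parity10 heven, contract_bosonic he R (R.γup a) τ, smul_neg]
  abel

theorem torsionConstraint_tangential_iff (hφ : IsM5Immersion R E Ψ Sh00 Sh01 H τ)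
    {h : Fin 6 → Fin 6 → Fin 6 → A} (hh : IsThreeForm h) (hsd : h = hodge h)
    (hH : H = slash R h * toFn R.P) (Ω : Idx → Idx → OneForm A) (a : Fin 6) :
    TorsionConstraint R E Ψ Ω (Sum.inl a) ↔
      WorldvolumeTorsion R (fun a => E (Sum.inl a)) (act R.P Ψ)
        (fun b c => Ω (Sum.inl b) (Sum.inl c)) τ h a := by
  have h1 : d (E (Sum.inl a)) + ∑ b, wedge (Ω (Sum.inl a) b) (E b) =
      d (E (Sum.inl a)) + ∑ b, wedge (Ω (Sum.inl a) (Sum.inl b)) (E (Sum.inl b)) := by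
    rw [Fintype.sum_sum_type]
    simp only [hφ.transversal_eq_zero, wedge_zero_right, Finset.sum_const_zero, add_zero]
  rw [TorsionConstraint, WorldvolumeTorsion, hφ.pairForm_tangential hh hsd hH, h1, eq_comm]

theorem torsionConstraint_transversal (hφ : IsM5Immersion R E Ψ Sh00 Sh01 H τ)
    {Ω : Idx → Idx → OneForm A} {II0 : Fin 5 → Fin 6 → Fin 6 → A}
    {II1 : Fin 5 → Fin 32 → Fin 6 → A}
    (hII : IsSecondFundamental R (fun a => E (Sum.inl a)) (act R.P Ψ) Ω II0 II1) :
    (∀ a : Fin 5, TorsionConstraint R E Ψ Ω (Sum.inr a)) ↔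
      (∀ a b₁ b₂, II0 a b₁ b₂ = II0 a b₂ b₁) ∧
      (∀ a b α, lower R (τ b) α = (1 / 2 : ℝ) • ΓII R II1 a α b) ∧
      (∃ H₃ : Fin 6 → Fin 6 → Fin 6 → A, IsThreeForm H₃ ∧ H₃ = hodge H₃ ∧
        H = slash R H₃ * toFn R.P) := by
  simp only [hφ.torsionConstraint_transversal_iff hII]
  have hτ : ∀ i b, (∀ α, (2 : ℝ) • ∑ β, (R.C * R.Γ (Sum.inr i)) α β • τ b β = II1 i α b) ↔
      ∀ α, lower R (τ b) α = (1 / 2 : ℝ) • ΓII R II1 i α b := fun i b => by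
    have := lower_eq_iff R i (τ b) fun α => II1 i α b
    rw [funext_iff, funext_iff] at this
    exact this
  constructor
  · intro h
    -- A single transversal index, here the first, already determines the form of `H`; conversely
    -- that form yields skewness for every index.
    exact ⟨fun a b₁ b₂ => (h a).2.2 b₁ b₂, fun a b => (hτ a b).1 fun α => (h a).2.1 α b,
      exists_threeForm R hφ.parity11 hφ.dom11 hφ.shear_comm 0 (h 0).1⟩
  · rintro ⟨h1, h2, h3, hh, -, rfl⟩ i
    exact ⟨slash_P_skew R hh i, fun α b => (hτ i b).2 (h2 i b) α, h1 i⟩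

end IsM5Immersion

end M5

end

theorem mainTheorem2 (R : M5.Majorana)
    (S : M5.Supermanifold.{u} 6 16) (X : M5.Supermanifold.{v} 11 32) (φ : S.Hom X)
    (U : TopologicalSpace.Opens S.M) (V : TopologicalSpace.Opens X.M) (hUV : U ≤ V.comap φ.base)
    -- the target super-spacetime geometry
    (EX : M5.Idx → M5.OneForm (X.fn V)) (ΨX : Fin 32 → M5.OneForm (X.fn V))
    (ΩX : M5.Idx → M5.Idx → M5.OneForm (X.fn V)) (hX : M5.IsSpacetime EX ΨX ΩX)
    -- its pullback to the worldvolume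
    (E : M5.Idx → M5.OneForm (S.fn U)) (Ψ : Fin 32 → M5.OneForm (S.fn U))
    (Ω : M5.Idx → M5.Idx → M5.OneForm (S.fn U))
    (hE : ∀ a, M5.IsPullback (φ.pullTo hUV) (EX a) (E a))
    (hΨ : ∀ α, M5.IsPullback (φ.pullTo hUV) (ΨX α) (Ψ α))
    (hΩ : ∀ a b, M5.IsPullback (φ.pullTo hUV) (ΩX a b) (Ω a b))
    -- the super-shear map
    (Sh00 : Fin 5 → Fin 6 → S.fn U) (Sh01 : Fin 5 → Fin 32 → S.fn U)
    (H : Matrix (Fin 32) (Fin 32) (S.fn U)) (τ : Fin 6 → Fin 32 → S.fn U)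
    (hφ : M5.IsM5Immersion R E Ψ Sh00 Sh01 H τ)
    -- the induced worldvolume co-frame
    (e : Fin 6 → M5.OneForm (S.fn U)) (he : e = fun a => E (Sum.inl a))
    (ψ : Fin 32 → M5.OneForm (S.fn U)) (hψ : ψ = M5.act R.P Ψ)
    -- the second fundamental super-form
    (II0 : Fin 5 → Fin 6 → Fin 6 → S.fn U) (II1 : Fin 5 → Fin 32 → Fin 6 → S.fn U)
    (hII : M5.IsSecondFundamental R e ψ Ω II0 II1) :
    ((∀ a : Fin 5, M5.TorsionConstraint R E Ψ Ω (Sum.inr a)) ↔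
      (∀ a b₁ b₂, II0 a b₁ b₂ = II0 a b₂ b₁) ∧
      (∀ a b α, M5.lower R (τ b) α = (1 / 2 : ℝ) • M5.ΓII R II1 a α b) ∧
      (∃ H₃ : Fin 6 → Fin 6 → Fin 6 → S.fn U, M5.IsThreeForm H₃ ∧ H₃ = M5.hodge H₃ ∧
        H = M5.slash R H₃ * M5.toFn R.P)) ∧
    (∀ H₃ : Fin 6 → Fin 6 → Fin 6 → S.fn U, M5.IsThreeForm H₃ → H₃ = M5.hodge H₃ →
      H = M5.slash R H₃ * M5.toFn R.P →
      ((∀ a : Fin 6, M5.TorsionConstraint R E Ψ Ω (Sum.inl a)) ↔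
        ∀ a : Fin 6, M5.WorldvolumeTorsion R e ψ
          (fun b c => Ω (Sum.inl b) (Sum.inl c)) τ H₃ a)) := by
  subst he hψ
  exact ⟨hφ.torsionConstraint_transversal hII, fun H₃ h1 h2 h3 =>
    forall_congr' fun a => hφ.torsionConstraint_tangential_iff h1 h2 h3 Ω a⟩
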